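/- Let $p>2$ be a prime and let $E/\mathbf{Q}$ be an elliptic curve with good reduction at $p$, given by a Weierstrass equation $y^2+a_1xy+a_3y=x^3+a_2x^2+a_4x+a_6$ with integral coefficients and discriminant prime to $p$. Put $a_p(E)=p+1-\#E(\mathbf{F}_p)$. Let $K$ be an imaginary quadratic field in which $p=\mathfrak{p}\bar{\mathfrak{p}}$ splits, with $\mathfrak{p}\ne\bar{\mathfrak{p}}$, and identify the ring of integers of $K_{\mathfrak{p}}$ with $\mathbf{Z}_p$. Write $E(K_{\mathfrak p})\hat\otimes\mathbf{Z}_p=\varprojlim_n E(K_{\mathfrak p})/p^nE(K_{\mathfrak p})$ for the $p$-adic completion. Let $T=T_pE$ and let $S_p(E/K)\subset H^1(K,T)$ be the pro-$p$ Selmer group, i.e. the group of classes in continuous cohomology whose image in $H^1(K,E[p^n])$ lies in the $p^n$-Selmer group of $E/K$ for all $n$. Let $\mathrm{loc}_{\mathfrak p}:S_p(E/K)\to E(K_{\mathfrak p})\hat\otimes\mathbf{Z}_p$ be the map given by restriction to $H^1(K_{\mathfrak p},T)$ and the Kummer map, and let $\mathrm{loc}_{\mathfrak p}$ also denote the natural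 map $E(K)\otimes\mathbf{Z}_p\to E(K_{\mathfrak p})\hat\otimes\mathbf{Z}_p$. Let $\omega_E=u\,\frac{dx}{2y+a_1x+a_3}$ with $u\in\mathbf{Z}_{(p)}^\times$ be a N\'eron differential over $\mathbf{Z}_{(p)}$, and let $\log_{\omega_E}$ be the associated formal group logarithm: it is defined on the kernel of reduction $E_1(K_{\mathfrak p})$ by integrating the expansion of $\omega_E$ in the parameter $z=-x/y$, is extended to $E(K_{\mathfrak p})$ by $\log_{\omega_E}(P)=m^{-1}\log_{\omega_E}(mP)$ with $m=\#E(\mathbf{F}_p)$, then by continuity to $E(K_{\mathfrak p})\hat\otimes\mathbf{Z}_p$, and finally to $E(K)\otimes\mathbf{Z}_p$ by composition with $\mathrm{loc}_{\mathfrak p}$. Assume that the $p$-primary part of the Tate--Shafarevich group of $E/K$ is finite and that $a_p(E)\not\equiv 1\pmod p$. Let $y_1,\dots,y_{r-1},y_{\mathfrak p}$ ($r\geq 1$) be a $\mathbf{Z}_p$-basis of $E(K)\otimes\mathbf{Z}_p$ such that $y_1,\dots,y_{r-1}$ is a $\mathbf{Z}_p$-basis of the kernel of $\mathrm{loc}_{\mathfrak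 p}:E(K)\otimes\mathbf{Z}_p\to E(K_{\mathfrak p})\hat\otimes\mathbf{Z}_p$ (the strict Selmer group). Then $\log_{\omega_E}(y_{\mathfrak p})\in\mathbf{Z}_p$, the cokernel of $\mathrm{loc}_{\mathfrak p}:S_p(E/K)\to E(K_{\mathfrak p})\hat\otimes\mathbf{Z}_p$ and the group $\mathbf{Z}_p/\log_{\omega_E}(y_{\mathfrak p})\mathbf{Z}_p$ are finite, and $$\#\mathrm{coker}(\mathrm{loc}_{\mathfrak p})=p^{-1}\cdot\#\bigl(\mathbf{Z}_p/\log_{\omega_E}(y_{\mathfrak p})\mathbf{Z}_p\bigr).$$ -/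

import Mathlib

open scoped TensorProduct NumberField Topology
open IsDedekindDomain NumberField

noncomputable section

namespace EllSelmer

/-! ### First continuous cohomology, by continuous crossed homomorphisms -/

section Cohomology

variable (G A : Type*) [Group G] [TopologicalSpace G] [AddCommGroup A] [DistribMulAction G A]
  [TopologicalSpace A] [IsTopologicalAddGroup A]

/-- Continuous 1-cocycles `f : G → A`, that is `f (σ τ) = f σ + σ • f τ`. -/
def Z1 : AddSubgroup (G → A) where
  carrier := {f | Continuous f ∧ ∀ σ τ, f (σ * τ) = f σ + σ • f τ}
  zero_mem' := ⟨continuous_const, fun _ _ => by simp⟩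
  add_mem' := by
    rintro f g ⟨hf, hf'⟩ ⟨hg, hg'⟩
    refine ⟨hf.add hg, fun σ τ => ?_⟩
    simp only [Pi.add_apply, hf', hg', smul_add]
    abel
  neg_mem' := by
    rintro f ⟨hf, hf'⟩
    refine ⟨hf.neg, fun σ τ => ?_⟩
    simp only [Pi.neg_apply, hf', smul_neg]
    abel

/-- The cocycles that are coboundaries `σ ↦ σ • a - a`. -/
def B1 : AddSubgroup (Z1 G A) where
  carrier := {f | ∃ a : A, ∀ σ, f.1 σ = σ • a - a}
  zero_mem' := ⟨0, fun _ => by simp⟩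
  add_mem' := by
    rintro f g ⟨a, ha⟩ ⟨b, hb⟩
    refine ⟨a + b, fun σ => ?_⟩
    simp only [AddSubgroup.coe_add, Pi.add_apply, ha, hb, smul_add]
    abel
  neg_mem' := by
    rintro f ⟨a, ha⟩
    refine ⟨-a, fun σ => ?_⟩
    simp only [AddSubgroup.coe_neg, Pi.neg_apply, ha, smul_neg]
    abel

/-- The continuous cohomology group `H¹(G, A)`. -/
abbrev H1 : Type _ := Z1 G A ⧸ B1 G A

variable {G A}
variable {H B : Type*} [Group H] [TopologicalSpace H] [AddCommGroup B] [DistribMulAction H B]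
  [TopologicalSpace B] [IsTopologicalAddGroup B]

/-- `f ↦ g ∘ f ∘ φ` on cocycles. -/
def Z1.map (φ : H →* G) (hφ : Continuous φ) (g : A →+ B) (hg : Continuous g)
    (hgφ : ∀ h a, g (φ h • a) = h • g a) : Z1 G A →+ Z1 H B where
  toFun f := ⟨fun h => g (f.1 (φ h)), hg.comp (f.2.1.comp hφ), fun σ τ => by
    change g (f.1 (φ (σ * τ))) = g (f.1 (φ σ)) + σ • g (f.1 (φ τ))
    rw [map_mul, f.2.2, map_add, hgφ]⟩
  map_zero' := by ext; simp
  map_add' f f' := by ext; simp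

/-- The map `H¹(G, A) → H¹(H, B)` induced by a continuous homomorphism `φ : H → G` and a
compatible continuous homomorphism `g : A → B`. -/
def H1.map (φ : H →* G) (hφ : Continuous φ) (g : A →+ B) (hg : Continuous g)
    (hgφ : ∀ h a, g (φ h • a) = h • g a) : H1 G A →+ H1 H B :=
  QuotientAddGroup.map _ _ (Z1.map φ hφ g hg hgφ) (by
    rintro f ⟨a, ha⟩
    refine ⟨g a, fun σ => ?_⟩
    change g (f.1 (φ σ)) = _
    rw [ha, map_sub, hgφ])

end Cohomology

/-! ### Points and Galois groups -/

section Points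

variable (W : WeierstrassCurve ℤ)

/-- The group `E(F)` of the `F`-rational points of the curve `E` with Weierstrass equation `W`. -/
def Pt (F : Type*) [Field F] : Type _ := (W.baseChange F).toAffine.Point

instance (F : Type*) [Field F] : AddCommGroup (Pt W F) :=
  letI := Classical.decEq F
  inferInstanceAs (AddCommGroup (W.baseChange F).toAffine.Point)

/-- The homomorphism `E(F) → E(L)` induced by a homomorphism of fields `F → L`. -/
def Pt.map {F L : Type*} [Field F] [Field L] (f : F →+* L) : Pt W F →+ Pt W L :=
  letI := Classical.decEq F
  letI := Classical.decEq L
  WeierstrassCurve.Affine.Point.map (W' := W.toAffine) (S := ℤ) f.toIntAlgHom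

theorem Pt.map_injective {F L : Type*} [Field F] [Field L] (f : F →+* L) :
    Function.Injective (Pt.map W f) := by
  let := Classical.decEq F
  let := Classical.decEq L
  exact WeierstrassCurve.Affine.Point.map_injective (W' := W.toAffine) (S := ℤ) f.toIntAlgHom

theorem Pt.map_map {F L M : Type*} [Field F] [Field L] [Field M] (f : F →+* L) (g : L →+* M)
    (P : Pt W F) : Pt.map W g (Pt.map W f P) = Pt.map W (g.comp f) P := by
  cases P <;> rfl

theorem Pt.map_id {F : Type*} [Field F] (P : Pt W F) : Pt.map W (RingHom.id F) P = P := by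
  cases P <;> rfl

/-- The absolute Galois group, with the Krull topology. -/
abbrev Gal (F : Type*) [Field F] : Type _ := AlgebraicClosure F ≃ₐ[F] AlgebraicClosure F

/-- The group `E(F̄)`, with the discrete topology. -/
def GPt (F : Type*) [Field F] : Type _ := Pt W (AlgebraicClosure F)

variable (F : Type*) [Field F]

instance : AddCommGroup (GPt W F) := inferInstanceAs (AddCommGroup (Pt W (AlgebraicClosure F)))

instance : TopologicalSpace (GPt W F) := ⊥

instance : DiscreteTopology (GPt W F) := ⟨rfl⟩

/-- The Galois action on `E(F̄)`. -/
instance : DistribMulAction (Gal F) (GPt W F) where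
  smul σ P := Pt.map W (σ : AlgebraicClosure F →+* AlgebraicClosure F) P
  one_smul P := Pt.map_id W P
  mul_smul σ τ P := (Pt.map_map W (τ : AlgebraicClosure F →+* AlgebraicClosure F)
    (σ : AlgebraicClosure F →+* AlgebraicClosure F) P).symm
  smul_zero σ := (Pt.map W (σ : AlgebraicClosure F →+* AlgebraicClosure F)).map_zero
  smul_add σ P Q := (Pt.map W (σ : AlgebraicClosure F →+* AlgebraicClosure F)).map_add P Q

theorem GPt.smul_def (σ : Gal F) (P : GPt W F) :
    σ • P = Pt.map W (σ : AlgebraicClosure F →+* AlgebraicClosure F) P := rfl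

/-- The inclusion `E(F) → E(F̄)`. -/
def Pt.toGPt : Pt W F →+ GPt W F := Pt.map W (algebraMap F (AlgebraicClosure F))

theorem Pt.toGPt_injective : Function.Injective (Pt.toGPt W F) := Pt.map_injective W _

/-- A Galois invariant point of `E(F̄)` is rational. -/
theorem GPt.exists_of_fixed [CharZero F] (P : GPt W F) (h : ∀ σ : Gal F, σ • P = P) :
    ∃ Q : Pt W F, Pt.toGPt W F Q = P := by
  let := Classical.decEq F
  let := Classical.decEq (AlgebraicClosure F)
  rcases P with _ | ⟨x, y, hxy⟩
  · exact ⟨0, map_zero _⟩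
  · have hx : ∀ σ : Gal F, σ x = x ∧ σ y = y := fun σ =>
      ⟨(WeierstrassCurve.Affine.Point.some.inj (h σ)).1,
        (WeierstrassCurve.Affine.Point.some.inj (h σ)).2⟩
    obtain ⟨a, rfl⟩ :=
      (InfiniteGalois.mem_range_algebraMap_iff_fixed (k := F) x).2 fun σ => (hx σ).1
    obtain ⟨b, rfl⟩ :=
      (InfiniteGalois.mem_range_algebraMap_iff_fixed (k := F) y).2 fun σ => (hx σ).2
    have hab : (W.baseChange F).toAffine.Nonsingular a b :=
      (WeierstrassCurve.Affine.baseChange_nonsingular (W := W.toAffine) (S := ℤ)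
        (f := (algebraMap F (AlgebraicClosure F)).toIntAlgHom)
        (algebraMap F (AlgebraicClosure F)).injective a b).1 hxy
    exact ⟨WeierstrassCurve.Affine.Point.some a b hab, rfl⟩

/-! ### The Tate module -/

/-- The `p`-adic Tate module `T = lim E[pⁿ]`: sequences `t` in `E(F̄)` with `t 0 = 0` and
`p • t (n + 1) = t n`, so that `t n ∈ E[pⁿ]`. -/
def Tate (p : ℕ) : AddSubgroup (ℕ → GPt W F) where
  carrier := {t | t 0 = 0 ∧ ∀ n, p • t (n + 1) = t n}
  zero_mem' := ⟨rfl, fun _ => by simp⟩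
  add_mem' := by
    rintro s t ⟨hs, hs'⟩ ⟨ht, ht'⟩
    exact ⟨by simp [hs, ht], fun n => by simp only [Pi.add_apply, smul_add, hs', ht']⟩
  neg_mem' := by
    rintro t ⟨ht, ht'⟩
    exact ⟨by simp [ht], fun n => by simp only [Pi.neg_apply, smul_neg, ht']⟩

instance (p : ℕ) : DistribMulAction (Gal F) (Tate W F p) where
  smul σ t := ⟨fun n => σ • t.1 n, by
    refine ⟨(congrArg (σ • ·) t.2.1).trans (smul_zero σ), fun n => ?_⟩
    change p • (σ • t.1 (n + 1)) = σ • t.1 n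
    rw [← t.2.2 n]
    exact ((DistribSMul.toAddMonoidHom (GPt W F) σ).map_nsmul _ _).symm⟩
  one_smul t := Subtype.ext (funext fun n => one_smul _ (t.1 n))
  mul_smul σ τ t := Subtype.ext (funext fun n => mul_smul σ τ (t.1 n))
  smul_zero σ := Subtype.ext (funext fun _ => smul_zero σ)
  smul_add σ s t := Subtype.ext (funext fun n => smul_add σ (s.1 n) (t.1 n))

/-- The projection `T → E[pⁿ] ⊆ E(F̄)`. -/
def Tate.proj (p n : ℕ) : Tate W F p →+ GPt W F :=
  (Pi.evalAddMonoidHom (fun _ : ℕ => GPt W F) n).comp (Tate W F p).subtype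

theorem Tate.continuous_proj (p n : ℕ) : Continuous (Tate.proj W F p n) :=
  (continuous_apply n).comp continuous_subtype_val

theorem Tate.pow_nsmul_proj (p n : ℕ) (t : Tate W F p) : p ^ n • Tate.proj W F p n t = 0 := by
  induction n with
  | zero => rw [pow_zero, one_smul]; exact t.2.1
  | succ n ih => rw [pow_succ, mul_smul]; exact (congrArg _ (t.2.2 n)).trans ih

/-- The map `H¹(F, T) → H¹(F, E)` given by the projection `T → E[pⁿ]`. -/
def H1.proj (p n : ℕ) : H1 (Gal F) (Tate W F p) →+ H1 (Gal F) (GPt W F) :=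
  H1.map (MonoidHom.id _) continuous_id (Tate.proj W F p n) (Tate.continuous_proj W F p n)
    fun _ _ => rfl

end Points

/-! ### Restriction to an extension field -/

section Restriction

variable (W : WeierstrassCurve ℤ) (K F : Type*) [Field K] [Field F] [Algebra K F]

/-- An embedding `K̄ → F̄` over `K`. -/
def closureEmb : AlgebraicClosure K →ₐ[K] AlgebraicClosure F :=
  IsAlgClosed.lift

/-- The restriction homomorphism `Gal(F̄/F) → Gal(K̄/K)`. -/
def resGal : Gal F →* Gal K :=
  letI : Algebra (AlgebraicClosure K) (AlgebraicClosure F) := (closureEmb K F).toRingHom.toAlgebra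
  haveI : IsScalarTower K (AlgebraicClosure K) (AlgebraicClosure F) :=
    IsScalarTower.of_algebraMap_eq fun x => ((closureEmb K F).commutes x).symm
  (AlgEquiv.restrictNormalHom (F := K) (K₁ := AlgebraicClosure F) (AlgebraicClosure K)).comp
    (AlgEquiv.restrictScalarsHom K)

theorem closureEmb_resGal (σ : Gal F) (x : AlgebraicClosure K) :
    closureEmb K F (resGal K F σ x) = σ (closureEmb K F x) := by
  let : Algebra (AlgebraicClosure K) (AlgebraicClosure F) := (closureEmb K F).toRingHom.toAlgebra
  have : IsScalarTower K (AlgebraicClosure K) (AlgebraicClosure F) :=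
    IsScalarTower.of_algebraMap_eq fun x => ((closureEmb K F).commutes x).symm
  exact AlgEquiv.restrictNormal_commutes (AlgEquiv.restrictScalars K σ) (AlgebraicClosure K) x

theorem continuous_resGal : Continuous (resGal K F) := by
  refine continuous_of_continuousAt_one _ ?_
  rw [ContinuousAt, map_one]
  intro s hs
  obtain ⟨E, hE, hEs⟩ := (krullTopology_mem_nhds_one_iff _ _ _).1 hs
  let b := Module.finBasis K E
  let S : Set (AlgebraicClosure F) := Set.range fun i => closureEmb K F (b i)
  refine (krullTopology_mem_nhds_one_iff _ _ _).2 ⟨IntermediateField.adjoin F S,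
    IntermediateField.finiteDimensional_adjoin fun x _ => Algebra.IsIntegral.isIntegral x, ?_⟩
  intro σ hσ
  refine hEs ((IntermediateField.mem_fixingSubgroup_iff _ _).2 fun x hx => ?_)
  have hb : ∀ i, resGal K F σ (b i) = b i := fun i => by
    refine (closureEmb K F).injective ((closureEmb_resGal K F σ (b i)).trans ?_)
    exact (IntermediateField.mem_fixingSubgroup_iff _ _).1 hσ _
      (IntermediateField.subset_adjoin F S ⟨i, rfl⟩)
  have key : (resGal K F σ).toLinearMap ∘ₗ E.val.toLinearMap = E.val.toLinearMap :=
    b.ext fun i => hb i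
  exact LinearMap.congr_fun key ⟨x, hx⟩

/-- The map `E(K̄) → E(F̄)`. -/
def GPt.emb : GPt W K →+ GPt W F :=
  Pt.map W (closureEmb K F : AlgebraicClosure K →+* AlgebraicClosure F)

theorem GPt.emb_smul (σ : Gal F) (P : GPt W K) :
    GPt.emb W K F (resGal K F σ • P) = σ • GPt.emb W K F P := by
  refine (Pt.map_map W _ _ P).trans (Eq.trans ?_ (Pt.map_map W _ _ P).symm)
  congr 1
  congr 1
  exact RingHom.ext fun x => closureEmb_resGal K F σ x

/-- The restriction map `H¹(K, E) → H¹(F, E)`. -/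
def H1.res : H1 (Gal K) (GPt W K) →+ H1 (Gal F) (GPt W F) :=
  H1.map (resGal K F) (continuous_resGal K F) (GPt.emb W K F) continuous_of_discreteTopology
    (GPt.emb_smul W K F)

end Restriction

/-! ### Selmer and Tate--Shafarevich groups -/

section Selmer

variable (W : WeierstrassCurve ℤ) (K : Type*) [Field K] [NumberField K]

/-- The Tate--Shafarevich group: the classes in `H¹(K, E)` that are trivial in `H¹(K_v, E)` for
all finite and infinite places `v` of `K`. -/
def Sha : AddSubgroup (H1 (Gal K) (GPt W K)) :=
  (⨅ v : HeightOneSpectrum (𝓞 K), (H1.res W K (v.adicCompletion K)).ker) ⊓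
    ⨅ v : InfinitePlace K, (H1.res W K v.Completion).ker

/-- The pro-`p` Selmer group `S_p(E/K) ⊆ H¹(K, T)`: the classes whose image in `H¹(K, E[pⁿ])`
lies in the `pⁿ`-Selmer group for all `n`, i.e. maps to zero in all `H¹(K_v, E)`. -/
def Sel (p : ℕ) : AddSubgroup (H1 (Gal K) (Tate W K p)) :=
  ⨅ n : ℕ, (Sha W K).comap (H1.proj W K p n)

end Selmer

/-! ### The restriction map on the Selmer group -/

section Localization

variable (W : WeierstrassCurve ℤ) (p : ℕ) [Fact p.Prime]

/-- `E(F) ⊗ ℤ_p`. -/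
abbrev PtZp (F : Type*) [Field F] : Type _ := ℤ_[p] ⊗[ℤ] Pt W F

/-- The `p`-adic completion `lim (E(F) ⊗ ℤ_p) / pⁿ = lim E(F) / pⁿ`. -/
abbrev PtHat (F : Type*) [Field F] : Type _ :=
  AdicCompletion (Ideal.span {(p : ℤ_[p])}) (PtZp W p F)

variable {W p}

/-- `x` is the class of `(P n mod pⁿ)ₙ`. -/
def Represents {F : Type*} [Field F] (x : PtHat W p F) (P : ℕ → Pt W F) : Prop :=
  ∀ n, AdicCompletion.eval (Ideal.span {(p : ℤ_[p])}) (PtZp W p F) n x =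
    Submodule.Quotient.mk ((1 : ℤ_[p]) ⊗ₜ[ℤ] P n)

variable (W p)

theorem tmul_pow_nsmul_mem {F : Type*} [Field F] (n : ℕ) (R : Pt W F) :
    (1 : ℤ_[p]) ⊗ₜ[ℤ] (p ^ n • R) ∈
      (Ideal.span {(p : ℤ_[p])} ^ n • ⊤ : Submodule ℤ_[p] (PtZp W p F)) := by
  have h : (1 : ℤ_[p]) ⊗ₜ[ℤ] (p ^ n • R) = (p : ℤ_[p]) ^ n • ((1 : ℤ_[p]) ⊗ₜ[ℤ] R) := by
    rw [TensorProduct.tmul_smul, ← Nat.cast_pow, Nat.cast_smul_eq_nsmul]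
  rw [h]
  exact Submodule.smul_mem_smul
    (Ideal.pow_mem_pow (Ideal.mem_span_singleton_self _) n) Submodule.mem_top

variable (K F : Type*) [Field K] [Field F] [Algebra K F]

/-- The natural map `E(K) ⊗ ℤ_p → E(F) ⊗ ℤ_p`, with values in the `p`-adic completion. -/
def locPt : PtZp W p K →ₗ[ℤ_[p]] PtHat W p F :=
  AdicCompletion.of (Ideal.span {(p : ℤ_[p])}) (PtZp W p F) ∘ₗ
    (Pt.map W (algebraMap K F)).toIntLinearMap.baseChange ℤ_[p]

/-- The restriction of `c ∈ H¹(K, T)` to `H¹(F, T)` is the image of `x` under the Kummer map: at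
level `n` it is the class of `σ ↦ σ Q - Q`, where `pⁿ Q` is a point of `E(F)` that represents `x`
modulo `pⁿ`. -/
def IsLoc (c : H1 (Gal K) (Tate W K p)) (x : PtHat W p F) : Prop :=
  ∃ (ξ : Z1 (Gal K) (Tate W K p)) (P : ℕ → Pt W F) (Q : ℕ → GPt W F),
    QuotientAddGroup.mk ξ = c ∧ Represents x P ∧ (∀ n, Pt.toGPt W F (P n) = p ^ n • Q n) ∧
      ∀ n (σ : Gal F),
        GPt.emb W K F (Tate.proj W K p n (ξ.1 (resGal K F σ))) = σ • Q n - Q n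

variable {W p K F}

theorem IsLoc.add {c c' : H1 (Gal K) (Tate W K p)} {x x' : PtHat W p F}
    (h : IsLoc W p K F c x) (h' : IsLoc W p K F c' x') : IsLoc W p K F (c + c') (x + x') := by
  obtain ⟨ξ, P, Q, rfl, hx, hP, hQ⟩ := h
  obtain ⟨ξ', P', Q', rfl, hx', hP', hQ'⟩ := h'
  refine ⟨ξ + ξ', P + P', Q + Q', rfl, fun n => ?_, fun n => ?_, fun n σ => ?_⟩
  · rw [map_add, hx n, hx' n, Pi.add_apply, TensorProduct.tmul_add, Submodule.Quotient.mk_add]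
  · simp only [Pi.add_apply, map_add, hP, hP', smul_add]
  · simp only [AddSubgroup.coe_add, Pi.add_apply, map_add, hQ, hQ', smul_add]
    abel

theorem represents_unique {x x' : PtHat W p F} {P P' : ℕ → Pt W F} (hx : Represents x P)
    (hx' : Represents x' P') (h : ∀ n, ∃ R : Pt W F, P n - P' n = p ^ n • R) : x = x' := by
  refine AdicCompletion.ext fun n => ?_
  obtain ⟨R, hR⟩ := h n
  refine (hx n).trans (Eq.trans ?_ (hx' n).symm)
  rw [Submodule.Quotient.eq, ← TensorProduct.tmul_sub, hR]
  exact tmul_pow_nsmul_mem W p n R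

theorem exists_represents_of_cauchy {P : ℕ → Pt W F}
    (h : ∀ n, ∃ R : Pt W F, P n - P (n + 1) = p ^ n • R) : ∃ x : PtHat W p F, Represents x P := by
  refine ⟨AdicCompletion.mk _ _ (AdicCompletion.AdicCauchySequence.mk _ _
    (fun n => (1 : ℤ_[p]) ⊗ₜ[ℤ] P n) fun n => ?_), fun n => rfl⟩
  obtain ⟨R, hR⟩ := h n
  rw [SModEq.sub_mem, ← TensorProduct.tmul_sub, hR]
  exact tmul_pow_nsmul_mem W p n R

theorem IsLoc.unique [CharZero K] {c : H1 (Gal K) (Tate W K p)} {x x' : PtHat W p F}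
    (h : IsLoc W p K F c x) (h' : IsLoc W p K F c x') : x = x' := by
  have : CharZero F := charZero_of_injective_algebraMap (algebraMap K F).injective
  obtain ⟨ξ, P, Q, rfl, hx, hP, hQ⟩ := h
  obtain ⟨ξ', P', Q', hξ, hx', hP', hQ'⟩ := h'
  obtain ⟨t, ht⟩ : -ξ' + ξ ∈ B1 (Gal K) (Tate W K p) := QuotientAddGroup.eq.1 hξ
  refine represents_unique hx hx' fun n => ?_
  let e := GPt.emb W K F (Tate.proj W K p n t)
  have he : p ^ n • e = 0 := by
    rw [← map_nsmul, Tate.pow_nsmul_proj, map_zero]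
  obtain ⟨R, hR⟩ := GPt.exists_of_fixed W F (Q n - Q' n - e) fun σ => by
    have h1 : GPt.emb W K F (Tate.proj W K p n (-ξ'.1 (resGal K F σ) + ξ.1 (resGal K F σ))) =
        σ • e - e := by
      refine (congrArg (fun s => GPt.emb W K F (Tate.proj W K p n s)) (ht (resGal K F σ))).trans ?_
      rw [map_sub, map_sub]
      exact congrArg (· - e) (GPt.emb_smul W K F σ _)
    rw [map_add, map_neg, map_add, map_neg, hQ, hQ'] at h1
    rw [smul_sub, smul_sub]
    have h2 : σ • e = e + (-(σ • Q' n - Q' n) + (σ • Q n - Q n)) := by rw [h1]; abel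
    rw [h2]
    abel
  refine ⟨R, Pt.toGPt_injective W F ?_⟩
  rw [map_sub, map_nsmul, hR, hP, hP', smul_sub, smul_sub, he, sub_zero]

theorem exists_isLoc [CharZero K] (c : H1 (Gal K) (Tate W K p))
    (hc : ∀ n, H1.res W K F (H1.proj W K p n c) = 0) : ∃ x, IsLoc W p K F c x := by
  have : CharZero F := charZero_of_injective_algebraMap (algebraMap K F).injective
  obtain ⟨ξ, rfl⟩ := QuotientAddGroup.mk_surjective c
  have hQ : ∀ n, ∃ Q : GPt W F, ∀ σ : Gal F,
      GPt.emb W K F (Tate.proj W K p n (ξ.1 (resGal K F σ))) = σ • Q - Q := fun n => by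
    obtain ⟨Q, hQ⟩ := (QuotientAddGroup.eq_zero_iff _).1 (hc n)
    exact ⟨Q, hQ⟩
  choose Q hQ using hQ
  have hP : ∀ n, ∃ P : Pt W F, Pt.toGPt W F P = p ^ n • Q n := fun n => by
    refine GPt.exists_of_fixed W F _ fun σ => ?_
    have h1 : p ^ n • (σ • Q n - Q n) = 0 := by
      rw [← hQ, ← map_nsmul, Tate.pow_nsmul_proj, map_zero]
    rw [smul_sub, sub_eq_zero] at h1
    exact ((DistribSMul.toAddMonoidHom (GPt W F) σ).map_nsmul _ _).trans h1
  choose P hP using hP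
  obtain ⟨x, hx⟩ := exists_represents_of_cauchy (P := P) fun n => by
    obtain ⟨R, hR⟩ := GPt.exists_of_fixed W F (Q n - p • Q (n + 1)) fun σ => by
      have h1 : p • (σ • Q (n + 1) - Q (n + 1)) = σ • Q n - Q n := by
        rw [← hQ, ← hQ, ← map_nsmul]
        exact congrArg (GPt.emb W K F) ((ξ.1 (resGal K F σ)).2.2 n)
      have h2 : σ • (p • Q (n + 1)) = p • (σ • Q (n + 1)) :=
        (DistribSMul.toAddMonoidHom (GPt W F) σ).map_nsmul _ _
      rw [smul_sub] at h1
      have h3 : σ • Q n = Q n + (p • σ • Q (n + 1) - p • Q (n + 1)) := by rw [h1]; abel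
      rw [smul_sub, h2, h3]
      abel
    refine ⟨R, Pt.toGPt_injective W F ?_⟩
    rw [map_sub, map_nsmul, hR, hP, hP, smul_sub, pow_succ, mul_smul]
  exact ⟨x, ξ, P, Q, rfl, hx, hP, hQ⟩

theorem exists_represents (x : PtHat W p F) : ∃ P : ℕ → Pt W F, Represents x P := by
  have key : ∀ (n : ℕ) (y : PtZp W p F), ∃ P : Pt W F, y - (1 : ℤ_[p]) ⊗ₜ[ℤ] P ∈
      (Ideal.span {(p : ℤ_[p])} ^ n • ⊤ : Submodule ℤ_[p] (PtZp W p F)) := by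
    intro n y
    induction y using TensorProduct.induction_on with
    | zero => exact ⟨0, by simp⟩
    | tmul a P =>
      refine ⟨a.appr n • P, ?_⟩
      have h : (1 : ℤ_[p]) ⊗ₜ[ℤ] (a.appr n • P) = (a.appr n : ℤ_[p]) • ((1 : ℤ_[p]) ⊗ₜ[ℤ] P) := by
        rw [TensorProduct.tmul_smul, Nat.cast_smul_eq_nsmul]
      have h' : a ⊗ₜ[ℤ] P = a • ((1 : ℤ_[p]) ⊗ₜ[ℤ] P) := by
        rw [TensorProduct.smul_tmul', smul_eq_mul, mul_one]
      rw [h, h', ← sub_smul]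
      refine Submodule.smul_mem_smul ?_ Submodule.mem_top
      rw [Ideal.span_singleton_pow]
      exact PadicInt.appr_spec n a
    | add y z hy hz =>
      obtain ⟨P, hP⟩ := hy
      obtain ⟨R, hR⟩ := hz
      refine ⟨P + R, ?_⟩
      rw [TensorProduct.tmul_add, add_sub_add_comm]
      exact Submodule.add_mem _ hP hR
  have h : ∀ n, ∃ P : Pt W F, AdicCompletion.eval (Ideal.span {(p : ℤ_[p])}) (PtZp W p F) n x =
      Submodule.Quotient.mk ((1 : ℤ_[p]) ⊗ₜ[ℤ] P) := by
    intro n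
    obtain ⟨y, hy⟩ := Submodule.Quotient.mk_surjective _
      (AdicCompletion.eval (Ideal.span {(p : ℤ_[p])}) (PtZp W p F) n x)
    obtain ⟨P, hP⟩ := key n y
    exact ⟨P, hy.symm.trans ((Submodule.Quotient.eq _).2 hP)⟩
  choose P hP using h
  exact ⟨P, hP⟩

end Localization

section LocalizationSel

variable (W : WeierstrassCurve ℤ) (p : ℕ) [Fact p.Prime] {K : Type*} [Field K] [NumberField K]
  (v : HeightOneSpectrum (𝓞 K))

theorem exists_isLoc_of_mem_sel (c : Sel W K p) : ∃ x, IsLoc W p K (v.adicCompletion K) c.1 x := by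
  refine exists_isLoc c.1 fun n => ?_
  have h : H1.proj W K p n c.1 ∈ Sha W K := (AddSubgroup.mem_iInf.1 c.2 n :)
  exact (AddSubgroup.mem_iInf.1 h.1 v :)

/-- The restriction map `loc_v : S_p(E/K) → E(K_v) ⊗ ℤ_p` (completed tensor product). -/
def loc : Sel W K p →+ PtHat W p (v.adicCompletion K) :=
  AddMonoidHom.mk' (fun c => (exists_isLoc_of_mem_sel W p v c).choose) fun c c' =>
    (exists_isLoc_of_mem_sel W p v (c + c')).choose_spec.unique
      ((exists_isLoc_of_mem_sel W p v c).choose_spec.add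
        (exists_isLoc_of_mem_sel W p v c').choose_spec)

theorem loc_spec (c : Sel W K p) : IsLoc W p K (v.adicCompletion K) c.1 (loc W p v c) :=
  (exists_isLoc_of_mem_sel W p v c).choose_spec

end LocalizationSel

/-! ### The formal group logarithm -/

section Log

open PowerSeries

variable (W : WeierstrassCurve ℤ)

/-- In the coordinates `z = -x/y`, `w = -1/y` the Weierstrass equation is `w = wStep w`. -/
def wStep (w : PowerSeries ℤ) : PowerSeries ℤ :=
  X ^ 3 + C W.a₁ * X * w + C W.a₂ * X ^ 2 * w + C W.a₃ * w ^ 2 + C W.a₄ * X * w ^ 2 + C W.a₆ * w ^ 3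

/-- The expansion of `w` in powers of `z` at the origin, the limit of the iterates of `wStep`: the
`n`-th coefficient of the iterates is constant from the `n`-th iterate on. -/
def wSeries : PowerSeries ℤ :=
  PowerSeries.mk fun n => coeff n ((wStep W)^[n] 0)

/-- The expansion `ω(z)` of the invariant differential `dx / (2 y + a₁ x + a₃) = ω(z) dz`; the
relation `w = wStep w` gives `dx / (2 y + a₁ x + a₃) = dz / (1 - ∂(wStep w)/∂w)`. -/
def omegaSeries : PowerSeries ℤ :=
  invOfUnit (1 - (C W.a₁ * X + C W.a₂ * X ^ 2 + 2 * C W.a₃ * wSeries W +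
    2 * C W.a₄ * X * wSeries W + 3 * C W.a₆ * wSeries W ^ 2)) 1

/-- The formal logarithm `∫ ω(z) dz`, evaluated at `t`. -/
def formalLog {F : Type*} [Field F] [TopologicalSpace F] (t : F) : F :=
  ∑' n : ℕ, ((coeff n (omegaSeries W) : ℤ) : F) / ((n : F) + 1) * t ^ (n + 1)

/-- The local parameter `z = -x/y` at the origin. -/
def Pt.z {F : Type*} [Field F] : Pt W F → F
  | .zero => 0
  | .some x y _ => -x / y

/-- `#E(𝔽_p)`, for the reduction of the Weierstrass equation modulo `p`. -/
def numPts (p : ℕ) [Fact p.Prime] : ℕ := Nat.card (Pt W (ZMod p))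

/-- `a_p(E) = p + 1 - #E(𝔽_p)`. -/
def ap (p : ℕ) [Fact p.Prime] : ℤ := p + 1 - numPts W p

/-- The logarithm on `E(F)`, where `F` has residue field `𝔽_p`, associated with the differential
`u dx / (2 y + a₁ x + a₃)`: the formal logarithm on the kernel of reduction `E₁(F)`, extended to
`E(F)` by `log P = m⁻¹ log (m P)` for `m = #E(𝔽_p)`, which maps `E(F)` to `E₁(F)`. -/
def ptLog (p : ℕ) [Fact p.Prime] (u : ℚ) {F : Type*} [Field F] [TopologicalSpace F]
    (P : Pt W F) : F :=
  (u : F) * ((numPts W p : F)⁻¹ * formalLog W (Pt.z W (numPts W p • P)))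

/-- `ℓ` is the value at `x` of the continuous extension of the logarithm to the `p`-adic completion
of `E(F)`. -/
def HasLog {W : WeierstrassCurve ℤ} {p : ℕ} [Fact p.Prime] (u : ℚ) {F : Type*} [Field F]
    [TopologicalSpace F] (x : PtHat W p F) (l : F) : Prop :=
  ∀ P : ℕ → Pt W F, Represents x P →
    Filter.Tendsto (fun n => ptLog W p u (P n)) Filter.atTop (𝓝 l)

end Log

end EllSelmer

end

noncomputable section
namespace EllSelmer

/-! ### Collinear points -/

section Collinear

variable (W : WeierstrassCurve ℤ) {F : Type*} [Field F]

/-! Let `F` be the completion of `K` at `v`; it is `ℚ_p`. Since `m = #E(𝔽_p) = p + 1 - a_p` is prime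
to `p`, the `p`-adic completion of `E(F)` does not see `E(F)/E₁(F)`, and because `p > 2` the formal
logarithm maps `E₁(F)` isomorphically onto `pℤ_p`. So the logarithm extends to an injection of the
completion into `ℤ_p` with image `pℤ_p` (`exists_ptLog_hom`, `hatExt_injective`, `range_hatExt`).
The index `p` of this image is the source of the factor `p⁻¹`. The images of a Selmer class in Sha
form a sequence compatible under multiplication by `p`, which vanishes when the `p`-primary part is
finite. Hence the localization of the class is a limit of localizations of global points. Conversely
each element of `E(K) ⊗ ℤ_p` has a Kummer class in the Selmer group. As the last basis vector spans
`E(K) ⊗ ℤ_p` modulo the kernel of localization, the logarithm sends the image of the Selmer group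
onto the ideal generated by the logarithm `l` of that vector, and `l ≠ 0` (`map_hatExt_range_loc`).
Multiplicativity of indices for `(l) ⊆ (p) ⊆ ℤ_p` gives the formula (`natCard_quotient_range_loc`).
The rest supplies the inputs. Chords in the coordinates `z = -x/y`, `w = -1/y` exist over any
commutative ring for points congruent to the origin modulo an ideal in the Jacobson radical
(`exists_isChord`). Applied to valuation rings, `ℤ_p` and power series rings, this gives the formal
group and, with the affine addition law, the reduction homomorphism (`IsRed.add`). The logarithm is
additive because the invariant differential sums to zero over three collinear points. This is an
identity for any derivation, which is integrated in `ℤ_p[[X]]` and then evaluated at `X = p`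
(`exists_third_formalLog`). Surjectivity onto `pℤ_p` is a fixed point argument
(`exists_formalLog_eq`). Kummer classes require `E(K̄)` to be `p`-divisible. To divide a point with
first coordinate `x₀` by `n`, specialize the generic point at a zero of `f - x₀`, where `f = x ∘
[n]` (`Pt.exists_nsmul_eq`). -/

theorem equation_iff_intCast (x y : F) : (W.baseChange F).toAffine.Equation x y ↔
    y ^ 2 + W.a₁ * x * y + W.a₃ * y = x ^ 3 + W.a₂ * x ^ 2 + W.a₄ * x + W.a₆ := by
  rw [WeierstrassCurve.Affine.equation_iff]
  simp [WeierstrassCurve.baseChange]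

theorem nonsingular_iff_intCast (hΔ : (W.Δ : F) ≠ 0) (x y : F) :
    (W.baseChange F).toAffine.Nonsingular x y ↔
    y ^ 2 + W.a₁ * x * y + W.a₃ * y = x ^ 3 + W.a₂ * x ^ 2 + W.a₄ * x + W.a₆ := by
  rw [← WeierstrassCurve.Affine.equation_iff_nonsingular_of_Δ_ne_zero, equation_iff_intCast]
  simpa [WeierstrassCurve.baseChange] using hΔ

/-- The affine point `(x, y)`. -/
def Pt.some {W : WeierstrassCurve ℤ} {x y : F} (h : (W.baseChange F).toAffine.Nonsingular x y) :
    Pt W F :=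
  WeierstrassCurve.Affine.Point.some x y h

/-- The tangent direction of a point is not degenerate. -/
theorem partial_ne_zero {x y : F} (h : (W.baseChange F).toAffine.Nonsingular x y) :
    ¬ (2 * y + W.a₁ * x + W.a₃ = 0 ∧ 3 * x ^ 2 + 2 * W.a₂ * x + W.a₄ - W.a₁ * y = 0) := by
  rintro ⟨h1, h2⟩
  rw [WeierstrassCurve.Affine.nonsingular_iff'] at h
  simp only [WeierstrassCurve.baseChange, WeierstrassCurve.map_a₁, WeierstrassCurve.map_a₂,
    WeierstrassCurve.map_a₃, WeierstrassCurve.map_a₄, algebraMap_int_eq, eq_intCast] at h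
  rcases h.2 with h | h
  · exact h (by linear_combination -h2)
  · exact h h1

/-- Three affine points that are the intersection of the curve with a line have sum zero. -/
theorem add_add_eq_zero_of_line {x₁ x₂ x₃ s t : F}
    (h₁ : (W.baseChange F).toAffine.Nonsingular x₁ (s * x₁ + t))
    (h₂ : (W.baseChange F).toAffine.Nonsingular x₂ (s * x₂ + t))
    (h₃ : (W.baseChange F).toAffine.Nonsingular x₃ (s * x₃ + t))
    (hs : x₁ + x₂ + x₃ = s ^ 2 + W.a₁ * s - W.a₂)
    (hp : x₁ * x₂ + x₁ * x₃ + x₂ * x₃ = W.a₄ - 2 * s * t - W.a₁ * t - W.a₃ * s) :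
    Pt.some h₁ + Pt.some h₂ + Pt.some h₃ = 0 := by
  let := Classical.decEq F
  have key : ¬ (x₁ = x₂ ∧ s * x₁ + t = (W.baseChange F).toAffine.negY x₂ (s * x₂ + t)) ∧
      (W.baseChange F).toAffine.slope x₁ x₂ (s * x₁ + t) (s * x₂ + t) = s := by
    by_cases hx : x₁ = x₂
    · subst hx
      have hy : s * x₁ + t ≠ (W.baseChange F).toAffine.negY x₁ (s * x₁ + t) := by
        intro hy
        simp only [WeierstrassCurve.Affine.negY, WeierstrassCurve.baseChange,
          WeierstrassCurve.map_a₁, WeierstrassCurve.map_a₃, algebraMap_int_eq, eq_intCast] at hy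
        have e : 2 * (s * x₁ + t) + W.a₁ * x₁ + W.a₃ = 0 := by linear_combination hy
        refine partial_ne_zero W h₁ ⟨e, ?_⟩
        -- On the line the equation becomes a cubic with the double root `x₁`. Its derivative there
        -- is a combination of the two partials, so both vanish.
        linear_combination s * e - hp + 2 * x₁ * hs
      refine ⟨fun h => hy h.2, ?_⟩
      rw [WeierstrassCurve.Affine.slope_of_Y_ne rfl hy, div_eq_iff (sub_ne_zero.2 hy)]
      simp only [WeierstrassCurve.Affine.negY, WeierstrassCurve.baseChange,
          WeierstrassCurve.map_a₁, WeierstrassCurve.map_a₃, WeierstrassCurve.map_a₂,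
          WeierstrassCurve.map_a₄, algebraMap_int_eq, eq_intCast]
      linear_combination - hp + 2 * x₁ * hs
    · refine ⟨fun h => hx h.1, ?_⟩
      rw [WeierstrassCurve.Affine.slope_of_X_ne hx, div_eq_iff (sub_ne_zero.2 hx)]
      ring
  have h := WeierstrassCurve.Affine.Point.add_some key.1 (h₁ := h₁) (h₂ := h₂)
  refine add_eq_zero_iff_eq_neg.2 (h.trans ?_)
  refine Eq.trans ?_ (WeierstrassCurve.Affine.Point.neg_some h₃).symm
  have hx : (W.baseChange F).toAffine.addX x₁ x₂
      ((W.baseChange F).toAffine.slope x₁ x₂ (s * x₁ + t) (s * x₂ + t)) = x₃ := by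
    rw [key.2]
    simp only [WeierstrassCurve.Affine.addX, WeierstrassCurve.baseChange,
          WeierstrassCurve.map_a₁, WeierstrassCurve.map_a₂, algebraMap_int_eq, eq_intCast]
    linear_combination -hs
  rw [WeierstrassCurve.Affine.Point.some.injEq]
  refine ⟨hx, ?_⟩
  rw [WeierstrassCurve.Affine.addY, WeierstrassCurve.Affine.negAddY, hx, key.2]
  congr 1
  ring

end Collinear

/-! ### The coordinates `z = -x/y` and `w = -1/y` -/

section ZW

variable (W : WeierstrassCurve ℤ) {R S : Type*} [CommRing R] [CommRing S]

/-- The Weierstrass equation in the coordinates `z = -x/y`, `w = -1/y`. -/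
def OnZW (z w : R) : Prop :=
  w = z ^ 3 + W.a₁ * z * w + W.a₂ * z ^ 2 * w + W.a₃ * w ^ 2 + W.a₄ * z * w ^ 2 + W.a₆ * w ^ 3

/-- The leading coefficient of the restriction of the equation to a line of slope `l`. -/
def chordLead (l : R) : R := 1 + W.a₂ * l + W.a₄ * l ^ 2 + W.a₆ * l ^ 3

/-- The line `w = l z + n` meets the curve in the points with `z`-coordinates `z₁, z₂, z₃`. -/
structure IsChord (l n z₁ z₂ z₃ : R) : Prop where
  sum : chordLead W l * (z₁ + z₂ + z₃) =
    -(W.a₁ * l + W.a₂ * n + W.a₃ * l ^ 2 + 2 * W.a₄ * l * n + 3 * W.a₆ * l ^ 2 * n)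
  sum_mul : chordLead W l * (z₁ * z₂ + z₁ * z₃ + z₂ * z₃) =
    -(l - W.a₁ * n - 2 * W.a₃ * l * n - W.a₄ * n ^ 2 - 3 * W.a₆ * l * n ^ 2)
  prod : chordLead W l * (z₁ * z₂ * z₃) = n - W.a₃ * n ^ 2 - W.a₆ * n ^ 3

variable {W}

theorem OnZW.map {z w : R} (h : OnZW W z w) (f : R →+* S) : OnZW W (f z) (f w) := by
  simpa [OnZW] using congrArg f h

theorem onZW_zero : OnZW W (0 : R) 0 := by simp [OnZW]

theorem map_chordLead (f : R →+* S) (l : R) : f (chordLead W l) = chordLead W (f l) := by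
  simp [chordLead]

theorem IsChord.map {l n z₁ z₂ z₃ : R} (h : IsChord W l n z₁ z₂ z₃) (f : R →+* S) :
    IsChord W (f l) (f n) (f z₁) (f z₂) (f z₃) := by
  constructor
  · simpa [map_chordLead, map_ofNat] using congrArg f h.sum
  · simpa [map_chordLead, map_ofNat] using congrArg f h.sum_mul
  · simpa [map_chordLead, map_ofNat] using congrArg f h.prod

theorem IsChord.swap {l n z₁ z₂ z₃ : R} (h : IsChord W l n z₁ z₂ z₃) : IsChord W l n z₂ z₁ z₃ :=
  ⟨by linear_combination h.sum, by linear_combination h.sum_mul, by linear_combination h.prod⟩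

theorem IsChord.rotate {l n z₁ z₂ z₃ : R} (h : IsChord W l n z₁ z₂ z₃) : IsChord W l n z₂ z₃ z₁ :=
  ⟨by linear_combination h.sum, by linear_combination h.sum_mul, by linear_combination h.prod⟩

/-- The three relations are Vieta's formulas: they identify the equation restricted to the line, up
to sign, with `chordLead W l * (z - z₁) * (z - z₂) * (z - z₃)`. -/
theorem IsChord.onZW {l n z₁ z₂ z₃ : R} (h : IsChord W l n z₁ z₂ z₃) :
    OnZW W z₁ (l * z₁ + n) := by
  have h1 := h.sum
  have h2 := h.sum_mul
  have h3 := h.prod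
  simp only [chordLead] at h1 h2 h3
  simp only [OnZW]
  linear_combination -z₁ ^ 2 * h1 + z₁ * h2 - h3

/-- A chord or tangent of the curve through points that are congruent to the origin modulo an ideal
in the radical. -/
theorem exists_isChord {I : Ideal R} (hI : I ≤ Ideal.jacobson ⊥) {z₁ w₁ z₂ w₂ : R}
    (hz₁ : z₁ ∈ I) (hw₁ : w₁ ∈ I) (hz₂ : z₂ ∈ I) (hw₂ : w₂ ∈ I) (h₁ : OnZW W z₁ w₁)
    (h₂ : OnZW W z₂ w₂) :
    ∃ l n z₃, IsChord W l n z₁ z₂ z₃ ∧ w₁ = l * z₁ + n ∧ w₂ = l * z₂ + n ∧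
      l ∈ I ^ 2 ∧ n ∈ I ^ 2 ∧ z₁ + z₂ + z₃ ∈ I ^ 2 ∧ IsUnit (chordLead W l) := by
  have unit : ∀ a ∈ I, IsUnit (1 + a) := fun a ha => by
    have := Ideal.mem_jacobson_bot.1 (hI ha) 1
    rwa [mul_one, add_comm] at this
  -- Subtracting the two equations gives `(1 + U) * (w₂ - w₁) = V * (z₂ - z₁)`. So `V / (1 + U)`
  -- serves as slope without division by `z₂ - z₁`, and for equal points it is the slope of the
  -- tangent.
  let U : R := -(W.a₁ * z₂ + W.a₂ * z₂ ^ 2 + W.a₃ * (w₁ + w₂) + W.a₄ * z₂ * (w₁ + w₂) +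
    W.a₆ * (w₁ ^ 2 + w₁ * w₂ + w₂ ^ 2))
  let V : R := z₁ ^ 2 + z₁ * z₂ + z₂ ^ 2 + W.a₁ * w₁ + W.a₂ * (z₁ + z₂) * w₁ + W.a₄ * w₁ ^ 2
  have hww : w₁ ∈ I ^ 2 := by
    have : w₁ = (z₁ + W.a₂ * w₁) * (z₁ * z₁) + (W.a₁ : R) * (z₁ * w₁) +
      (W.a₃ + W.a₄ * z₁ + W.a₆ * w₁) * (w₁ * w₁) := by
        rw [OnZW] at h₁
        linear_combination h₁
    rw [this, pow_two]
    refine add_mem (add_mem ?_ ?_) ?_ <;>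
    exact Ideal.mul_mem_left _ _ (Ideal.mul_mem_mul (by assumption) (by assumption))
  have hV : V ∈ I ^ 2 := by
    have : V = 1 * (z₁ * z₁) + 1 * (z₁ * z₂) + 1 * (z₂ * z₂) + (W.a₁ : R) * w₁ +
      (W.a₂ * (z₁ + z₂)) * w₁ + W.a₄ * w₁ * w₁ := by simp only [V]; ring
    rw [this]
    refine add_mem (add_mem (add_mem (add_mem (add_mem ?_ ?_) ?_) ?_) ?_) ?_
    · rw [pow_two]; exact Ideal.mul_mem_left _ _ (Ideal.mul_mem_mul hz₁ hz₁)
    · rw [pow_two]; exact Ideal.mul_mem_left _ _ (Ideal.mul_mem_mul hz₁ hz₂)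
    · rw [pow_two]; exact Ideal.mul_mem_left _ _ (Ideal.mul_mem_mul hz₂ hz₂)
    all_goals exact Ideal.mul_mem_left _ _ hww
  have hU : IsUnit (1 + U) := unit U (by
    have : U = -(W.a₁ + W.a₂ * z₂) * z₂ + -(W.a₃ + W.a₄ * z₂ + W.a₆ * (w₁ + w₂)) * w₁ +
      -(W.a₃ + W.a₄ * z₂ + W.a₆ * w₂) * w₂ := by simp only [U]; ring
    rw [this]
    exact add_mem (add_mem (Ideal.mul_mem_left _ _ hz₂) (Ideal.mul_mem_left _ _ hw₁))
      (Ideal.mul_mem_left _ _ hw₂))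
  obtain ⟨u, hu⟩ := hU.exists_right_inv
  obtain ⟨l, hl0⟩ : ∃ l, l = u * V := ⟨_, rfl⟩
  have hl : l ∈ I ^ 2 := hl0 ▸ Ideal.mul_mem_left _ _ hV
  have hlI : l ∈ I := Ideal.pow_le_self two_ne_zero hl
  have hlV : (1 + U) * l = V := by rw [hl0]; linear_combination V * hu
  obtain ⟨n, hn0⟩ : ∃ n, n = w₁ - l * z₁ := ⟨_, rfl⟩
  have hn : n ∈ I ^ 2 := hn0 ▸ sub_mem hww (Ideal.mul_mem_right _ _ hl)
  have hdiff : w₂ - w₁ = l * (z₂ - z₁) := by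
    have e : (1 + U) * (w₂ - w₁) = V * (z₂ - z₁) := by
      rw [OnZW] at h₁ h₂
      simp only [U, V]
      linear_combination h₂ - h₁
    calc w₂ - w₁ = u * ((1 + U) * (w₂ - w₁)) := by linear_combination -(w₂ - w₁) * hu
      _ = _ := by rw [e, hl0]; ring
  have hC : IsUnit (chordLead W l) := by
    have : chordLead W l = 1 + (W.a₂ + W.a₄ * l + W.a₆ * l ^ 2) * l := by
      simp only [chordLead]; ring
    rw [this]
    exact unit _ (Ideal.mul_mem_left _ _ hlI)
  obtain ⟨c, hc⟩ := hC.exists_right_inv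
  obtain ⟨q, hq0⟩ : ∃ q, q = -(W.a₁ * l + W.a₂ * n + W.a₃ * l ^ 2 + 2 * W.a₄ * l * n + 3 * W.a₆ * l ^ 2 * n) :=
    ⟨_, rfl⟩
  have hq : q ∈ I ^ 2 := by
    have : q = -(W.a₁ + W.a₃ * l + 2 * W.a₄ * n + 3 * W.a₆ * l * n) * l + -W.a₂ * n := by
      rw [hq0]; ring
    rw [this]
    exact add_mem (Ideal.mul_mem_left _ _ hl) (Ideal.mul_mem_left _ _ hn)
  have hw1 : w₁ = l * z₁ + n := by rw [hn0]; ring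
  have hw2 : w₂ = l * z₂ + n := by linear_combination hdiff + hw1
  have hsum : chordLead W l * (z₁ + z₂ + (c * q - z₁ - z₂)) = q := by linear_combination q * hc
  -- The sum of the roots defines `z₃`. The second Vieta relation then follows from the slope
  -- equation, and the third from the first point being on the curve.
  obtain ⟨z₃, hz₃⟩ : ∃ z, z = c * q - z₁ - z₂ := ⟨_, rfl⟩
  rw [← hz₃] at hsum
  rw [hq0] at hsum
  have hmul : chordLead W l * (z₁ * z₂ + z₁ * z₃ + z₂ * z₃) =
      -(l - W.a₁ * n - 2 * W.a₃ * l * n - W.a₄ * n ^ 2 - 3 * W.a₆ * l * n ^ 2) := by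
    simp only [U, V] at hlV
    rw [hw1, hw2] at hlV
    have h1 := hsum
    simp only [chordLead] at h1 ⊢
    linear_combination (z₁ + z₂) * h1 + hlV
  refine ⟨l, n, z₃, ⟨hsum, hmul, ?_⟩, hw1, hw2, hl, hn, ?_, hC⟩
  · rw [OnZW, hw1] at h₁
    have h1 := hsum
    have h2 := hmul
    simp only [chordLead] at h1 h2 ⊢
    linear_combination -h₁ + z₁ * h2 - z₁ ^ 2 * h1
  · have : z₁ + z₂ + z₃ = c * q := by rw [hz₃]; ring
    rw [this]
    exact Ideal.mul_mem_left _ _ hq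

/-- The coordinate `w` of a point close to the origin is determined by `z`. -/
theorem OnZW.unique {I : Ideal R} (hI : I ≤ Ideal.jacobson ⊥) {z w₁ w₂ : R} (hz : z ∈ I)
    (hw₁ : w₁ ∈ I) (hw₂ : w₂ ∈ I) (h₁ : OnZW W z w₁) (h₂ : OnZW W z w₂) : w₁ = w₂ := by
  -- Even for equal `z` the chord has the form `w = l * z + n`, so it determines `w`.
  obtain ⟨l, n, z₃, -, e₁, e₂, -⟩ := exists_isChord hI hz hw₁ hz hw₂ h₁ h₂
  rw [e₁, e₂]

end ZW

/-! ### Points in the coordinates `z`, `w` -/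

section PointZW

variable {W : WeierstrassCurve ℤ} {F : Type*} [Field F]

theorem Pt.some_congr {x y x' y' : F} (h : (W.baseChange F).toAffine.Nonsingular x y)
    (h' : (W.baseChange F).toAffine.Nonsingular x' y') (hx : x = x') (hy : y = y') :
    Pt.some h = Pt.some h' := by
  subst hx hy
  rfl

theorem Pt.some_ne_zero {x y : F} (h : (W.baseChange F).toAffine.Nonsingular x y) :
    Pt.some h ≠ 0 :=
  WeierstrassCurve.Affine.Point.some_ne_zero h

theorem Pt.eq_zero_or_some (P : Pt W F) :
    P = 0 ∨ ∃ (x y : F) (h : (W.baseChange F).toAffine.Nonsingular x y), P = Pt.some h := by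
  rcases P with _ | ⟨x, y, h⟩
  · exact Or.inl rfl
  · exact Or.inr ⟨x, y, h, rfl⟩

open Classical in
/-- The point with coordinates `z = -x/y` and `w = -1/y`. -/
def Pt.ofZW (W : WeierstrassCurve ℤ) (z w : F) : Pt W F :=
  if h : w ≠ 0 ∧ (W.baseChange F).toAffine.Nonsingular (z / w) (-1 / w) then Pt.some h.2 else 0

theorem Pt.ofZW_zero (z : F) : Pt.ofZW W z 0 = 0 := dif_neg fun h => h.1 rfl

theorem OnZW.eq_zero {z : F} (h : OnZW W z 0) : z = 0 := by
  have h' : z ^ 3 = 0 := by simpa [OnZW] using h.symm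
  exact pow_eq_zero_iff three_ne_zero |>.1 h'

theorem OnZW.nonsingular (hΔ : (W.Δ : F) ≠ 0) {z w : F} (h : OnZW W z w) (hw : w ≠ 0) :
    (W.baseChange F).toAffine.Nonsingular (z / w) (-1 / w) := by
  rw [nonsingular_iff_intCast W hΔ]
  rw [OnZW] at h
  field_simp
  linear_combination h

theorem Pt.ofZW_eq_some (hΔ : (W.Δ : F) ≠ 0) {z w : F} (h : OnZW W z w) (hw : w ≠ 0) :
    Pt.ofZW W z w = Pt.some (h.nonsingular hΔ hw) :=
  dif_pos ⟨hw, h.nonsingular hΔ hw⟩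

theorem Pt.z_ofZW (hΔ : (W.Δ : F) ≠ 0) {z w : F} (h : OnZW W z w) :
    Pt.z W (Pt.ofZW W z w) = z := by
  by_cases hw : w = 0
  · subst hw
    rw [h.eq_zero, Pt.ofZW_zero]
    rfl
  · rw [Pt.ofZW_eq_some hΔ h hw]
    change -(z / w) / (-1 / w) = z
    field_simp

theorem onZW_of_nonsingular {x y : F} (h : (W.baseChange F).toAffine.Nonsingular x y)
    (hy : y ≠ 0) : OnZW W (-x / y) (-1 / y) := by
  have := (equation_iff_intCast W x y).1 h.1
  rw [OnZW]
  field_simp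
  linear_combination -this

theorem Pt.ofZW_of_nonsingular {x y : F} (h : (W.baseChange F).toAffine.Nonsingular x y)
    (hy : y ≠ 0) : Pt.ofZW W (-x / y) (-1 / y) = Pt.some h := by
  have hx' : -x / y / (-1 / y) = x := by field_simp
  have hy' : -1 / (-1 / y) = y := by field_simp
  have h' : -1 / y ≠ 0 ∧
      (W.baseChange F).toAffine.Nonsingular (-x / y / (-1 / y)) (-1 / (-1 / y)) :=
    ⟨by simpa using hy, by rwa [hx', hy']⟩
  exact (dif_pos h').trans (Pt.some_congr _ _ hx' hy')

/-- The line `w = l * z` through the origin is the vertical line `x = 1 / l` in affine coordinates,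
so the other two points are opposite. If `l = 0`, both are the origin. -/
theorem IsChord.add_eq_zero_of_zero (hΔ : (W.Δ : F) ≠ 0) {l z₂ z₃ : F}
    (h : IsChord W l 0 0 z₂ z₃) : Pt.ofZW W z₂ (l * z₂) + Pt.ofZW W z₃ (l * z₃) = 0 := by
  have hs := h.sum
  have hp := h.sum_mul
  have h₂ : OnZW W z₂ (l * z₂) := by simpa using h.rotate.onZW
  have h₃ : OnZW W z₃ (l * z₃) := by simpa using h.rotate.rotate.onZW
  simp only [zero_mul, zero_add, mul_zero, add_zero, sub_zero, ne_eq, OfNat.ofNat_ne_zero,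
    not_false_eq_true, zero_pow] at hs hp
  by_cases hl : l = 0
  · simp [hl, Pt.ofZW_zero]
  have hz : z₂ ≠ 0 ∧ z₃ ≠ 0 := by
    constructor <;> rintro rfl <;> simp [hl] at hp
  have hC : chordLead W l ≠ 0 := by
    intro hC
    rw [hC, zero_mul] at hp
    exact hl (by linear_combination hp)
  rw [Pt.ofZW_eq_some hΔ h₂ (mul_ne_zero hl hz.1), Pt.ofZW_eq_some hΔ h₃ (mul_ne_zero hl hz.2)]
  let := Classical.decEq F
  refine WeierstrassCurve.Affine.Point.add_of_Y_eq ?_ ?_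
  · obtain ⟨h2, h3⟩ := hz
    field_simp
  · obtain ⟨h2, h3⟩ := hz
    simp only [WeierstrassCurve.Affine.negY, WeierstrassCurve.baseChange,
          WeierstrassCurve.map_a₁, WeierstrassCurve.map_a₃, algebraMap_int_eq, eq_intCast]
    field_simp
    refine mul_left_cancel₀ hC (mul_left_cancel₀ hl ?_)
    linear_combination -l * hs + (W.a₁ + l * W.a₃) * l * hp

/-- Three collinear points have sum zero. -/
theorem IsChord.add_eq_zero (hΔ : (W.Δ : F) ≠ 0) {l n z₁ z₂ z₃ : F}
    (h : IsChord W l n z₁ z₂ z₃) (hC : chordLead W l ≠ 0) :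
    Pt.ofZW W z₁ (l * z₁ + n) + Pt.ofZW W z₂ (l * z₂ + n) + Pt.ofZW W z₃ (l * z₃ + n) = 0 := by
  by_cases hn : n = 0
  · subst hn
    have hp : z₁ * z₂ * z₃ = 0 := by simpa [hC] using h.prod
    simp only [add_zero]
    rcases mul_eq_zero.1 hp with hp | rfl
    · rcases mul_eq_zero.1 hp with rfl | rfl
      · rw [mul_zero, Pt.ofZW_zero, zero_add]
        exact h.add_eq_zero_of_zero hΔ
      · rw [mul_zero, Pt.ofZW_zero, add_zero]
        exact h.swap.add_eq_zero_of_zero hΔ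
    · rw [mul_zero, Pt.ofZW_zero, add_zero]
      exact h.rotate.rotate.add_eq_zero_of_zero hΔ
  have hw : ∀ {z z' z''}, IsChord W l n z z' z'' → l * z + n ≠ 0 := fun {z z' z''} h' h0 => by
    have h1 := h'.onZW
    rw [h0] at h1
    rw [h1.eq_zero, mul_zero, zero_add] at h0
    exact hn h0
  have hw₁ := hw h
  have hw₂ := hw h.rotate
  have hw₃ := hw h.rotate.rotate
  -- In affine coordinates the line `w = l * z + n` is `y = (l / n) * x - 1 / n`.
  have hline : ∀ {z : F}, l * z + n ≠ 0 →
      -1 / (l * z + n) = l / n * (z / (l * z + n)) + -1 / n := fun {z} h0 => by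
    field_simp
    ring
  have hs := h.sum
  have hm := h.sum_mul
  have hp := h.prod
  obtain ⟨C, hC'⟩ : ∃ C, C = chordLead W l := ⟨_, rfl⟩
  have hCl : C = 1 + W.a₂ * l + W.a₄ * l ^ 2 + W.a₆ * l ^ 3 := hC'
  rw [← hC'] at hs hm hp hC
  -- The product of the three `w`-coordinates; it clears the denominators in the affine Vieta
  -- relations below.
  have hprod : C * ((l * z₁ + n) * (l * z₂ + n) * (l * z₃ + n)) = n ^ 3 := by
    linear_combination l ^ 3 * hp + l ^ 2 * n * hm + l * n ^ 2 * hs + n ^ 3 * hCl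
  have hsum : z₁ / (l * z₁ + n) + z₂ / (l * z₂ + n) + z₃ / (l * z₃ + n) =
      (l / n) ^ 2 + W.a₁ * (l / n) - W.a₂ := by
    refine mul_left_cancel₀ (pow_ne_zero 3 hn) ?_
    nth_rewrite 1 [← hprod]
    field_simp
    linear_combination 3 * l ^ 2 * hp + 2 * l * n * hm + n ^ 2 * hs
  have hmul : z₁ / (l * z₁ + n) * (z₂ / (l * z₂ + n)) + z₁ / (l * z₁ + n) * (z₃ / (l * z₃ + n)) +
      z₂ / (l * z₂ + n) * (z₃ / (l * z₃ + n)) =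
      W.a₄ - 2 * (l / n) * (-1 / n) - W.a₁ * (-1 / n) - W.a₃ * (l / n) := by
    refine mul_left_cancel₀ (pow_ne_zero 3 hn) ?_
    nth_rewrite 1 [← hprod]
    field_simp
    linear_combination 3 * l * hp + n * hm
  rw [Pt.ofZW_eq_some hΔ h.onZW hw₁, Pt.ofZW_eq_some hΔ h.rotate.onZW hw₂,
    Pt.ofZW_eq_some hΔ h.rotate.rotate.onZW hw₃]
  have h₁ := h.onZW.nonsingular hΔ hw₁
  have h₂ := h.rotate.onZW.nonsingular hΔ hw₂
  have h₃ := h.rotate.rotate.onZW.nonsingular hΔ hw₃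
  rw [hline hw₁] at h₁
  rw [hline hw₂] at h₂
  rw [hline hw₃] at h₃
  rw [Pt.some_congr _ h₁ rfl (hline hw₁), Pt.some_congr _ h₂ rfl (hline hw₂),
    Pt.some_congr _ h₃ rfl (hline hw₃)]
  exact add_add_eq_zero_of_line W h₁ h₂ h₃ hsum hmul

variable {R : Type*} [CommRing R] [Algebra R F]

/-- `P` is a point with coordinate `z` in the formal group of the ideal `I`. -/
def InFormal (I : Ideal R) (z : R) (P : Pt W F) : Prop :=
  z ∈ I ∧ ∃ w ∈ I, OnZW W z w ∧ P = Pt.ofZW W (algebraMap R F z) (algebraMap R F w)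

theorem inFormal_zero (I : Ideal R) : InFormal I 0 (0 : Pt W F) :=
  ⟨zero_mem _, 0, zero_mem _, onZW_zero, by rw [map_zero, Pt.ofZW_zero]⟩

theorem InFormal.z_eq (hΔ : (W.Δ : F) ≠ 0) {I : Ideal R} {z : R} {P : Pt W F}
    (h : InFormal I z P) : Pt.z W P = algebraMap R F z := by
  obtain ⟨-, w, -, h, rfl⟩ := h
  exact Pt.z_ofZW hΔ (h.map _)

/-- The third point of the chord is again in the formal group. The congruence modulo `I ^ 2` makes
the group law additive in `z` to first order, which `exists_generic` uses to see that `[n]` is not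
constant. -/
theorem InFormal.exists_third (hΔ : (W.Δ : F) ≠ 0) {I : Ideal R} (hI : I ≤ Ideal.jacobson ⊥)
    {z₁ z₂ : R} {P₁ P₂ : Pt W F} (h₁ : InFormal I z₁ P₁) (h₂ : InFormal I z₂ P₂) :
    ∃ z₃, InFormal I z₃ (-(P₁ + P₂)) ∧ z₁ + z₂ + z₃ ∈ I ^ 2 := by
  obtain ⟨hz₁, w₁, hw₁, h₁, rfl⟩ := h₁
  obtain ⟨hz₂, w₂, hw₂, h₂, rfl⟩ := h₂
  obtain ⟨l, n, z₃, h, rfl, rfl, hl, hn, hz₃, hC⟩ := exists_isChord hI hz₁ hw₁ hz₂ hw₂ h₁ h₂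
  have hz₃' : z₃ ∈ I := by
    have := sub_mem (sub_mem (Ideal.pow_le_self two_ne_zero hz₃) hz₁) hz₂
    rwa [show z₁ + z₂ + z₃ - z₁ - z₂ = z₃ by ring] at this
  refine ⟨z₃, ⟨hz₃', l * z₃ + n, add_mem (Ideal.mul_mem_left _ _ hz₃')
    (Ideal.pow_le_self two_ne_zero hn), h.rotate.rotate.onZW, ?_⟩, hz₃⟩
  have hC' : chordLead W (algebraMap R F l) ≠ 0 := by
    rw [← map_chordLead]
    exact (hC.map (algebraMap R F)).ne_zero
  have := (h.map (algebraMap R F)).add_eq_zero hΔ hC'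
  simp only [← map_mul, ← map_add] at this
  exact (eq_neg_of_add_eq_zero_right this).symm

theorem InFormal.neg (hΔ : (W.Δ : F) ≠ 0) {I : Ideal R} (hI : I ≤ Ideal.jacobson ⊥)
    {z : R} {P : Pt W F} (h : InFormal I z P) : ∃ z', InFormal I z' (-P) ∧ z + z' ∈ I ^ 2 := by
  simpa using h.exists_third hΔ hI (inFormal_zero I)

theorem InFormal.add (hΔ : (W.Δ : F) ≠ 0) {I : Ideal R} (hI : I ≤ Ideal.jacobson ⊥)
    {z₁ z₂ : R} {P₁ P₂ : Pt W F} (h₁ : InFormal I z₁ P₁) (h₂ : InFormal I z₂ P₂) :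
    ∃ z, InFormal I z (P₁ + P₂) ∧ z - (z₁ + z₂) ∈ I ^ 2 := by
  obtain ⟨z₃, h₃, h⟩ := h₁.exists_third hΔ hI h₂
  obtain ⟨z, hz, h'⟩ := h₃.neg hΔ hI
  rw [neg_neg] at hz
  refine ⟨z, hz, ?_⟩
  have := sub_mem h' h
  rwa [show z₃ + z - (z₁ + z₂ + z₃) = z - (z₁ + z₂) by ring] at this

theorem InFormal.nsmul (hΔ : (W.Δ : F) ≠ 0) {I : Ideal R} (hI : I ≤ Ideal.jacobson ⊥)
    {z : R} {P : Pt W F} (h : InFormal I z P) (n : ℕ) :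
    ∃ z', InFormal I z' (n • P) ∧ z' - n * z ∈ I ^ 2 := by
  induction n with
  | zero => exact ⟨0, by simpa using inFormal_zero I, by simp⟩
  | succ n ih =>
    obtain ⟨z', h', hz'⟩ := ih
    obtain ⟨z'', h'', hz''⟩ := h'.add hΔ hI h
    refine ⟨z'', by rwa [succ_nsmul], ?_⟩
    have := add_mem hz'' hz'
    rwa [show z'' - (z' + z) + (z' - n * z) = z'' - (n + 1 : ℕ) * z by push_cast; ring] at this

end PointZW

/-! ### Reduction -/

section AddFormula

variable {W : WeierstrassCurve ℤ} {F : Type*} [Field F]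

/-- Slope and coordinates of the sum are free variables, so that a single integral slope can be used
both over the fraction field and over the residue field. -/
theorem Pt.some_add_some [DecidableEq F] {x₁ y₁ x₂ y₂ l x₃ y₃ : F}
    (h₁ : (W.baseChange F).toAffine.Nonsingular x₁ y₁)
    (h₂ : (W.baseChange F).toAffine.Nonsingular x₂ y₂)
    (hxy : ¬ (x₁ = x₂ ∧ y₁ = (W.baseChange F).toAffine.negY x₂ y₂))
    (hl : (W.baseChange F).toAffine.slope x₁ x₂ y₁ y₂ = l)
    (hx : x₃ = l ^ 2 + W.a₁ * l - W.a₂ - x₁ - x₂)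
    (hy : y₃ = -(l * (x₃ - x₁) + y₁) - W.a₁ * x₃ - W.a₃) :
    ∃ h₃ : (W.baseChange F).toAffine.Nonsingular x₃ y₃, Pt.some h₁ + Pt.some h₂ = Pt.some h₃ := by
  obtain rfl : ‹DecidableEq F› = Classical.decEq F := Subsingleton.elim _ _
  let := Classical.decEq F
  have hx' : (W.baseChange F).toAffine.addX x₁ x₂
      ((W.baseChange F).toAffine.slope x₁ x₂ y₁ y₂) = x₃ := by
    rw [hl, hx]
    simp [WeierstrassCurve.Affine.addX, WeierstrassCurve.baseChange]
  have hy' : (W.baseChange F).toAffine.addY x₁ x₂ y₁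
      ((W.baseChange F).toAffine.slope x₁ x₂ y₁ y₂) = y₃ := by
    rw [WeierstrassCurve.Affine.addY, WeierstrassCurve.Affine.negAddY, hx', hl, hy]
    simp [WeierstrassCurve.Affine.negY, WeierstrassCurve.baseChange]
  have h := WeierstrassCurve.Affine.nonsingular_add h₁ h₂ hxy
  have e : Pt.some h₁ + Pt.some h₂ = Pt.some h :=
    WeierstrassCurve.Affine.Point.add_some hxy (h₁ := h₁) (h₂ := h₂)
  rw [hx', hy'] at h
  exact ⟨h, e.trans (Pt.some_congr _ _ hx' hy')⟩

theorem Pt.add_of_Y_eq {x₁ y₁ x₂ y₂ : F}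
    (h₁ : (W.baseChange F).toAffine.Nonsingular x₁ y₁)
    (h₂ : (W.baseChange F).toAffine.Nonsingular x₂ y₂) (hx : x₁ = x₂)
    (hy : y₁ = (W.baseChange F).toAffine.negY x₂ y₂) : Pt.some h₁ + Pt.some h₂ = 0 :=
  let := Classical.decEq F
  WeierstrassCurve.Affine.Point.add_of_Y_eq hx hy

theorem negY_intCast (x y : F) :
    (W.baseChange F).toAffine.negY x y = -y - W.a₁ * x - W.a₃ := by
  simp [WeierstrassCurve.Affine.negY, WeierstrassCurve.baseChange]

/-- A second formula for the slope of a chord. -/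
theorem slope_mul [DecidableEq F] {x₁ y₁ x₂ y₂ : F}
    (h₁ : (W.baseChange F).toAffine.Nonsingular x₁ y₁)
    (h₂ : (W.baseChange F).toAffine.Nonsingular x₂ y₂)
    (hxy : ¬ (x₁ = x₂ ∧ y₁ = (W.baseChange F).toAffine.negY x₂ y₂)) :
    (W.baseChange F).toAffine.slope x₁ x₂ y₁ y₂ * (y₁ + y₂ + W.a₁ * x₂ + W.a₃) =
      x₁ ^ 2 + x₁ * x₂ + x₂ ^ 2 + W.a₂ * (x₁ + x₂) + W.a₄ - W.a₁ * y₁ := by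
  have e₁ := (equation_iff_intCast W _ _).1 h₁.1
  have e₂ := (equation_iff_intCast W _ _).1 h₂.1
  by_cases hx : x₁ = x₂
  · have hy : y₁ ≠ (W.baseChange F).toAffine.negY x₂ y₂ := fun h => hxy ⟨hx, h⟩
    have hyy := WeierstrassCurve.Affine.Y_eq_of_Y_ne h₁.1 h₂.1 hx hy
    subst hx hyy
    rw [WeierstrassCurve.Affine.slope_of_Y_ne rfl hy]
    rw [negY_intCast] at hy ⊢
    rw [div_mul_eq_mul_div, div_eq_iff (sub_ne_zero.2 hy)]
    simp only [WeierstrassCurve.baseChange, WeierstrassCurve.map_a₁, WeierstrassCurve.map_a₂,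
      WeierstrassCurve.map_a₄, algebraMap_int_eq, eq_intCast]
    ring
  · rw [WeierstrassCurve.Affine.slope_of_X_ne hx, div_mul_eq_mul_div,
      div_eq_iff (sub_ne_zero.2 hx)]
    linear_combination e₁ - e₂

end AddFormula

/-! ### Reduction of points over a valuation ring -/

section Reduction

set_option linter.unusedSectionVars false

variable {W : WeierstrassCurve ℤ} {R F k : Type*} [CommRing R] [IsDomain R] [ValuationRing R]
  [Field F] [Algebra R F] [IsFractionRing R F] [Field k] (φ : R →+* k)

/-- `Q` is the reduction of the point `P` with integral affine coordinates. -/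
def IsAffineRed (P : Pt W F) (Q : Pt W k) : Prop :=
  ∃ (x y : R) (h : (W.baseChange F).toAffine.Nonsingular (algebraMap R F x) (algebraMap R F y))
    (h' : (W.baseChange k).toAffine.Nonsingular (φ x) (φ y)), P = Pt.some h ∧ Q = Pt.some h'

/-- `Q` is the reduction of the point `P`. -/
def IsRed (P : Pt W F) (Q : Pt W k) : Prop :=
  (∃ z, InFormal (IsLocalRing.maximalIdeal R) z P) ∧ Q = 0 ∨ IsAffineRed φ P Q

variable {φ} {P P₁ P₂ : Pt W F} {Q Q' Q₁ Q₂ : Pt W k}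

/-- A valuation ring is integrally closed. This yields integrality of `y` once `x` is integral, and
of a slope once the three `x`-coordinates are. -/
theorem exists_algebraMap_eq_of_quadratic {t : F} {b c : R}
    (h : t ^ 2 + algebraMap R F b * t + algebraMap R F c = 0) : ∃ r : R, algebraMap R F r = t := by
  refine IsIntegrallyClosed.algebraMap_eq_of_integral (R := R) ⟨.X ^ 2 + .C b * .X + .C c, ?_, ?_⟩
  · monicity!
  · simpa using h

theorem IsAffineRed.ne_zero (h : IsAffineRed φ P Q) : Q ≠ 0 := by
  obtain ⟨x, y, h, h', rfl, rfl⟩ := h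
  exact Pt.some_ne_zero h'

theorem IsAffineRed.unique (h : IsAffineRed φ P Q) (h' : IsAffineRed φ P Q') : Q = Q' := by
  obtain ⟨x, y, h, h1, rfl, rfl⟩ := h
  obtain ⟨x', y', h', h1', e, rfl⟩ := h'
  obtain ⟨hx, hy⟩ := WeierstrassCurve.Affine.Point.some.inj e
  obtain rfl := IsFractionRing.injective R F hx
  obtain rfl := IsFractionRing.injective R F hy
  rfl

theorem IsAffineRed.neg (h : IsAffineRed φ P Q) : IsAffineRed φ (-P) (-Q) := by
  obtain ⟨x, y, h, h', rfl, rfl⟩ := h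
  have e1 : (W.baseChange F).toAffine.negY (algebraMap R F x) (algebraMap R F y) =
    algebraMap R F (-y - W.a₁ * x - W.a₃) := by simp
  have e2 : (W.baseChange k).toAffine.negY (φ x) (φ y) =
    φ (-y - W.a₁ * x - W.a₃) := by simp
  have h1 := (WeierstrassCurve.Affine.nonsingular_neg _ _).2 h
  have h2 := (WeierstrassCurve.Affine.nonsingular_neg _ _).2 h'
  have h1' := h1
  have h2' := h2
  rw [e1] at h1'
  rw [e2] at h2'
  exact ⟨x, _, h1', h2', (WeierstrassCurve.Affine.Point.neg_some h).trans
    (Pt.some_congr h1 h1' rfl e1), (WeierstrassCurve.Affine.Point.neg_some h').trans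
    (Pt.some_congr h2 h2' rfl e2)⟩

variable [IsLocalHom φ]

theorem map_eq_zero_iff_mem (x : R) : φ x = 0 ↔ x ∈ IsLocalRing.maximalIdeal R := by
  rw [IsLocalRing.mem_maximalIdeal, mem_nonunits_iff, ← isUnit_map_iff φ, isUnit_iff_ne_zero,
    not_not]

include φ in
theorem Δ_ne_zero_of_red (hΔ : (W.Δ : k) ≠ 0) : (W.Δ : F) ≠ 0 := by
  intro h
  apply hΔ
  have h1 : algebraMap R F W.Δ = 0 := by simpa using h
  have h2 : (W.Δ : R) = 0 := IsFractionRing.injective R F (by rw [h1, map_zero])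
  simpa using congrArg φ h2

/-- With `y` integral, `y * w = -1` would make `w` a unit, but `w` is in the maximal ideal. -/
theorem IsAffineRed.not_inFormal (h : IsAffineRed φ P Q) (z : R) :
    ¬ InFormal (IsLocalRing.maximalIdeal R) z P := by
  obtain ⟨x, y, h, -, rfl, -⟩ := h
  rintro ⟨-, w, hw, h1, h2⟩
  rw [Pt.ofZW] at h2
  split_ifs at h2 with h3
  · have hy := (WeierstrassCurve.Affine.Point.some.inj h2).2
    have h4 := h3.1
    rw [eq_div_iff h4, ← map_mul] at hy
    have : y * w = -1 := IsFractionRing.injective R F (by rw [hy]; simp)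
    have h5 : (-1 : R) ∈ IsLocalRing.maximalIdeal R := this ▸ Ideal.mul_mem_left _ _ hw
    exact (IsLocalRing.mem_maximalIdeal _).1 h5 isUnit_one.neg
  · exact Pt.some_ne_zero _ h2

variable (φ) in
theorem exists_isRed (hΔ : (W.Δ : k) ≠ 0) (P : Pt W F) : ∃ Q : Pt W k, IsRed φ P Q := by
  rcases P.eq_zero_or_some with rfl | ⟨x, y, h, rfl⟩
  · exact ⟨0, Or.inl ⟨⟨0, inFormal_zero _⟩, rfl⟩⟩
  have he := (equation_iff_intCast W _ _).1 h.1
  by_cases hx : ∃ r : R, algebraMap R F r = x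
  · obtain ⟨x, rfl⟩ := hx
    obtain ⟨y, rfl⟩ := exists_algebraMap_eq_of_quadratic (R := R) (t := y)
      (b := W.a₁ * x + W.a₃) (c := -(x ^ 3 + W.a₂ * x ^ 2 + W.a₄ * x + W.a₆)) (by
        simp only [map_add, map_mul, map_intCast, map_neg, map_pow]
        linear_combination he)
    have h' : (W.baseChange k).toAffine.Nonsingular (φ x) (φ y) := by
      rw [nonsingular_iff_intCast W hΔ]
      have : y ^ 2 + W.a₁ * x * y + W.a₃ * y = x ^ 3 + W.a₂ * x ^ 2 + W.a₄ * x + W.a₆ :=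
        IsFractionRing.injective R F (by simpa using he)
      simpa using congrArg φ this
    exact ⟨_, Or.inr ⟨x, y, h, h', rfl, rfl⟩⟩
  have key : ∀ t : F, (¬ ∃ r : R, algebraMap R F r = t) →
      t ≠ 0 ∧ ∃ r ∈ IsLocalRing.maximalIdeal R, algebraMap R F r = t⁻¹ := fun t ht => by
    have ht0 : t ≠ 0 := by
      rintro rfl
      exact ht ⟨0, map_zero _⟩
    refine ⟨ht0, ?_⟩
    obtain ⟨r, hr⟩ := (ValuationRing.isInteger_or_isInteger R t).resolve_left ht
    refine ⟨r, fun hu => ht ?_, hr⟩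
    obtain ⟨s, hs⟩ := hu.exists_right_inv
    refine ⟨s, ?_⟩
    have := congrArg (algebraMap R F) hs
    rw [map_mul, hr, map_one] at this
    field_simp at this
    exact this
  obtain ⟨hx0, m, hm, hmx⟩ := key x hx
  -- Dividing the equation by `x ^ 2` expresses `x` as a polynomial in `y / x` and `m = 1 / x`, so
  -- an integral `y / x` would make `x` integral. Hence `x / y` lies in the maximal ideal, and so
  -- does `1 / y = (x / y) * m`.
  have hs : ¬ ∃ r : R, algebraMap R F r = y / x := by
    rintro ⟨s, hs⟩
    refine hx ⟨s ^ 2 + W.a₁ * s + W.a₃ * m * s - W.a₂ - W.a₄ * m - W.a₆ * m ^ 2, ?_⟩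
    simp only [map_add, map_sub, map_mul, map_intCast, map_pow, hs, hmx]
    field_simp
    linear_combination he
  obtain ⟨hy0, r, hr, hry⟩ := key _ hs
  have hy : y ≠ 0 := fun h => hy0 (by rw [h, zero_div])
  refine ⟨0, Or.inl ⟨⟨-r, neg_mem hr, -(r * m), neg_mem (Ideal.mul_mem_left _ _ hm), ?_⟩, rfl⟩⟩
  have e1 : algebraMap R F (-r) = -x / y := by rw [map_neg, hry]; field_simp
  have e2 : algebraMap R F (-(r * m)) = -1 / y := by
    rw [map_neg, map_mul, hry, hmx]
    field_simp
  refine ⟨?_, ?_⟩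
  · have := onZW_of_nonsingular h hy
    rw [← e1, ← e2] at this
    simp only [OnZW] at this ⊢
    exact IsFractionRing.injective R F (by simpa using this)
  · rw [e1, e2, Pt.ofZW_of_nonsingular h hy]

theorem IsAffineRed.add (h₁ : IsAffineRed φ P₁ Q₁) (h₂ : IsAffineRed φ P₂ Q₂)
    (hQ : Q₁ + Q₂ ≠ 0) : IsAffineRed φ (P₁ + P₂) (Q₁ + Q₂) := by
  classical
  obtain ⟨x₁, y₁, h₁, h₁', rfl, rfl⟩ := h₁
  obtain ⟨x₂, y₂, h₂, h₂', rfl, rfl⟩ := h₂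
  have hxy' : ¬ (φ x₁ = φ x₂ ∧ φ y₁ = (W.baseChange k).toAffine.negY (φ x₂) (φ y₂)) := by
    rintro ⟨hx, hy⟩
    exact hQ (Pt.add_of_Y_eq h₁' h₂' hx hy)
  have hxy : ¬ (algebraMap R F x₁ = algebraMap R F x₂ ∧ algebraMap R F y₁ =
      (W.baseChange F).toAffine.negY (algebraMap R F x₂) (algebraMap R F y₂)) := by
    rintro ⟨hx, hy⟩
    refine hxy' ⟨congrArg φ (IsFractionRing.injective R F hx), ?_⟩
    rw [negY_intCast] at hy ⊢
    have : y₁ = -y₂ - W.a₁ * x₂ - W.a₃ := IsFractionRing.injective R F (by simpa using hy)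
    simpa using congrArg φ this
  obtain ⟨l, hl, hl'⟩ : ∃ l : R, (W.baseChange F).toAffine.slope (algebraMap R F x₁)
      (algebraMap R F x₂) (algebraMap R F y₁) (algebraMap R F y₂) = algebraMap R F l ∧
      (W.baseChange k).toAffine.slope (φ x₁) (φ x₂) (φ y₁) (φ y₂) = φ l := by
    -- One of the two slope formulas has a unit as denominator: the one of `slope_mul` if the
    -- `x`-coordinates have equal reductions, since the reduced points are not opposite, and the
    -- usual one otherwise.
    by_cases hx : φ x₁ = φ x₂
    · have s := slope_mul h₁ h₂ hxy
      have s' := slope_mul h₁' h₂' hxy'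
      have hd' : φ (y₁ + y₂ + W.a₁ * x₂ + W.a₃) ≠ 0 := fun h => hxy' ⟨hx, by
        rw [negY_intCast]
        simp only [map_add, map_mul, map_intCast] at h
        linear_combination h⟩
      obtain ⟨u, hu⟩ := (isUnit_of_map_unit φ _ hd'.isUnit).exists_right_inv
      refine ⟨u * (x₁ ^ 2 + x₁ * x₂ + x₂ ^ 2 + W.a₂ * (x₁ + x₂) + W.a₄ - W.a₁ * y₁), ?_, ?_⟩
      · have hu' := congrArg (algebraMap R F) hu
        simp only [map_add, map_sub, map_mul, map_intCast, map_pow, map_one] at hu' ⊢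
        rw [← s]
        linear_combination - (W.baseChange F).toAffine.slope (algebraMap R F x₁)
          (algebraMap R F x₂) (algebraMap R F y₁) (algebraMap R F y₂) * hu'
      · have hu' := congrArg φ hu
        simp only [map_add, map_sub, map_mul, map_intCast, map_pow, map_one] at hu' ⊢
        rw [← s']
        linear_combination - (W.baseChange k).toAffine.slope (φ x₁) (φ x₂) (φ y₁) (φ y₂) * hu'
    · have hd : φ (x₁ - x₂) ≠ 0 := by rwa [map_sub, sub_ne_zero]
      have hx' : algebraMap R F x₁ ≠ algebraMap R F x₂ := fun h =>
        hx (congrArg φ (IsFractionRing.injective R F h))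
      obtain ⟨u, hu⟩ := (isUnit_of_map_unit φ _ hd.isUnit).exists_right_inv
      refine ⟨(y₁ - y₂) * u, ?_, ?_⟩
      · rw [WeierstrassCurve.Affine.slope_of_X_ne hx', div_eq_iff (sub_ne_zero.2 hx')]
        have hu' := congrArg (algebraMap R F) hu
        simp only [map_sub, map_mul, map_one] at hu' ⊢
        linear_combination -(algebraMap R F y₁ - algebraMap R F y₂) * hu'
      · rw [WeierstrassCurve.Affine.slope_of_X_ne hx, div_eq_iff (sub_ne_zero.2 hx)]
        have hu' := congrArg φ hu
        simp only [map_sub, map_mul, map_one] at hu' ⊢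
        linear_combination -(φ y₁ - φ y₂) * hu'
  obtain ⟨x₃, hx₃⟩ : ∃ x₃, x₃ = l ^ 2 + W.a₁ * l - W.a₂ - x₁ - x₂ := ⟨_, rfl⟩
  obtain ⟨y₃, hy₃⟩ : ∃ y₃, y₃ = -(l * (x₃ - x₁) + y₁) - W.a₁ * x₃ - W.a₃ := ⟨_, rfl⟩
  obtain ⟨h₃, e⟩ := Pt.some_add_some h₁ h₂ hxy hl (x₃ := algebraMap R F x₃)
    (y₃ := algebraMap R F y₃) (by simp [hx₃]) (by simp [hy₃])
  obtain ⟨h₃', e'⟩ := Pt.some_add_some h₁' h₂' hxy' hl' (x₃ := φ x₃)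
    (y₃ := φ y₃) (by simp [hx₃]) (by simp [hy₃])
  exact ⟨x₃, y₃, h₃, h₃', e, e'⟩

/-- The sum of two points whose reductions are equal and of order two is in the kernel of
reduction. -/
theorem IsAffineRed.not_add (h₁ : IsAffineRed φ P₁ Q) (h₂ : IsAffineRed φ P₂ Q)
    (hQ : Q + Q = 0) (h₃ : IsAffineRed φ (P₁ + P₂) Q) : False := by
  classical
  obtain ⟨x₁, y₁, h₁, h₁', rfl, rfl⟩ := h₁
  obtain ⟨x₂, y₂, h₂, h₂', rfl, e₂⟩ := h₂
  obtain ⟨x₃, y₃, h₃, h₃', e, -⟩ := h₃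
  obtain ⟨hx₂, hy₂⟩ := WeierstrassCurve.Affine.Point.some.inj e₂
  have hQ' := eq_neg_of_add_eq_zero_left hQ
  have hneg := (WeierstrassCurve.Affine.Point.some.inj
    (hQ'.trans (WeierstrassCurve.Affine.Point.neg_some h₁'))).2
  rw [negY_intCast] at hneg
  have hxy : ¬ (algebraMap R F x₁ = algebraMap R F x₂ ∧ algebraMap R F y₁ =
      (W.baseChange F).toAffine.negY (algebraMap R F x₂) (algebraMap R F y₂)) := by
    rintro ⟨hx, hy⟩
    exact Pt.some_ne_zero h₃ (e.symm.trans (Pt.add_of_Y_eq h₁ h₂ hx hy))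
  obtain ⟨l, hl⟩ : ∃ l, (W.baseChange F).toAffine.slope (algebraMap R F x₁)
      (algebraMap R F x₂) (algebraMap R F y₁) (algebraMap R F y₂) = l := ⟨_, rfl⟩
  have s := slope_mul h₁ h₂ hxy
  obtain ⟨_, e'⟩ := Pt.some_add_some h₁ h₂ hxy hl rfl rfl
  have hx₃ := (WeierstrassCurve.Affine.Point.some.inj (e.symm.trans e')).1
  -- The third `x`-coordinate is integral, so the formula for it is a monic integral quadratic
  -- equation for the slope. Reducing `slope_mul` then makes both partials vanish at `Q`.
  obtain ⟨l, rfl⟩ := exists_algebraMap_eq_of_quadratic (R := R) (t := l)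
    (b := W.a₁) (c := -(W.a₂ + x₁ + x₂ + x₃)) (by
      simp only [map_add, map_intCast, map_neg]
      linear_combination -hx₃)
  rw [hl] at s
  have s' : l * (y₁ + y₂ + W.a₁ * x₂ + W.a₃) =
      x₁ ^ 2 + x₁ * x₂ + x₂ ^ 2 + W.a₂ * (x₁ + x₂) + W.a₄ - W.a₁ * y₁ :=
    IsFractionRing.injective R F (by simpa using s)
  have s'' := congrArg φ s'
  simp only [map_add, map_sub, map_mul, map_intCast, map_pow, ← hx₂, ← hy₂] at s''
  have h0 : 2 * φ y₁ + W.a₁ * φ x₁ + W.a₃ = 0 := by linear_combination hneg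
  exact partial_ne_zero W h₁' ⟨h0, by linear_combination φ l * h0 - s''⟩

/-- An indirect argument avoids mixed coordinates. The sum has some reduction. It is not in the
kernel, since `P₂` is not, and an affine reduction other than `Q₂` would give `P₁ = (P₁ + P₂) - P₂`
an affine reduction. -/
theorem InFormal.add_isAffineRed (hΔ : (W.Δ : k) ≠ 0) {z : R}
    (h₁ : InFormal (IsLocalRing.maximalIdeal R) z P₁) (h₂ : IsAffineRed φ P₂ Q₂) :
    IsAffineRed φ (P₁ + P₂) Q₂ := by
  have hΔ' : (W.Δ : F) ≠ 0 := Δ_ne_zero_of_red (φ := φ) hΔ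
  have hI : IsLocalRing.maximalIdeal R ≤ Ideal.jacobson ⊥ := IsLocalRing.maximalIdeal_le_jacobson _
  obtain ⟨S, hS⟩ := exists_isRed φ hΔ (P₁ + P₂)
  rcases hS with ⟨⟨z', hz'⟩, -⟩ | hS
  · obtain ⟨z'', hz'', -⟩ := h₁.neg hΔ' hI
    obtain ⟨z₃, hz₃, -⟩ := hz'.add hΔ' hI hz''
    rw [add_neg_cancel_comm] at hz₃
    exact (h₂.not_inFormal z₃ hz₃).elim
  · by_cases h : S + -Q₂ = 0
    · rwa [← eq_of_sub_eq_zero ((sub_eq_add_neg _ _).trans h)]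
    · have := hS.add h₂.neg h
      rw [add_neg_cancel_right] at this
      exact (this.not_inFormal z h₁).elim

theorem IsRed.add (hΔ : (W.Δ : k) ≠ 0) (h₁ : IsRed φ P₁ Q₁) (h₂ : IsRed φ P₂ Q₂) :
    IsRed φ (P₁ + P₂) (Q₁ + Q₂) := by
  have hΔ' : (W.Δ : F) ≠ 0 := Δ_ne_zero_of_red (φ := φ) hΔ
  have hI : IsLocalRing.maximalIdeal R ≤ Ideal.jacobson ⊥ := IsLocalRing.maximalIdeal_le_jacobson _
  rcases h₁ with ⟨⟨z₁, h₁⟩, rfl⟩ | h₁ <;> rcases h₂ with ⟨⟨z₂, h₂⟩, rfl⟩ | h₂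
  · obtain ⟨z, hz, -⟩ := h₁.add hΔ' hI h₂
    exact Or.inl ⟨⟨z, hz⟩, add_zero _⟩
  · rw [zero_add]
    exact Or.inr (h₁.add_isAffineRed hΔ h₂)
  · rw [add_zero, add_comm]
    exact Or.inr (h₂.add_isAffineRed hΔ h₁)
  by_cases hQ : Q₁ + Q₂ = 0
  · obtain ⟨S, hS | hS⟩ := exists_isRed φ hΔ (P₁ + P₂)
    · exact Or.inl ⟨hS.1, hQ⟩
    exfalso
    -- If `S ≠ Q₁`, then `P₂ = (P₁ + P₂) - P₁` reduces to `S - Q₁`, whence `S = Q₁ + Q₂ = 0`, which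
    -- is impossible for an affine reduction. Symmetrically `S = Q₂`, and `IsAffineRed.not_add`
    -- excludes the remaining case.
    have e₁ : S = Q₁ := by
      by_contra hne
      have := hS.add h₁.neg (by rwa [← sub_eq_add_neg, sub_ne_zero])
      rw [add_neg_cancel_comm] at this
      refine hS.ne_zero ?_
      rw [← hQ, h₂.unique this]
      abel
    have e₂ : S = Q₂ := by
      by_contra hne
      have := hS.add h₂.neg (by rwa [← sub_eq_add_neg, sub_ne_zero])
      rw [add_neg_cancel_right] at this
      refine hS.ne_zero ?_
      rw [← hQ, h₁.unique this]
      abel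
    subst e₁ e₂
    exact h₁.not_add h₂ hQ hS
  · exact Or.inr (h₁.add h₂ hQ)

theorem isRed_zero : IsRed φ (0 : Pt W F) (0 : Pt W k) := Or.inl ⟨⟨0, inFormal_zero _⟩, rfl⟩

theorem IsRed.nsmul (hΔ : (W.Δ : k) ≠ 0) (h : IsRed φ P Q) (n : ℕ) :
    IsRed φ (n • P) (n • Q) := by
  induction n with
  | zero => simpa using isRed_zero
  | succ n ih => simpa only [succ_nsmul] using ih.add hΔ h

/-- Multiplication by the number of points of the reduction maps to the kernel of reduction. -/
theorem exists_inFormal_card_nsmul (φ : R →+* k) [IsLocalHom φ] (hΔ : (W.Δ : k) ≠ 0) (P : Pt W F) :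
    ∃ z, InFormal (IsLocalRing.maximalIdeal R) z (Nat.card (Pt W k) • P) := by
  obtain ⟨Q, hQ⟩ := exists_isRed φ hΔ P
  have := hQ.nsmul hΔ (Nat.card (Pt W k))
  rw [card_nsmul_eq_zero'] at this
  rcases this with h | h
  · exact h.1
  · exact (h.ne_zero rfl).elim

end Reduction

/-! ### The expansions of `w` and of the invariant differential -/

section Expansion

open PowerSeries

variable (W : WeierstrassCurve ℤ)

/-- `wStep` is an `X`-adic contraction on series without constant term. This gives convergence of
the iterates and the fixed point equation for `wSeries`. -/
theorem dvd_wStep_sub {f g : PowerSeries ℤ} (hf : X ∣ f) (hg : X ∣ g) :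
    X * (f - g) ∣ wStep W f - wStep W g := by
  obtain ⟨a, rfl⟩ := hf
  obtain ⟨b, rfl⟩ := hg
  refine ⟨C W.a₁ + C W.a₂ * X + C W.a₃ * (a + b) + C W.a₄ * X * (a + b) +
    C W.a₆ * X * (a ^ 2 + a * b + b ^ 2), ?_⟩
  simp only [wStep]
  ring

theorem X_dvd_wStep {f : PowerSeries ℤ} (hf : X ∣ f) : X ∣ wStep W f := by
  obtain ⟨a, rfl⟩ := hf
  refine ⟨X ^ 2 + C W.a₁ * X * a + C W.a₂ * X ^ 2 * a + C W.a₃ * X * a ^ 2 +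
    C W.a₄ * X ^ 2 * a ^ 2 + C W.a₆ * X ^ 2 * a ^ 3, ?_⟩
  simp only [wStep]
  ring

theorem X_dvd_iterate_wStep (n : ℕ) : X ∣ (wStep W)^[n] 0 := by
  induction n with
  | zero => simp
  | succ n ih =>
    rw [Function.iterate_succ_apply']
    exact X_dvd_wStep W ih

theorem X_pow_dvd_iterate_wStep_sub (n : ℕ) :
    X ^ (n + 1) ∣ (wStep W)^[n + 1] 0 - (wStep W)^[n] 0 := by
  induction n with
  | zero => simpa using X_dvd_iterate_wStep W 1
  | succ n ih =>
    rw [Function.iterate_succ_apply' _ (n + 1), Function.iterate_succ_apply' _ n, pow_succ']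
    refine (mul_dvd_mul_left X ?_).trans (dvd_wStep_sub W ?_ (X_dvd_iterate_wStep W n))
    · rwa [Function.iterate_succ_apply'] at ih
    · simpa [Function.iterate_succ_apply'] using X_dvd_iterate_wStep W (n + 1)

theorem X_pow_dvd_wSeries_sub (n : ℕ) : X ^ (n + 1) ∣ wSeries W - (wStep W)^[n] 0 := by
  have key : ∀ m k, X ^ (m + 1) ∣ (wStep W)^[m + k] 0 - (wStep W)^[m] 0 := by
    intro m k
    induction k with
    | zero => simp
    | succ k ih =>
      have := (pow_dvd_pow X (by lia : m + 1 ≤ m + k + 1)).trans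
        (X_pow_dvd_iterate_wStep_sub W (m + k))
      have := dvd_add this ih
      rwa [sub_add_sub_cancel] at this
  rw [X_pow_dvd_iff]
  intro m hm
  obtain ⟨k, rfl⟩ := Nat.exists_eq_add_of_le (Nat.lt_succ_iff.1 hm)
  have := X_pow_dvd_iff.1 (key m k) m (Nat.lt_succ_self m)
  rw [map_sub, sub_eq_zero] at this ⊢
  rw [this, wSeries, coeff_mk]

theorem X_dvd_wSeries : X ∣ wSeries W := by
  simpa using X_pow_dvd_wSeries_sub W 0

theorem wStep_wSeries : wStep W (wSeries W) = wSeries W := by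
  have h : ∀ n, X ^ (n + 1) ∣ wStep W (wSeries W) - wSeries W := fun n => by
    have h1 := (Dvd.intro_left X rfl : wSeries W - (wStep W)^[n] 0 ∣ _).trans
      (dvd_wStep_sub W (X_dvd_wSeries W) (X_dvd_iterate_wStep W n))
    have h2 := (pow_dvd_pow X (Nat.le_succ (n + 1))).trans (X_pow_dvd_wSeries_sub W (n + 1))
    have h3 := dvd_sub ((X_pow_dvd_wSeries_sub W n).trans h1) h2
    rw [Function.iterate_succ_apply'] at h3
    convert h3 using 1
    ring
  rw [← sub_eq_zero]
  ext n
  exact X_pow_dvd_iff.1 (h n) n (Nat.lt_succ_self n)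

theorem onZW_wSeries : OnZW W (X : PowerSeries ℤ) (wSeries W) := by
  have h := wStep_wSeries W
  simp only [wStep, eq_intCast] at h
  exact h.symm

/-- The partial derivative with respect to `w` of the equation of the curve. -/
def derivW {R : Type*} [CommRing R] (z w : R) : R :=
  1 - (W.a₁ * z + W.a₂ * z ^ 2 + 2 * W.a₃ * w + 2 * W.a₄ * z * w + 3 * W.a₆ * w ^ 2)

theorem map_derivW {R S : Type*} [CommRing R] [CommRing S] (f : R →+* S) (z w : R) :
    f (derivW W z w) = derivW W (f z) (f w) := by
  simp [derivW, map_ofNat]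

theorem derivW_mul_omegaSeries : derivW W X (wSeries W) * omegaSeries W = 1 := by
  have h := mul_invOfUnit (1 - (C W.a₁ * X + C W.a₂ * X ^ 2 + 2 * C W.a₃ * wSeries W +
    2 * C W.a₄ * X * wSeries W + 3 * C W.a₆ * wSeries W ^ 2)) 1 (by
      have : constantCoeff (wSeries W) = 0 := X_dvd_iff.1 (X_dvd_wSeries W)
      simp [this])
  simp only [eq_intCast] at h
  simpa only [omegaSeries, derivW, eq_intCast] using h

/-- The substitution homomorphism from integral power series. -/
def intSubst {R : Type*} [CommRing R] {z : PowerSeries R} (hz : X ∣ z) :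
    PowerSeries ℤ →+* PowerSeries R :=
  (substAlgHom (HasSubst.of_constantCoeff_zero' (X_dvd_iff.1 hz)) :
    PowerSeries ℤ →ₐ[ℤ] PowerSeries R).toRingHom

variable {W} {R : Type*} [CommRing R] {z : PowerSeries R} (hz : X ∣ z)

theorem intSubst_apply (f : PowerSeries ℤ) : intSubst hz f = f.subst z :=
  congrFun (coe_substAlgHom _) f

theorem intSubst_X : intSubst hz X = z :=
  substAlgHom_X _

theorem X_dvd_intSubst {f : PowerSeries ℤ} (hf : X ∣ f) : X ∣ intSubst hz f := by
  obtain ⟨g, rfl⟩ := hf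
  rw [map_mul, intSubst_X]
  exact hz.mul_right _

theorem onZW_intSubst : OnZW W z (intSubst hz (wSeries W)) := by
  simpa only [intSubst_X] using (onZW_wSeries W).map (intSubst hz)

theorem span_X_le_jacobson [IsLocalRing R] :
    Ideal.span {(X : PowerSeries R)} ≤ Ideal.jacobson ⊥ := by
  refine (IsLocalRing.le_maximalIdeal ?_).trans (IsLocalRing.maximalIdeal_le_jacobson _)
  rw [Ne, Ideal.span_singleton_eq_top]
  simp [isUnit_iff_constantCoeff]

theorem wSeries_unique [IsLocalRing R] {w : PowerSeries R} (hw : X ∣ w) (h : OnZW W z w) :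
    w = intSubst hz (wSeries W) :=
  OnZW.unique span_X_le_jacobson (Ideal.mem_span_singleton.2 hz) (Ideal.mem_span_singleton.2 hw)
    (Ideal.mem_span_singleton.2 (X_dvd_intSubst hz (X_dvd_wSeries W))) h (onZW_intSubst hz)

end Expansion

/-! ### The invariant differential is additive -/

section Differential

variable {W : WeierstrassCurve ℤ} {A R : Type*} [CommRing A] [CommRing R]
  [Algebra A R] (D : Derivation A R R)

/-- Apply `D` to the equation at `(z₁, l * z₁ + n)`. The coefficient of `D z₁` is, up to sign, the
derivative at the root `z₁` of the cubic cut out by the line. -/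
theorem IsChord.derivation {l n z₁ z₂ z₃ : R} (h : IsChord W l n z₁ z₂ z₃) :
    derivW W z₁ (l * z₁ + n) * (z₁ * D l + D n) =
      chordLead W l * D z₁ * ((z₁ - z₂) * (z₁ - z₃)) := by
  have hD := congrArg D h.onZW
  have h1 := h.sum
  have h2 := h.sum_mul
  simp only [map_add, Derivation.leibniz, Derivation.leibniz_pow, smul_eq_mul,
    Derivation.map_intCast, nsmul_eq_mul] at hD
  simp only [derivW, chordLead] at *
  push_cast at hD
  linear_combination hD + (2 * z₁ * D z₁) * h1 - D z₁ * h2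

/-- The sum of the values of the invariant differential at three collinear points vanishes. -/
theorem IsChord.sum_differential [IsDomain R] {l n z₁ z₂ z₃ e₁ e₂ e₃ : R} (h : IsChord W l n z₁ z₂ z₃)
    (hC : chordLead W l ≠ 0)
    (he₁ : derivW W z₁ (l * z₁ + n) * e₁ = 1) (he₂ : derivW W z₂ (l * z₂ + n) * e₂ = 1)
    (he₃ : derivW W z₃ (l * z₃ + n) * e₃ = 1) (h₁₂ : z₁ ≠ z₂) (h₁₃ : z₁ ≠ z₃) (h₂₃ : z₂ ≠ z₃) :
    e₁ * D z₁ + e₂ * D z₂ + e₃ * D z₃ = 0 := by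
  have d₁ := h.derivation D
  have d₂ := h.rotate.derivation D
  have d₃ := h.rotate.rotate.derivation D
  have hne : chordLead W l * ((z₁ - z₂) * (z₁ - z₃) * (z₂ - z₃)) ≠ 0 :=
    mul_ne_zero hC (mul_ne_zero (mul_ne_zero (sub_ne_zero.2 h₁₂) (sub_ne_zero.2 h₁₃))
      (sub_ne_zero.2 h₂₃))
  refine (mul_eq_zero.1 ?_).resolve_left hne
  -- By `IsChord.derivation` each term is `(zᵢ * D l + D n)` divided by `chordLead W l * ∏ (zᵢ -
  -- zⱼ)`. The sum vanishes by Lagrange interpolation, as the numerators are linear in `zᵢ`.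
  linear_combination -e₁ * (z₂ - z₃) * d₁ + e₂ * (z₁ - z₃) * d₂ - e₃ * (z₁ - z₂) * d₃ +
    (z₂ - z₃) * (z₁ * D l + D n) * he₁ - (z₁ - z₃) * (z₂ * D l + D n) * he₂ +
    (z₁ - z₂) * (z₃ * D l + D n) * he₃

end Differential

/-! ### The formal logarithm is additive -/

section LogSeries

open PowerSeries

variable (W : WeierstrassCurve ℤ) (p : ℕ) [Fact p.Prime]

/-- The coefficients of the formal logarithm. -/
def logCoeff (n : ℕ) : ℚ_[p] := ((coeff n (omegaSeries W) : ℤ) : ℚ_[p]) / ((n : ℚ_[p]) + 1)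

/-- The formal logarithm as a power series. -/
def logSeries : PowerSeries ℚ_[p] := X * PowerSeries.mk (logCoeff W p)

theorem derivative_logSeries :
    derivative ℚ_[p] (logSeries W p) = (omegaSeries W).map (Int.castRingHom ℚ_[p]) := by
  ext n
  rw [coeff_derivative, logSeries, coeff_succ_X_mul, coeff_mk, coeff_map, logCoeff,
    div_mul_cancel₀ _ (Nat.cast_add_one_ne_zero n)]
  rfl

theorem logSeries_eq (N : ℕ) : ∃ h : PowerSeries ℚ_[p],
    logSeries W p = ∑ n ∈ Finset.range N, C (logCoeff W p n) * X ^ (n + 1) + X ^ N * h := by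
  have h : X ^ N ∣ logSeries W p - ∑ n ∈ Finset.range N, C (logCoeff W p n) * X ^ (n + 1) := by
    rw [X_pow_dvd_iff]
    intro m hm
    rw [map_sub, map_sum]
    cases m with
    | zero => simp [logSeries]
    | succ m =>
      rw [logSeries, coeff_succ_X_mul, coeff_mk, Finset.sum_eq_single m]
      · simp [coeff_C_mul, coeff_X_pow]
      · intro b _ hb
        simp [coeff_C_mul, coeff_X_pow, hb.symm]
      · intro h
        exact (h (Finset.mem_range.2 (by lia))).elim
  obtain ⟨h, hh⟩ := h
  exact ⟨h, by rw [← hh]; ring⟩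

variable {W p}

/-- The substitution of an integral power series into the formal logarithm. -/
def logSubst (z : PowerSeries ℤ_[p]) : PowerSeries ℚ_[p] :=
  (logSeries W p).subst (z.map PadicInt.Coe.ringHom)

theorem hasSubst_map {z : PowerSeries ℤ_[p]} (hz : X ∣ z) :
    HasSubst (z.map PadicInt.Coe.ringHom : PowerSeries ℚ_[p]) :=
  HasSubst.of_constantCoeff_zero' (by
    have : constantCoeff z = 0 := X_dvd_iff.1 hz
    rw [← coeff_zero_eq_constantCoeff_apply] at this ⊢
    rw [coeff_map, this, map_zero])

theorem derivative_map {R S : Type*} [CommRing R] [CommRing S] (f : R →+* S) (z : PowerSeries R) :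
    derivative S (z.map f) = (derivative R z).map f := by
  ext n
  simp [coeff_derivative]

/-- The chain rule for `log ∘ z`. The derivative has integral coefficients although the logarithm
does not, so the identity of differentials can be proved over `ℤ_p`. -/
theorem derivative_logSubst {z : PowerSeries ℤ_[p]} (hz : X ∣ z) :
    derivative ℚ_[p] (logSubst (W := W) z) =
      (intSubst hz (omegaSeries W) * derivative ℤ_[p] z).map PadicInt.Coe.ringHom := by
  have h1 : (intSubst hz (omegaSeries W)) =
      ((omegaSeries W).map (Int.castRingHom ℤ_[p])).subst z := by
    rw [intSubst_apply, ← algebraMap_int_eq, map_algebraMap_eq_subst_X,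
      subst_comp_subst_apply HasSubst.X' (HasSubst.of_constantCoeff_zero' (X_dvd_iff.1 hz)),
      subst_X (HasSubst.of_constantCoeff_zero' (X_dvd_iff.1 hz))]
  have h2 : PowerSeries.map PadicInt.Coe.ringHom
      (((omegaSeries W).map (Int.castRingHom ℤ_[p])).subst z) =
      (((omegaSeries W).map (Int.castRingHom ℤ_[p])).map PadicInt.Coe.ringHom).subst
        (z.map PadicInt.Coe.ringHom : PowerSeries ℚ_[p]) :=
    map_subst (HasSubst.of_constantCoeff_zero' (X_dvd_iff.1 hz)) _
  rw [logSubst, derivative_subst (hasSubst_map hz), derivative_logSeries, derivative_map, map_mul,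
    h1, h2]
  congr 2

theorem constantCoeff_logSubst {z : PowerSeries ℤ_[p]} (hz : X ∣ z) :
    constantCoeff (logSubst (W := W) z) = 0 := by
  refine constantCoeff_subst_eq_zero ?_ _ ?_
  · have : constantCoeff z = 0 := X_dvd_iff.1 hz
    change constantCoeff (z.map PadicInt.Coe.ringHom) = 0
    rw [← coeff_zero_eq_constantCoeff_apply] at this ⊢
    rw [coeff_map, this, map_zero]
  · simp [logSeries]

/-- The derivative of the sum vanishes by `IsChord.sum_differential` and the constant term is zero;
in characteristic zero the series is then zero. -/
theorem sum_logSubst {l n z₁ z₂ z₃ : PowerSeries ℤ_[p]} (h : IsChord W l n z₁ z₂ z₃)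
    (hC : chordLead W l ≠ 0) (hz₁ : X ∣ z₁) (hz₂ : X ∣ z₂) (hz₃ : X ∣ z₃) (hn : X ∣ n)
    (h₁₂ : z₁ ≠ z₂) (h₁₃ : z₁ ≠ z₃) (h₂₃ : z₂ ≠ z₃) :
    logSubst (W := W) z₁ + logSubst (W := W) z₂ + logSubst (W := W) z₃ = 0 := by
  have key : ∀ {z z' z''} (hz : X ∣ z), IsChord W l n z z' z'' →
      derivW W z (l * z + n) * intSubst hz (omegaSeries W) = 1 := fun {z z' z''} hz h' => by
    rw [wSeries_unique hz (dvd_add (hz.mul_left l) hn) h'.onZW]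
    have := congrArg (intSubst hz) (derivW_mul_omegaSeries W)
    rwa [map_mul, map_derivW, intSubst_X, map_one] at this
  have hD := h.sum_differential (derivative ℤ_[p]) hC
    (key hz₁ h) (key hz₂ h.rotate) (key hz₃ h.rotate.rotate) h₁₂ h₁₃ h₂₃
  refine derivative.ext ?_ ?_
  · rw [map_add, map_add, derivative_logSubst hz₁, derivative_logSubst hz₂,
      derivative_logSubst hz₃, ← map_add, ← map_add, hD, map_zero, map_zero]
  · rw [map_add, map_add, constantCoeff_logSubst hz₁, constantCoeff_logSubst hz₂,
      constantCoeff_logSubst hz₃, map_zero, add_zero, add_zero]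

theorem logSubst_eq {z : PowerSeries ℤ_[p]} (hz : X ∣ z) (N : ℕ) : ∃ h : PowerSeries ℚ_[p],
    logSubst (W := W) z = ∑ n ∈ Finset.range N,
      C (logCoeff W p n) * (z.map PadicInt.Coe.ringHom) ^ (n + 1) + X ^ N * h := by
  obtain ⟨h, hh⟩ := logSeries_eq W p N
  obtain ⟨y, rfl⟩ := hz
  have hz : X ∣ X * y := Dvd.intro _ rfl
  obtain ⟨g, hg⟩ : ∃ g : PowerSeries ℚ_[p],
      g = h.subst ((X * y).map PadicInt.Coe.ringHom : PowerSeries ℚ_[p]) := ⟨_, rfl⟩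
  refine ⟨(y.map PadicInt.Coe.ringHom) ^ N * g, ?_⟩
  have hs := hasSubst_map hz
  rw [logSubst, hh, ← coe_substAlgHom hs, map_add, map_sum]
  congr 1
  · refine Finset.sum_congr rfl fun n _ => ?_
    rw [map_mul, map_pow, substAlgHom_X]
    congr 1
    exact (substAlgHom hs).commutes _
  · rw [map_mul, map_pow, substAlgHom_X, coe_substAlgHom, ← hg, map_mul, map_X]
    ring

end LogSeries

/-! ### Evaluation of power series over `ℤ_p` at `X = p` -/

section Evaluation

open PowerSeries

variable (p : ℕ) [Fact p.Prime]

theorem summable_evalP (f : PowerSeries ℤ_[p]) :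
    Summable fun n => ‖coeff n f * (p : ℤ_[p]) ^ n‖ := by
  have hp : ((p : ℝ)⁻¹) < 1 := inv_lt_one_of_one_lt₀ (by exact_mod_cast (Fact.out : p.Prime).one_lt)
  refine Summable.of_nonneg_of_le (fun _ => norm_nonneg _) (fun n => ?_)
    (summable_geometric_of_lt_one (by positivity) hp)
  rw [norm_mul, norm_pow, PadicInt.norm_p]
  exact mul_le_of_le_one_left (by positivity) (PadicInt.norm_le_one _)

/-- Evaluation of power series over `ℤ_p` at `p`. -/
def evalP : PowerSeries ℤ_[p] →+* ℤ_[p] where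
  toFun f := ∑' n, coeff n f * (p : ℤ_[p]) ^ n
  map_one' := by
    rw [tsum_eq_single 0]
    · simp
    · intro n hn
      simp [coeff_one, hn]
  map_zero' := by simp
  map_add' f g := by
    rw [← (summable_evalP p f).of_norm.tsum_add (summable_evalP p g).of_norm]
    exact tsum_congr fun n => by rw [map_add, add_mul]
  map_mul' f g := by
    rw [tsum_mul_tsum_eq_tsum_sum_antidiagonal_of_summable_norm (summable_evalP p f)
      (summable_evalP p g)]
    refine tsum_congr fun n => ?_
    rw [coeff_mul, Finset.sum_mul]
    refine Finset.sum_congr rfl fun ij hij => ?_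
    rw [← Finset.HasAntidiagonal.mem_antidiagonal.1 hij, pow_add]
    ring

theorem evalP_X : evalP p X = p := by
  change ∑' n, coeff n X * (p : ℤ_[p]) ^ n = p
  rw [tsum_eq_single 1]
  · simp
  · intro n hn
    simp [coeff_X, hn]

theorem evalP_C (a : ℤ_[p]) : evalP p (C a) = a := by
  change ∑' n, coeff n (C a) * (p : ℤ_[p]) ^ n = a
  rw [tsum_eq_single 0]
  · simp
  · intro n hn
    simp [coeff_C, hn]

variable {p}

theorem evalP_mem {f : PowerSeries ℤ_[p]} (hf : X ∣ f) :
    evalP p f ∈ IsLocalRing.maximalIdeal ℤ_[p] := by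
  obtain ⟨g, rfl⟩ := hf
  rw [map_mul, evalP_X]
  exact Ideal.mul_mem_right _ _ (by
    rw [PadicInt.maximalIdeal_eq_span_p]; exact Ideal.mem_span_singleton_self _)

theorem norm_evalP_le {f : PowerSeries ℤ_[p]} {N : ℕ} (hf : X ^ N ∣ f) :
    ‖evalP p f‖ ≤ (p : ℝ)⁻¹ ^ N := by
  obtain ⟨g, rfl⟩ := hf
  rw [map_mul, map_pow, evalP_X, norm_mul, norm_pow, PadicInt.norm_p]
  exact mul_le_of_le_one_right (by positivity) (PadicInt.norm_le_one _)

end Evaluation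

/-! ### The formal logarithm on `pℤ_p` -/

section LogAnalytic

open PowerSeries

variable {p : ℕ} [Fact p.Prime] (hp : 2 < p) (W : WeierstrassCurve ℤ)

theorem inv_prime_pos (p : ℕ) [Fact p.Prime] : (0 : ℝ) < (p : ℝ)⁻¹ :=
  inv_pos.2 (by exact_mod_cast (Fact.out : p.Prime).pos)

theorem inv_prime_lt_one (p : ℕ) [Fact p.Prime] : (p : ℝ)⁻¹ < 1 :=
  inv_lt_one_of_one_lt₀ (by exact_mod_cast (Fact.out : p.Prime).one_lt)

theorem norm_tsum_le_of_forall_le {f : ℕ → ℚ_[p]} {B : ℝ} (hf : Summable f)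
    (h : ∀ n, ‖f n‖ ≤ B) : ‖∑' n, f n‖ ≤ B :=
  le_of_tendsto hf.hasSum.tendsto_sum_nat.norm (Filter.Eventually.of_forall fun _ =>
    IsUltrametricDist.norm_sum_le_of_forall_le_of_nonneg ((norm_nonneg _).trans (h 0))
      fun i _ => h i)

theorem norm_natCast_eq_pow {n : ℕ} (hn : n ≠ 0) :
    ‖(n : ℚ_[p])‖ = (p : ℝ)⁻¹ ^ padicValNat p n := by
  rw [Padic.norm_eq_zpow_neg_valuation (Nat.cast_ne_zero.2 hn), Padic.valuation_natCast,
    zpow_neg, zpow_natCast, inv_pow]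

include hp in
-- Legendre's formula bounds `(p - 1) * v(n!)` by `n - 1` for `n > 0`, and `p > 2` gives `p - 1 ≥
-- 2`. The estimates for the logarithm on `pℤ_p` rest on this bound.
theorem padicValNat_factorial_le (n : ℕ) : padicValNat p n.factorial ≤ (n - 1) / 2 := by
  rcases eq_or_ne n 0 with rfl | hn
  · simp
  have h := sub_one_mul_padicValNat_factorial_lt_of_ne_zero p hn
  have h2 : 2 * padicValNat p n.factorial ≤ (p - 1) * padicValNat p n.factorial :=
    Nat.mul_le_mul_right _ (by lia)
  lia

include hp in
theorem pow_le_norm_factorial (n : ℕ) :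
    (p : ℝ)⁻¹ ^ ((n - 1) / 2) ≤ ‖(n.factorial : ℚ_[p])‖ := by
  rw [norm_natCast_eq_pow n.factorial_ne_zero]
  exact pow_le_pow_of_le_one (inv_prime_pos p).le (inv_prime_lt_one p).le
    (padicValNat_factorial_le hp n)

theorem factorial_mul_logCoeff {N n : ℕ} (hn : n < N) :
    ∃ e : ℤ, (N.factorial : ℚ_[p]) * logCoeff W p n = e := by
  obtain ⟨k, hk⟩ := Nat.dvd_factorial n.succ_pos (Nat.succ_le_of_lt hn)
  refine ⟨k * coeff n (omegaSeries W), ?_⟩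
  rw [hk, logCoeff]
  have := Nat.cast_add_one_ne_zero (R := ℚ_[p]) n
  push_cast
  field_simp

include hp in
theorem norm_logCoeff_mul_le (n : ℕ) : ‖logCoeff W p n‖ * (p : ℝ)⁻¹ ^ (n / 2) ≤ 1 := by
  obtain ⟨e, he⟩ := factorial_mul_logCoeff (p := p) W n.lt_succ_self
  have h1 := Padic.norm_int_le_one (p := p) e
  rw [← he, norm_mul, mul_comm] at h1
  exact (mul_le_mul_of_nonneg_left (pow_le_norm_factorial hp (n + 1)) (norm_nonneg _)).trans h1

include hp in
-- The exponent `n - n / 2` tends to infinity, which gives convergence on `pℤ_p`, and is at least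
-- `1` for `n ≥ 1`, which gives the contraction factor `1 / p`.
theorem norm_logCoeff_mul_pow_le (n : ℕ) :
    ‖logCoeff W p n‖ * (p : ℝ)⁻¹ ^ n ≤ (p : ℝ)⁻¹ ^ (n - n / 2) := by
  have : n = n / 2 + (n - n / 2) := by lia
  nth_rewrite 2 [this]
  rw [pow_add, ← mul_assoc]
  exact mul_le_of_le_one_left (pow_nonneg (inv_prime_pos p).le _) (norm_logCoeff_mul_le hp W n)

theorem tendsto_pow_sub_div (p : ℕ) [Fact p.Prime] :
    Filter.Tendsto (fun n : ℕ => (p : ℝ)⁻¹ ^ (n - n / 2)) Filter.atTop (𝓝 0) := by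
  refine (tendsto_pow_atTop_nhds_zero_of_lt_one (inv_prime_pos p).le (inv_prime_lt_one p)).comp ?_
  refine Filter.tendsto_atTop.2 fun b => ?_
  filter_upwards [Filter.eventually_ge_atTop (2 * b)] with n hn
  lia

include hp in
theorem summable_log {t : ℚ_[p]} (ht : ‖t‖ ≤ (p : ℝ)⁻¹) :
    Summable fun n => logCoeff W p n * t ^ (n + 1) := by
  refine NonarchimedeanAddGroup.summable_of_tendsto_cofinite_zero ?_
  rw [Nat.cofinite_eq_atTop, tendsto_zero_iff_norm_tendsto_zero]
  refine squeeze_zero (fun _ => norm_nonneg _) (fun n => ?_) (tendsto_pow_sub_div p)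
  rw [norm_mul, norm_pow]
  refine le_trans ?_ (norm_logCoeff_mul_pow_le hp W n)
  refine mul_le_mul_of_nonneg_left ?_ (norm_nonneg _)
  refine (pow_le_pow_left₀ (norm_nonneg _) ht _).trans ?_
  exact pow_le_pow_of_le_one (inv_prime_pos p).le (inv_prime_lt_one p).le n.le_succ

theorem formalLog_eq (t : ℚ_[p]) : formalLog W t = ∑' n, logCoeff W p n * t ^ (n + 1) := rfl

theorem logCoeff_zero : logCoeff W p 0 = 1 := by
  have : constantCoeff (omegaSeries W) = 1 := by simp [omegaSeries, constantCoeff_invOfUnit]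
  simp [logCoeff, this]

include hp in
theorem formalLog_eq_add {t : ℚ_[p]} (ht : ‖t‖ ≤ (p : ℝ)⁻¹) :
    formalLog W t = t + ∑' n, logCoeff W p (n + 1) * t ^ (n + 2) := by
  rw [formalLog_eq, (summable_log hp W ht).tsum_eq_zero_add, logCoeff_zero]
  simp

include hp in
-- The logarithm is a perturbation of the identity by a map with Lipschitz constant `1 / p`;
-- injectivity and surjectivity on `pℤ_p` both follow from this.
theorem norm_formalLog_sub_le {s t : ℚ_[p]} (hs : ‖s‖ ≤ (p : ℝ)⁻¹) (ht : ‖t‖ ≤ (p : ℝ)⁻¹) :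
    ‖(formalLog W s - s) - (formalLog W t - t)‖ ≤ (p : ℝ)⁻¹ * ‖s - t‖ := by
  have hs' := (summable_nat_add_iff 1).2 (summable_log hp W hs)
  have ht' := (summable_nat_add_iff 1).2 (summable_log hp W ht)
  rw [formalLog_eq_add hp W hs, formalLog_eq_add hp W ht, add_sub_cancel_left,
    add_sub_cancel_left, ← Summable.tsum_sub hs' ht']
  refine norm_tsum_le_of_forall_le (hs'.sub ht') fun n => ?_
  -- The difference of the powers of `s` and `t` is `s - t` times a sum of monomials of degree `n +
  -- 1`, each of norm at most `p⁻¹ ^ (n + 1)`.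
  rw [← mul_sub, ← geom_sum₂_mul, norm_mul, norm_mul, ← mul_assoc]
  refine mul_le_mul_of_nonneg_right ?_ (norm_nonneg _)
  have h1 : ‖∑ i ∈ Finset.range (n + 1 + 1), s ^ i * t ^ (n + 1 + 1 - 1 - i)‖ ≤
      (p : ℝ)⁻¹ ^ (n + 1) := by
    refine IsUltrametricDist.norm_sum_le_of_forall_le_of_nonneg
      (pow_nonneg (inv_prime_pos p).le _) fun i hi => ?_
    have hi' : n + 1 = i + (n + 1 + 1 - 1 - i) := by
      have := Finset.mem_range.1 hi
      lia
    have hi'' : (p : ℝ)⁻¹ ^ (n + 1) = (p : ℝ)⁻¹ ^ i * (p : ℝ)⁻¹ ^ (n + 1 + 1 - 1 - i) := by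
      rw [← pow_add, ← hi']
    rw [norm_mul, norm_pow, norm_pow, hi'']
    gcongr
  refine (mul_le_mul_of_nonneg_left h1 (norm_nonneg _)).trans
    ((norm_logCoeff_mul_pow_le hp W (n + 1)).trans ?_)
  refine (pow_le_pow_of_le_one (inv_prime_pos p).le (inv_prime_lt_one p).le
    (by lia : 1 ≤ n + 1 - (n + 1) / 2)).trans (pow_one _).le

theorem formalLog_zero : formalLog W (0 : ℚ_[p]) = 0 := by
  simp [formalLog_eq]

include hp in
theorem norm_formalLog_sub_self_le {t : ℚ_[p]} (ht : ‖t‖ ≤ (p : ℝ)⁻¹) :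
    ‖formalLog W t - t‖ ≤ (p : ℝ)⁻¹ * ‖t‖ := by
  simpa [formalLog_zero] using
    norm_formalLog_sub_le hp W ht (t := 0) (by simp)

include hp in
theorem norm_formalLog_le {t : ℚ_[p]} (ht : ‖t‖ ≤ (p : ℝ)⁻¹) : ‖formalLog W t‖ ≤ (p : ℝ)⁻¹ := by
  have h := norm_formalLog_sub_self_le hp W ht
  have h2 : ‖formalLog W t - t‖ ≤ (p : ℝ)⁻¹ := h.trans
    ((mul_le_of_le_one_left (norm_nonneg _) (inv_prime_lt_one p).le).trans ht)
  have := IsUltrametricDist.norm_add_le_max (formalLog W t - t) t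
  rw [sub_add_cancel] at this
  exact this.trans (max_le h2 ht)

include hp in
theorem eq_zero_of_formalLog_eq_zero {t : ℚ_[p]} (ht : ‖t‖ ≤ (p : ℝ)⁻¹)
    (h : formalLog W t = 0) : t = 0 := by
  have h1 := norm_formalLog_sub_self_le hp W ht
  rw [h, zero_sub, norm_neg] at h1
  by_contra hne
  have := mul_lt_of_lt_one_left (norm_pos_iff.2 hne) (inv_prime_lt_one p)
  linarith

include hp in
theorem exists_formalLog_eq {c : ℚ_[p]} (hc : ‖c‖ ≤ (p : ℝ)⁻¹) :
    ∃ t : ℚ_[p], ‖t‖ ≤ (p : ℝ)⁻¹ ∧ formalLog W t = c := by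
  let s : Set ℚ_[p] := Metric.closedBall 0 (p : ℝ)⁻¹
  have hs : ∀ t, t ∈ s ↔ ‖t‖ ≤ (p : ℝ)⁻¹ := fun t => mem_closedBall_zero_iff
  -- The fixed points of this contraction are the solutions of `formalLog W t = c`.
  let f : ℚ_[p] → ℚ_[p] := fun t => c - (formalLog W t - t)
  have hmaps : Set.MapsTo f s s := fun t ht => by
    rw [hs] at ht ⊢
    change ‖c - (formalLog W t - t)‖ ≤ _
    rw [sub_eq_add_neg]
    refine (IsUltrametricDist.norm_add_le_max _ _).trans (max_le hc ?_)
    rw [norm_neg]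
    exact (norm_formalLog_sub_self_le hp W ht).trans
      ((mul_le_of_le_one_left (norm_nonneg _) (inv_prime_lt_one p).le).trans ht)
  have hcon : ContractingWith (p : NNReal)⁻¹ (hmaps.restrict f s s) := by
    refine ⟨inv_lt_one_of_one_lt₀ (by exact_mod_cast (Fact.out : p.Prime).one_lt), ?_⟩
    refine LipschitzWith.of_dist_le_mul fun x y => ?_
    rw [Subtype.dist_eq, Subtype.dist_eq, dist_eq_norm, dist_eq_norm]
    have := norm_formalLog_sub_le hp W ((hs _).1 y.2) ((hs _).1 x.2)
    rw [norm_sub_rev (x : ℚ_[p])]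
    have e : f x - f y = formalLog W (y : ℚ_[p]) - y - (formalLog W (x : ℚ_[p]) - x) := by
      simp only [f]
      ring
    rw [← e] at this
    simpa using this
  obtain ⟨t, ht, hft, -⟩ := hcon.exists_fixedPoint' (x := 0) Metric.isClosed_closedBall.isComplete
    hmaps ((hs 0).2 (by simp)) (edist_ne_top _ _)
  refine ⟨t, (hs t).1 ht, ?_⟩
  have : c - (formalLog W t - t) = t := hft
  linear_combination -this

variable {W}

theorem norm_le_inv_iff_mem (x : ℤ_[p]) :
    ‖(x : ℚ_[p])‖ ≤ (p : ℝ)⁻¹ ↔ x ∈ IsLocalRing.maximalIdeal ℤ_[p] := by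
  have := PadicInt.norm_le_pow_iff_mem_span_pow x 1
  rw [PadicInt.maximalIdeal_eq_span_p, ← pow_one (p : ℤ_[p]), ← this, PadicInt.norm_def]
  simp

include hp in
-- The series of the logarithm is not integral, so `evalP` does not apply to it. The sum of the
-- three truncations, multiplied by `N!`, is the value of an integral series divisible by `X ^ N`,
-- hence of norm at most `p⁻¹ ^ N`. Dividing by `N!` costs at most `(N - 1) / 2` powers of `p`, so
-- the bound still tends to zero.
theorem sum_formalLog_evalP {z₁ z₂ z₃ : PowerSeries ℤ_[p]} (h₁ : X ∣ z₁) (h₂ : X ∣ z₂)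
    (h₃ : X ∣ z₃) (h : logSubst (W := W) z₁ + logSubst (W := W) z₂ + logSubst (W := W) z₃ = 0) :
    formalLog W (evalP p z₁ : ℚ_[p]) + formalLog W (evalP p z₂ : ℚ_[p]) +
      formalLog W (evalP p z₃ : ℚ_[p]) = 0 := by
  have hlim : ∀ {z : PowerSeries ℤ_[p]}, X ∣ z → Filter.Tendsto
      (fun N => ∑ n ∈ Finset.range N, logCoeff W p n * (evalP p z : ℚ_[p]) ^ (n + 1)) Filter.atTop
      (𝓝 (formalLog W (evalP p z : ℚ_[p]))) := fun {z} hz =>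
    (summable_log hp W ((norm_le_inv_iff_mem _).2 (evalP_mem hz))).hasSum.tendsto_sum_nat
  refine tendsto_nhds_unique (((hlim h₁).add (hlim h₂)).add (hlim h₃)) ?_
  rw [tendsto_zero_iff_norm_tendsto_zero]
  refine squeeze_zero (fun _ => norm_nonneg _) (fun N => ?_) (tendsto_pow_sub_div p)
  have hfac : ∀ n : ℕ, ∃ e : ℤ, n < N → (N.factorial : ℚ_[p]) * logCoeff W p n = e := fun n => by
    by_cases hn : n < N
    · obtain ⟨e, he⟩ := factorial_mul_logCoeff (p := p) W hn
      exact ⟨e, fun _ => he⟩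
    · exact ⟨0, fun h => (hn h).elim⟩
  choose e he using hfac
  let A : PowerSeries ℤ_[p] := ∑ n ∈ Finset.range N,
    (e n : PowerSeries ℤ_[p]) * (z₁ ^ (n + 1) + z₂ ^ (n + 1) + z₃ ^ (n + 1))
  have hA : X ^ N ∣ A := by
    obtain ⟨g₁, hg₁⟩ := logSubst_eq (W := W) h₁ N
    obtain ⟨g₂, hg₂⟩ := logSubst_eq (W := W) h₂ N
    obtain ⟨g₃, hg₃⟩ := logSubst_eq (W := W) h₃ N
    have hmap : A.map PadicInt.Coe.ringHom = -(N.factorial : PowerSeries ℚ_[p]) *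
        (X ^ N * (g₁ + g₂ + g₃)) := by
      have e1 : A.map PadicInt.Coe.ringHom = (N.factorial : PowerSeries ℚ_[p]) *
          (∑ n ∈ Finset.range N, C (logCoeff W p n) *
            (z₁.map PadicInt.Coe.ringHom) ^ (n + 1) + ∑ n ∈ Finset.range N, C (logCoeff W p n) *
            (z₂.map PadicInt.Coe.ringHom) ^ (n + 1) + ∑ n ∈ Finset.range N, C (logCoeff W p n) *
            (z₃.map PadicInt.Coe.ringHom) ^ (n + 1)) := by
        rw [← Finset.sum_add_distrib, ← Finset.sum_add_distrib, Finset.mul_sum, map_sum]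
        refine Finset.sum_congr rfl fun n hn => ?_
        have h1 : (e n : PowerSeries ℚ_[p]) =
            (N.factorial : PowerSeries ℚ_[p]) * C (logCoeff W p n) := by
          rw [← map_natCast (C : ℚ_[p] →+* _), ← map_mul, he n (Finset.mem_range.1 hn), map_intCast]
        simp only [map_mul, map_add, map_pow, map_intCast]
        rw [h1]
        ring
      rw [e1]
      rw [hg₁, hg₂, hg₃] at h
      linear_combination (N.factorial : PowerSeries ℚ_[p]) * h
    rw [X_pow_dvd_iff]
    intro m hm
    have h1 : coeff m (A.map PadicInt.Coe.ringHom) = 0 := by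
      refine X_pow_dvd_iff.1 ?_ m hm
      rw [hmap]
      exact (Dvd.intro _ rfl).mul_left _
    rw [coeff_map] at h1
    exact PadicInt.coe_eq_zero.1 h1
  have h1 := norm_evalP_le hA
  have h2 : ((evalP p A : ℤ_[p]) : ℚ_[p]) = N.factorial *
      (∑ n ∈ Finset.range N, logCoeff W p n * (evalP p z₁ : ℚ_[p]) ^ (n + 1) +
      ∑ n ∈ Finset.range N, logCoeff W p n * (evalP p z₂ : ℚ_[p]) ^ (n + 1) +
      ∑ n ∈ Finset.range N, logCoeff W p n * (evalP p z₃ : ℚ_[p]) ^ (n + 1)) := by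
    rw [← Finset.sum_add_distrib, ← Finset.sum_add_distrib, Finset.mul_sum]
    simp only [A, map_sum]
    rw [PadicInt.coe_sum]
    refine Finset.sum_congr rfl fun n hn => ?_
    simp only [map_mul, map_add, map_pow, map_intCast]
    push_cast
    rw [← he n (Finset.mem_range.1 hn)]
    ring
  rw [PadicInt.norm_def, h2, norm_mul] at h1
  have h3 := (mul_le_mul_of_nonneg_right (pow_le_norm_factorial hp N) (norm_nonneg _)).trans h1
  have h4 : N = (N - 1) / 2 + (N - (N - 1) / 2) := by lia
  have h5 : (0 : ℝ) < (p : ℝ)⁻¹ ^ ((N - 1) / 2) := pow_pos (inv_prime_pos p) _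
  have h6 : (p : ℝ)⁻¹ ^ N = (p : ℝ)⁻¹ ^ ((N - 1) / 2) * (p : ℝ)⁻¹ ^ (N - (N - 1) / 2) := by
    rw [← pow_add, ← h4]
  rw [h6] at h3
  refine (le_of_mul_le_mul_left h3 h5).trans ?_
  exact pow_le_pow_of_le_one (inv_prime_pos p).le (inv_prime_lt_one p).le (by lia)

include hp in
/-- The formal logarithm is additive. -/
theorem exists_third_formalLog (hΔ : (W.Δ : ℚ_[p]) ≠ 0) {z₁ z₂ : ℤ_[p]} {P₁ P₂ : Pt W ℚ_[p]}
    (h₁ : InFormal (IsLocalRing.maximalIdeal ℤ_[p]) z₁ P₁)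
    (h₂ : InFormal (IsLocalRing.maximalIdeal ℤ_[p]) z₂ P₂) :
    ∃ z₃, InFormal (IsLocalRing.maximalIdeal ℤ_[p]) z₃ (-(P₁ + P₂)) ∧
      formalLog W (z₁ : ℚ_[p]) + formalLog W (z₂ : ℚ_[p]) + formalLog W (z₃ : ℚ_[p]) = 0 := by
  obtain ⟨hz₁, w₁, hw₁, h₁, rfl⟩ := h₁
  obtain ⟨hz₂, w₂, hw₂, h₂, rfl⟩ := h₂
  have hI : IsLocalRing.maximalIdeal ℤ_[p] ≤ Ideal.jacobson ⊥ :=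
    IsLocalRing.maximalIdeal_le_jacobson _
  obtain ⟨a, ha⟩ : ∃ a, z₁ = p * a := by
    rwa [PadicInt.maximalIdeal_eq_span_p, Ideal.mem_span_singleton] at hz₁
  obtain ⟨b, hb⟩ : ∃ b, z₂ = p * b := by
    rwa [PadicInt.maximalIdeal_eq_span_p, Ideal.mem_span_singleton] at hz₂
  have hp0 : (p : ℤ_[p]) ≠ 0 := Nat.cast_ne_zero.2 (Fact.out : p.Prime).ne_zero
  -- The points are deformed to the series `a X` and `(b - c p) X + c X ^ 2`, with values `z₁` and
  -- `z₂` at `X = p`. Modulo `X ^ 2` the third series is minus their sum. Each condition says that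
  -- two of the three linear coefficients agree and excludes at most one `c`, so some `c` makes the
  -- three series distinct, as `sum_logSubst` requires.
  obtain ⟨c, hc⟩ : ∃ c : ℤ_[p], ¬ (a = b - c * p ∨ 2 * a + b = c * p ∨ a + 2 * b = 2 * (c * p)) := by
    have fin : ∀ f : ℤ_[p] → Prop, (∀ c d, f c → f d → c = d) → {c | f c}.Finite := fun f hf =>
      Set.Subsingleton.finite fun c hc d hd => hf c d hc hd
    have h := ((fin (fun c => a = b - c * p) fun c d hc hd =>
        mul_right_cancel₀ hp0 (by linear_combination hc - hd)).union
      ((fin (fun c => 2 * a + b = c * p) fun c d hc hd =>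
        mul_right_cancel₀ hp0 (by linear_combination hd - hc)).union
      (fin (fun c => a + 2 * b = 2 * (c * p)) fun c d hc hd =>
        mul_right_cancel₀ hp0 (mul_left_cancel₀ two_ne_zero (by linear_combination hd - hc)))))
    obtain ⟨c, hc⟩ := h.exists_notMem
    exact ⟨c, hc⟩
  let y₁ : PowerSeries ℤ_[p] := X * C a
  let y₂ : PowerSeries ℤ_[p] := X * (C (b - c * p) + C c * X)
  have hy₁ : X ∣ y₁ := Dvd.intro _ rfl
  have hy₂ : X ∣ y₂ := Dvd.intro _ rfl
  have e₁ : evalP p y₁ = z₁ := by simp only [y₁, map_mul, evalP_X, evalP_C, ha]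
  have e₂ : evalP p y₂ = z₂ := by
    simp only [y₂, map_mul, map_add, map_sub, evalP_X, evalP_C, hb]
    ring
  have hv₁ := X_dvd_intSubst hy₁ (X_dvd_wSeries W)
  have hv₂ := X_dvd_intSubst hy₂ (X_dvd_wSeries W)
  obtain ⟨l, n, y₃, h, k₁, k₂, hl, hn, hy₃, hC⟩ := exists_isChord span_X_le_jacobson
    (Ideal.mem_span_singleton.2 hy₁) (Ideal.mem_span_singleton.2 hv₁)
    (Ideal.mem_span_singleton.2 hy₂) (Ideal.mem_span_singleton.2 hv₂)
    (onZW_intSubst hy₁) (onZW_intSubst (W := W) hy₂)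
  rw [Ideal.span_singleton_pow, Ideal.mem_span_singleton] at hn hy₃
  have hn' : X ∣ n := (dvd_pow_self X two_ne_zero).trans hn
  have hy₃' : X ∣ y₃ := by
    have := dvd_sub (dvd_sub ((dvd_pow_self X two_ne_zero).trans hy₃) hy₁) hy₂
    rwa [show y₁ + y₂ + y₃ - y₁ - y₂ = y₃ by ring] at this
  have c₁ : coeff 1 y₁ = a := by simp [y₁, coeff_succ_X_mul (n := 0)]
  have c₂ : coeff 1 y₂ = b - c * p := by
    rw [show (1 : ℕ) = 0 + 1 from rfl, coeff_succ_X_mul]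
    simp
  have c₃ : coeff 1 y₁ + coeff 1 y₂ + coeff 1 y₃ = 0 := by
    rw [← map_add, ← map_add]
    exact X_pow_dvd_iff.1 hy₃ 1 one_lt_two
  rw [c₁, c₂] at c₃
  have hsum := sum_formalLog_evalP hp hy₁ hy₂ hy₃' (sum_logSubst h hC.ne_zero hy₁ hy₂ hy₃' hn'
    (fun h => hc (Or.inl (by rw [← c₁, h, c₂])))
    (fun h => hc (Or.inr (Or.inl (by
      rw [← h, c₁] at c₃
      linear_combination c₃))))
    (fun h => hc (Or.inr (Or.inr (by
      rw [← h, c₂] at c₃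
      linear_combination c₃)))))
  rw [e₁, e₂] at hsum
  -- At `X = p` the deformed points become the given ones, because `w` is determined by `z`.
  have u₁ : w₁ = evalP p (intSubst hy₁ (wSeries W)) := by
    refine OnZW.unique hI hz₁ hw₁ (evalP_mem hv₁) h₁ ?_
    rw [← e₁]
    exact (onZW_intSubst hy₁).map _
  have u₂ : w₂ = evalP p (intSubst hy₂ (wSeries W)) := by
    refine OnZW.unique hI hz₂ hw₂ (evalP_mem hv₂) h₂ ?_
    rw [← e₂]
    exact (onZW_intSubst hy₂).map _
  refine ⟨evalP p y₃, ⟨evalP_mem hy₃', evalP p (l * y₃ + n),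
    evalP_mem (dvd_add (hy₃'.mul_left l) hn'), h.rotate.rotate.onZW.map _, ?_⟩, hsum⟩
  have hC' : chordLead W (algebraMap ℤ_[p] ℚ_[p] (evalP p l)) ≠ 0 := by
    rw [← map_chordLead, ← map_chordLead]
    exact ((hC.map (evalP p)).map (algebraMap ℤ_[p] ℚ_[p])).ne_zero
  have := ((h.map (evalP p)).map (algebraMap ℤ_[p] ℚ_[p])).add_eq_zero hΔ hC'
  have m₁ : evalP p l * z₁ + evalP p n = w₁ := by rw [u₁, k₁, map_add, map_mul, e₁]
  have m₂ : evalP p l * z₂ + evalP p n = w₂ := by rw [u₂, k₂, map_add, map_mul, e₂]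
  rw [e₁, e₂] at this
  simp only [← map_mul, ← map_add, m₁, m₂] at this
  exact (eq_neg_of_add_eq_zero_right this).symm

end LogAnalytic

/-! ### The logarithm on `E(ℚ_p)` -/

section LogPoints

variable {p : ℕ} [Fact p.Prime] (hp : 2 < p) {W : WeierstrassCurve ℤ}

local notation "𝔪" => IsLocalRing.maximalIdeal ℤ_[p]

theorem InFormal.norm_le {z : ℤ_[p]} {P : Pt W ℚ_[p]} (h : InFormal 𝔪 z P) :
    ‖(z : ℚ_[p])‖ ≤ (p : ℝ)⁻¹ := (norm_le_inv_iff_mem z).2 h.1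

include hp in
theorem formalLog_z_add (hΔ : (W.Δ : ℚ_[p]) ≠ 0) {z₁ z₂ : ℤ_[p]} {P₁ P₂ : Pt W ℚ_[p]}
    (h₁ : InFormal 𝔪 z₁ P₁) (h₂ : InFormal 𝔪 z₂ P₂) :
    formalLog W (Pt.z W (P₁ + P₂)) = formalLog W (Pt.z W P₁) + formalLog W (Pt.z W P₂) := by
  obtain ⟨z, h, -⟩ := h₁.add hΔ (IsLocalRing.maximalIdeal_le_jacobson _) h₂
  obtain ⟨z₃, h₃, e₃⟩ := exists_third_formalLog hp hΔ h₁ h₂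
  -- The chords through `P₁, P₂` and through `P₁ + P₂, 0` have the same third point `-(P₁ + P₂)`;
  -- comparing the two relations gives additivity.
  obtain ⟨z₄, h₄, e₄⟩ := exists_third_formalLog hp hΔ h (inFormal_zero 𝔪)
  rw [add_zero] at h₄
  have e : (z₃ : ℚ_[p]) = z₄ := (h₃.z_eq hΔ).symm.trans (h₄.z_eq hΔ)
  rw [h.z_eq hΔ, h₁.z_eq hΔ, h₂.z_eq hΔ]
  change formalLog W (z : ℚ_[p]) = formalLog W (z₁ : ℚ_[p]) + formalLog W (z₂ : ℚ_[p])
  rw [PadicInt.coe_zero, formalLog_zero] at e₄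
  rw [e] at e₃
  linear_combination e₄ - e₃

include hp in
theorem formalLog_z_nsmul (hΔ : (W.Δ : ℚ_[p]) ≠ 0) {z : ℤ_[p]} {P : Pt W ℚ_[p]}
    (h : InFormal 𝔪 z P) (n : ℕ) :
    formalLog W (Pt.z W (n • P)) = n * formalLog W (Pt.z W P) := by
  induction n with
  | zero =>
    rw [zero_smul, (inFormal_zero 𝔪).z_eq hΔ, map_zero, formalLog_zero, Nat.cast_zero, zero_mul]
  | succ n ih =>
    obtain ⟨z', h', -⟩ := h.nsmul hΔ (IsLocalRing.maximalIdeal_le_jacobson _) n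
    rw [succ_nsmul, formalLog_z_add hp hΔ h' h, ih]
    push_cast
    ring

theorem exists_inFormal_of_norm_le {t : ℚ_[p]} (ht : ‖t‖ ≤ (p : ℝ)⁻¹) :
    ∃ (z : ℤ_[p]) (P : Pt W ℚ_[p]), (z : ℚ_[p]) = t ∧ InFormal 𝔪 z P := by
  let z : ℤ_[p] := ⟨t, ht.trans (inv_prime_lt_one p).le⟩
  have hz : z ∈ 𝔪 := (norm_le_inv_iff_mem z).1 ht
  obtain ⟨a, ha⟩ : ∃ a, z = p * a := by
    rwa [PadicInt.maximalIdeal_eq_span_p, Ideal.mem_span_singleton] at hz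
  have hy : (PowerSeries.X : PowerSeries ℤ_[p]) ∣ PowerSeries.X * PowerSeries.C a := Dvd.intro _ rfl
  have e : evalP p (PowerSeries.X * PowerSeries.C a) = z := by rw [map_mul, evalP_X, evalP_C, ha]
  refine ⟨z, _, rfl, hz, evalP p (intSubst hy (wSeries W)),
    evalP_mem (X_dvd_intSubst hy (X_dvd_wSeries W)), ?_, rfl⟩
  rw [← e]
  exact (onZW_intSubst hy).map _

theorem toZMod_eq_zero_iff (x : ℤ_[p]) : PadicInt.toZMod x = 0 ↔ x ∈ 𝔪 := by
  rw [← PadicInt.ker_toZMod, RingHom.mem_ker]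

instance : IsLocalHom (PadicInt.toZMod (p := p)) where
  map_nonunit x hx := by
    by_contra h
    exact hx.ne_zero ((toZMod_eq_zero_iff x).2 h)

theorem norm_numPts (hap : ¬ ap W p ≡ 1 [ZMOD p]) : ‖(numPts W p : ℚ_[p])‖ = 1 := by
  rw [Padic.norm_natCast_eq_one_iff]
  refine ((Fact.out : p.Prime).coprime_iff_not_dvd.2 fun h => hap ?_)
  rw [Int.modEq_comm, Int.modEq_iff_dvd, ap]
  have : (p : ℤ) ∣ numPts W p := Int.natCast_dvd_natCast.2 h
  rw [show (p : ℤ) + 1 - numPts W p - 1 = p - numPts W p by ring]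
  exact dvd_sub dvd_rfl this

theorem norm_ratCast_eq_one {u : ℚ} (hu : u ≠ 0) (hu' : padicValRat p u = 0) :
    ‖(u : ℚ_[p])‖ = 1 := by
  rw [Padic.eq_padicNorm, padicNorm.eq_zpow_of_nonzero hu, hu']
  simp

theorem intCast_ne_zero_of_not_dvd (hgood : ¬ (p : ℤ) ∣ W.Δ) : (W.Δ : ZMod p) ≠ 0 := fun h =>
  hgood ((ZMod.intCast_zmod_eq_zero_iff_dvd _ _).1 h)

include hp in
/-- The logarithm is a homomorphism onto `pℤ_p` with kernel of order prime to `p`. -/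
theorem exists_ptLog_hom (hgood : ¬ (p : ℤ) ∣ W.Δ) (hap : ¬ ap W p ≡ 1 [ZMOD p])
    {u : ℚ} (hu : u ≠ 0) (hu' : padicValRat p u = 0) :
    ∃ L : Pt W ℚ_[p] →+ ℤ_[p], (∀ P, (L P : ℚ_[p]) = ptLog W p u P) ∧
      (∀ c, (∃ P, L P = c) ↔ (p : ℤ_[p]) ∣ c) ∧ ∀ P, L P = 0 → numPts W p • P = 0 := by
  have hΔ' := intCast_ne_zero_of_not_dvd hgood
  have hΔ : (W.Δ : ℚ_[p]) ≠ 0 := Δ_ne_zero_of_red (φ := PadicInt.toZMod (p := p)) hΔ'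
  have hm := norm_numPts hap
  have hun := norm_ratCast_eq_one hu hu'
  have hm0 : (numPts W p : ℚ_[p]) ≠ 0 := norm_ne_zero_iff.1 (by rw [hm]; exact one_ne_zero)
  have hu0 : (u : ℚ_[p]) ≠ 0 := norm_ne_zero_iff.1 (by rw [hun]; exact one_ne_zero)
  have hE : ∀ P : Pt W ℚ_[p], ∃ z, InFormal 𝔪 z (numPts W p • P) := fun P =>
    exists_inFormal_card_nsmul (PadicInt.toZMod (p := p)) hΔ' P
  have hn : ∀ P : Pt W ℚ_[p], ‖ptLog W p u P‖ ≤ (p : ℝ)⁻¹ := fun P => by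
    obtain ⟨z, hz⟩ := hE P
    rw [ptLog, norm_mul, norm_mul, norm_inv, hm, hun, inv_one, one_mul, one_mul, hz.z_eq hΔ]
    exact norm_formalLog_le hp W hz.norm_le
  have hadd : ∀ P Q : Pt W ℚ_[p], ptLog W p u (P + Q) = ptLog W p u P + ptLog W p u Q :=
    fun P Q => by
      obtain ⟨z, hz⟩ := hE P
      obtain ⟨z', hz'⟩ := hE Q
      rw [ptLog, ptLog, ptLog, smul_add, formalLog_z_add hp hΔ hz hz']
      ring
  refine ⟨AddMonoidHom.mk' (fun P => ⟨ptLog W p u P, (hn P).trans (inv_prime_lt_one p).le⟩)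
    fun P Q => Subtype.ext (hadd P Q), fun P => rfl, fun c => ⟨?_, fun hc => ?_⟩, fun P hP => ?_⟩
  · rintro ⟨P, rfl⟩
    rw [← Ideal.mem_span_singleton, ← PadicInt.maximalIdeal_eq_span_p, ← norm_le_inv_iff_mem]
    exact hn P
  · rw [← Ideal.mem_span_singleton, ← PadicInt.maximalIdeal_eq_span_p, ← norm_le_inv_iff_mem] at hc
    -- A point of `E₁` with formal logarithm `u⁻¹ * c` suffices: on `E₁` the factor `#E(𝔽_p)`
    -- cancels.
    obtain ⟨t, ht, htc⟩ := exists_formalLog_eq hp W (c := (u : ℚ_[p])⁻¹ * c)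
      (by rwa [norm_mul, norm_inv, hun, inv_one, one_mul])
    obtain ⟨z, P, rfl, hz⟩ := exists_inFormal_of_norm_le (W := W) ht
    refine ⟨P, Subtype.ext ?_⟩
    change ptLog W p u P = c
    rw [ptLog, formalLog_z_nsmul hp hΔ hz, hz.z_eq hΔ]
    change (u : ℚ_[p]) * ((numPts W p : ℚ_[p])⁻¹ * (numPts W p * formalLog W (z : ℚ_[p]))) = c
    rw [htc]
    field_simp
  · have h : ptLog W p u P = 0 := congrArg Subtype.val hP
    obtain ⟨z, hz⟩ := hE P
    rw [ptLog, hz.z_eq hΔ, mul_eq_zero, mul_eq_zero, inv_eq_zero] at h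
    have h0 : z = 0 := PadicInt.coe_eq_zero.1 (eq_zero_of_formalLog_eq_zero hp W hz.norm_le
      ((h.resolve_left hu0).resolve_left hm0))
    obtain ⟨hz1, w, hw, hzw, e⟩ := hz
    subst h0
    have : w = 0 := OnZW.unique (IsLocalRing.maximalIdeal_le_jacobson _) hz1 hw (Ideal.zero_mem _)
      hzw onZW_zero
    rw [e, this, map_zero, Pt.ofZW_zero]

end LogPoints

/-! ### Places of function fields of one variable -/

section Places

open IntermediateField algebraAdjoinAdjoin

/-- The Steinitz exchange property for algebraic dependence, from the matroid of algebraically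
independent sets. -/
theorem isAlgebraic_adjoin_exchange {k L : Type*} [Field k] [Field L] [Algebra k L] {x h : L}
    (h₁ : IsAlgebraic k⟮x⟯ h) (h₂ : Transcendental k h) : IsAlgebraic k⟮h⟯ x := by
  rw [← IsFractionRing.isAlgebraic_iff (Algebra.adjoin k {x})] at h₁
  rw [← IsFractionRing.isAlgebraic_iff (Algebra.adjoin k {h})]
  have key := (AlgebraicIndependent.matroid k L).closure_exchange (X := ∅) (e := h) (f := x)
  simp only [AlgebraicIndependent.matroid_closure_eq, insert_empty_eq] at key
  refine (Subalgebra.mem_algebraicClosure _ _).1 (key ⟨h₁, fun h' => h₂ ?_⟩).1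
  have := (Subalgebra.mem_algebraicClosure _ _).1 h'
  rw [Algebra.adjoin_empty] at this
  exact Subalgebra.isAlgebraic_of_isAlgebraic_bot this

/-- A relation for `a` over `k(h)` with denominators cleared: the coefficients are polynomials in
`h`, so it can be specialized at `h = 0`. -/
theorem exists_eval₂_eq_zero {k L : Type*} [Field k] [Field L] [Algebra k L] {h a : L}
    (ha : IsAlgebraic k⟮h⟯ a) : ∃ G : Polynomial (Polynomial k), G ≠ 0 ∧
      G.eval₂ (Polynomial.aeval h).toRingHom a = 0 := by
  rw [← IsFractionRing.isAlgebraic_iff (Algebra.adjoin k {h})] at ha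
  obtain ⟨q, hq, e⟩ := ha
  obtain ⟨G, rfl⟩ := Polynomial.map_surjective ((Polynomial.aeval h).codRestrict
    (Algebra.adjoin k {h}) fun q => Polynomial.aeval_mem_adjoin_singleton k h).toRingHom (by
      rintro ⟨b, hb⟩
      obtain ⟨q, rfl⟩ := (Algebra.adjoin_singleton_eq_range_aeval k h).le hb
      exact ⟨q, rfl⟩) q
  refine ⟨G, fun h0 => hq (by rw [h0, Polynomial.map_zero]), ?_⟩
  rwa [← Polynomial.eval_map_algebraMap, Polynomial.map_map, Polynomial.eval_map] at e

variable {k F : Type*} [Field k] [IsAlgClosed k] [Field F] [Algebra k F]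

/-- A `k`-rational zero of a non-constant function `h`, as a valuation ring with residue field `k`.
-/
theorem exists_valuationSubring {h : F} (hh : Transcendental k h)
    (hF : ∀ a : F, ∃ G : Polynomial (Polynomial k), G ≠ 0 ∧
      G.eval₂ (Polynomial.aeval h).toRingHom a = 0) :
    ∃ (V : ValuationSubring F) (φ : V →+* k) (ι : k →+* V) (t : V), IsLocalHom φ ∧
      (t : F) = h ∧ φ t = 0 ∧ (∀ c, φ (ι c) = c) ∧ ∀ c, (ι c : F) = algebraMap k F c := by
  let A := Algebra.adjoin k {h}
  let h' : A := ⟨h, Algebra.self_mem_adjoin_singleton k h⟩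
  have hI : (Ideal.span {h'} : Ideal A) ≠ ⊤ := by
    rw [Ne, Ideal.span_singleton_eq_top]
    rintro hu
    obtain ⟨⟨b, hb⟩, e⟩ := hu.exists_right_inv
    obtain ⟨q, rfl⟩ := (Algebra.adjoin_singleton_eq_range_aeval k h).le hb
    have e' : h * Polynomial.aeval h q = 1 := congrArg Subtype.val e
    have := transcendental_iff.1 hh (.X * q - 1) (by simp [e'])
    have := congrArg (Polynomial.eval 0) this
    simp at this
  obtain ⟨V, hAV, hV⟩ := Ideal.image_subset_nonunits_valuationSubring (A := A.toSubring) _ hI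
  have hhV : h ∈ V.nonunits := hV ⟨h', Ideal.mem_span_singleton_self _, rfl⟩
  let ι : k →+* V := (algebraMap k F).codRestrict V.toSubring fun c => hAV (A.algebraMap_mem c)
  let t : V := ⟨h, hAV h'.2⟩
  have ht : IsLocalRing.residue V t = 0 :=
    (IsLocalRing.residue_eq_zero_iff _).2 ((V.coe_mem_nonunits_iff (a := t)).1 hhV)
  let κ := IsLocalRing.ResidueField V
  let _ : Algebra k κ := ((IsLocalRing.residue V).comp ι).toAlgebra
  -- Divide a relation `G(h, a) = 0` by the highest power of `h` that divides it. At `h = 0` it then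
  -- gives a nonzero polynomial over `k` with the residue of `a` as a root. As `k` is algebraically
  -- closed, `κ = k`.
  have halg : Algebra.IsAlgebraic k κ := ⟨fun b => by
    obtain ⟨a, rfl⟩ := IsLocalRing.residue_surjective b
    obtain ⟨G, hG, e⟩ := hF a
    have hXu : ¬ IsUnit (Polynomial.C (Polynomial.X : Polynomial k)) := by
      rw [Polynomial.isUnit_C]
      exact Polynomial.not_isUnit_X
    obtain ⟨n, G, hXG, rfl⟩ := WfDvdMonoid.max_power_factor' hG hXu
    rw [Polynomial.eval₂_mul, Polynomial.eval₂_pow, Polynomial.eval₂_C] at e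
    have hh0 : h ≠ 0 := fun h0 => hh (h0 ▸ isAlgebraic_zero)
    have e1 := (mul_eq_zero.1 e).resolve_left (pow_ne_zero _ (by simpa using hh0))
    let ψ : Polynomial k →+* V := Polynomial.eval₂RingHom ι t
    have e2 : G.eval₂ ψ a = 0 := by
      refine Subtype.val_injective ?_
      have hψ : V.subtype.comp ψ = (Polynomial.aeval h).toRingHom := by
        refine Polynomial.ringHom_ext (fun c => ?_) ?_
        · simp [ψ, ι]
        · simp [ψ, t]
      change V.subtype _ = 0
      rw [Polynomial.hom_eval₂, hψ]
      exact e1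
    refine ⟨G.map (Polynomial.evalRingHom 0), fun h0 => hXG ?_, ?_⟩
    · refine (Polynomial.C_dvd_iff_dvd_coeff _ _).2 fun i => ?_
      rw [Polynomial.X_dvd_iff, Polynomial.coeff_zero_eq_eval_zero]
      have := congrArg (fun q => q.coeff i) h0
      simpa using this
    · have e3 := congrArg (IsLocalRing.residue V) e2
      rw [Polynomial.hom_eval₂, map_zero] at e3
      rw [Polynomial.aeval_def, Polynomial.eval₂_map, ← e3]
      congr 1
      ext
      · simp [ψ]; rfl
      · simp [ψ, ht]⟩
  have hb := IsAlgClosed.algebraMap_bijective_of_isIntegral (k := k) (K := κ)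
  let e := RingEquiv.ofBijective (algebraMap k κ) hb
  have hloc : IsLocalHom (e.symm.toRingHom.comp (IsLocalRing.residue V)) :=
    RingHom.isLocalHom_comp _ _
  refine ⟨V, _, ι, t, hloc, rfl, ?_, fun c => ?_, fun c => rfl⟩
  · simp [ht]
  · exact e.symm_apply_apply c

end Places

/-! ### Divisibility of the group of points over an algebraically closed field -/

section Divisible

open IntermediateField

variable {W : WeierstrassCurve ℤ}

/-- The equation gives `w ∈ I ^ 2`, so `x = z / w = c` with `c` in `R` would force `z = c * w ∈ I ^
2`. This certifies that `x` is not constant. -/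
theorem InFormal.exists_some {R F : Type*} [CommRing R] [Field F] [Algebra R F]
    [FaithfulSMul R F] (hΔ : (W.Δ : F) ≠ 0) {I : Ideal R} {z : R} {P : Pt W F}
    (h : InFormal I z P) (hz : z ∉ I ^ 2) :
    ∃ (x y : F) (h : (W.baseChange F).toAffine.Nonsingular x y), P = Pt.some h ∧
      ∀ c : R, x ≠ algebraMap R F c := by
  obtain ⟨hz1, w, hw, h, rfl⟩ := h
  have hinj := FaithfulSMul.algebraMap_injective R F
  have hw2 : w ∈ I ^ 2 := by
    rw [h, pow_two]
    have h1 := Ideal.mul_mem_mul hz1 hz1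
    have h2 := Ideal.mul_mem_mul hz1 hw
    have h3 := Ideal.mul_mem_mul hw hw
    rw [show z ^ 3 + W.a₁ * z * w + W.a₂ * z ^ 2 * w + W.a₃ * w ^ 2 + W.a₄ * z * w ^ 2 +
      W.a₆ * w ^ 3 = z * (z * z) + W.a₁ * (z * w) + W.a₂ * z * (z * w) + W.a₃ * (w * w) +
      W.a₄ * z * (w * w) + W.a₆ * w * (w * w) by ring]
    exact add_mem (add_mem (add_mem (add_mem (add_mem (Ideal.mul_mem_left _ _ h1)
      (Ideal.mul_mem_left _ _ h2)) (Ideal.mul_mem_left _ _ h2)) (Ideal.mul_mem_left _ _ h3))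
      (Ideal.mul_mem_left _ _ h3)) (Ideal.mul_mem_left _ _ h3)
  have h' := h.map (algebraMap R F)
  have hw0 : algebraMap R F w ≠ 0 := fun h0 => hz (by
    rw [h0] at h'
    rw [hinj (h'.eq_zero.trans (map_zero _).symm)]
    exact zero_mem _)
  refine ⟨_, _, _, Pt.ofZW_eq_some hΔ h' hw0, fun c hc => hz ?_⟩
  rw [div_eq_iff hw0, ← map_mul] at hc
  rw [hinj hc]
  exact Ideal.mul_mem_left _ _ hw2

theorem transcendental_of_forall_ne {k L : Type*} [Field k] [IsAlgClosed k] [Field L]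
    [Algebra k L] {f : L} (hf : ∀ c, f ≠ algebraMap k L c) : Transcendental k f := fun h => by
  have := IntermediateField.isAlgebraic_adjoin_simple h.isIntegral
  obtain ⟨c, hc⟩ := (IsAlgClosed.algebraMap_bijective_of_isIntegral (k := k) (K := k⟮f⟯)).2
    ⟨f, mem_adjoin_simple_self k f⟩
  exact hf c (congrArg Subtype.val hc).symm

/-- Multiples of a point with coordinates in a subfield have coordinates there. It serves to pass
from the field of fractions of `k[[X]]` to relative algebraic closures inside it. -/
theorem Pt.exists_lift_nsmul {F L : Type*} [Field F] [Field L] (j : F →+* L)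
    (hΔ : (W.Δ : F) ≠ 0) {x y : F} {f g : L}
    (h : (W.baseChange L).toAffine.Nonsingular (j x) (j y))
    (h' : (W.baseChange L).toAffine.Nonsingular f g) {n : ℕ} (hn : n • Pt.some h = Pt.some h') :
    ∃ (f₀ g₀ : F) (h₀ : (W.baseChange F).toAffine.Nonsingular x y)
      (h₀' : (W.baseChange F).toAffine.Nonsingular f₀ g₀),
      n • Pt.some h₀ = Pt.some h₀' ∧ j f₀ = f ∧ j g₀ = g := by
  have h₀ : (W.baseChange F).toAffine.Nonsingular x y := by
    have := (equation_iff_intCast W _ _).1 h.1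
    refine (nonsingular_iff_intCast W hΔ _ _).2 (j.injective ?_)
    simpa using this
  have e : n • Pt.map W j (Pt.some h₀) = Pt.some h' := hn
  rw [← map_nsmul] at e
  rcases (n • Pt.some h₀).eq_zero_or_some with h0 | ⟨f₀, g₀, h₀', h0⟩
  · rw [h0, map_zero] at e
    exact (Pt.some_ne_zero h' e.symm).elim
  · rw [h0] at e
    obtain ⟨e1, e2⟩ := WeierstrassCurve.Affine.Point.some.inj e
    exact ⟨f₀, g₀, h₀, h₀', h0, e1, e2⟩

theorem isAlgebraic_of_equation {M L : Type*} [Field M] [Field L] [Algebra M L] {x y : L}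
    (hx : IsAlgebraic M x) (h : (W.baseChange L).toAffine.Equation x y) : IsAlgebraic M y := by
  rw [equation_iff_intCast] at h
  let x' : algebraicClosure M L := ⟨x, mem_algebraicClosure_iff.2 hx⟩
  have hy : IsAlgebraic (algebraicClosure M L) y := by
    refine IsIntegral.isAlgebraic ⟨.X ^ 2 + .C (W.a₁ * x' + W.a₃) * .X -
      .C (x' ^ 3 + W.a₂ * x' ^ 2 + W.a₄ * x' + W.a₆), by monicity!, ?_⟩
    have e : algebraMap (algebraicClosure M L) L x' = x := rfl
    simp only [Polynomial.eval₂_sub, Polynomial.eval₂_add, Polynomial.eval₂_mul,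
      Polynomial.eval₂_pow, Polynomial.eval₂_X, Polynomial.eval₂_C]
    simp only [map_add, map_mul, map_pow, map_intCast, e]
    linear_combination h
  exact hy.restrictScalars M

/-- The coordinate function `f = x ∘ [n]` on the curve is not constant, and the coordinates of the
generic point are algebraic over `k(f - x₀)`. -/
theorem exists_generic.{v} {k : Type v} [Field k] [IsAlgClosed k] [CharZero k] (hΔ : (W.Δ : k) ≠ 0)
    {n : ℕ} (hn : n ≠ 0) (x₀ : k) :
    ∃ (F : Type v) (_ : Field F) (_ : Algebra k F) (x y f g : F)
      (h : (W.baseChange F).toAffine.Nonsingular x y)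
      (h' : (W.baseChange F).toAffine.Nonsingular f g),
      n • Pt.some h = Pt.some h' ∧ Transcendental k (f - algebraMap k F x₀) ∧
      ∀ a : F, ∃ G : Polynomial (Polynomial k), G ≠ 0 ∧
        G.eval₂ (Polynomial.aeval (f - algebraMap k F x₀)).toRingHom a = 0 := by
  let R := PowerSeries k
  let L := FractionRing R
  let I : Ideal R := Ideal.span {PowerSeries.X}
  have hI : I ≤ Ideal.jacobson ⊥ := span_X_le_jacobson
  have hΔL : ∀ {M : Type _} [Field M] [Algebra k M], (W.Δ : M) ≠ 0 := fun {M} _ _ h => by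
    rw [← map_intCast (algebraMap k M), map_eq_zero] at h
    exact hΔ h
  -- The formal point with `z = X` plays the part of the generic point. Its `n`-th multiple has `z ≡
  -- n X` modulo `X ^ 2`, so its `x`-coordinate `f` is not constant.
  have hX : InFormal I (PowerSeries.X : R) (Pt.ofZW W (algebraMap R L PowerSeries.X)
      (algebraMap R L ((wSeries W).map (Int.castRingHom k)))) := by
    refine ⟨Ideal.mem_span_singleton_self _, _, Ideal.mem_span_singleton.2 ?_, ?_, rfl⟩
    · simpa using map_dvd (PowerSeries.map (Int.castRingHom k)) (X_dvd_wSeries W)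
    · simpa using (onZW_wSeries W).map (PowerSeries.map (Int.castRingHom k))
  obtain ⟨z, hz, hzn⟩ := hX.nsmul hΔL hI n
  have hmem : ∀ q : R, q ∈ I ^ 2 → PowerSeries.coeff 1 q = 0 := fun q hq => by
    rw [Ideal.span_singleton_pow, Ideal.mem_span_singleton] at hq
    exact PowerSeries.X_pow_dvd_iff.1 hq 1 one_lt_two
  obtain ⟨x, y, h, e, -⟩ := hX.exists_some hΔL fun h0 => by
    have := hmem _ h0
    simp at this
  rw [e] at hz
  obtain ⟨f, g, h', e', hf⟩ := hz.exists_some hΔL fun h0 => by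
    have h1 := hmem _ h0
    have h2 := hmem _ hzn
    rw [map_sub, h1, zero_sub, neg_eq_zero, ← map_natCast (PowerSeries.C (R := k)),
      PowerSeries.coeff_C_mul, PowerSeries.coeff_one_X, mul_one] at h2
    exact hn (Nat.cast_eq_zero.1 h2)
  let t : L := f - algebraMap k L x₀
  have htr : Transcendental k t := transcendental_of_forall_ne fun c hc => by
    refine hf (algebraMap k R (c + x₀)) ?_
    rw [← IsScalarTower.algebraMap_apply, map_add, ← hc, sub_add_cancel]
  -- The coordinate `f` of the multiple is algebraic over `k(x)`, and so is `t`. As `t` is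
  -- transcendental over `k`, exchange makes `x` algebraic over `k(t)`.
  have hx : IsAlgebraic k⟮t⟯ x := by
    refine isAlgebraic_adjoin_exchange ?_ htr
    let M := algebraicClosure k⟮x⟯ L
    have hxM : IsAlgebraic k⟮x⟯ x :=
      isAlgebraic_algebraMap (⟨x, mem_adjoin_simple_self k x⟩ : k⟮x⟯)
    have hyM := isAlgebraic_of_equation hxM h.1
    obtain ⟨f₀, g₀, -, -, -, rfl, -⟩ := Pt.exists_lift_nsmul (algebraMap M L) hΔL
      (x := ⟨x, mem_algebraicClosure_iff.2 hxM⟩) (y := ⟨y, mem_algebraicClosure_iff.2 hyM⟩)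
      h h' e'
    have h1 : IsAlgebraic k⟮x⟯ (algebraMap M L f₀) := mem_algebraicClosure_iff.1 f₀.2
    have h2 : IsAlgebraic k⟮x⟯ (algebraMap k L x₀) := (isAlgebraic_algebraMap x₀).tower_top _
    exact h1.sub h2
  have hy := isAlgebraic_of_equation hx h.1
  let M := (algebraicClosure k⟮t⟯ L).restrictScalars k
  obtain ⟨f₀, g₀, h₀, h₀', e₀, ef, -⟩ := Pt.exists_lift_nsmul (algebraMap M L) hΔL
    (x := ⟨x, mem_algebraicClosure_iff.2 hx⟩) (y := ⟨y, mem_algebraicClosure_iff.2 hy⟩) h h' e'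
  have et : algebraMap M L (f₀ - algebraMap k M x₀) = t := by
    rw [map_sub, ef, ← IsScalarTower.algebraMap_apply]
  refine ⟨M, inferInstance, inferInstance, _, _, f₀, g₀, h₀, h₀', e₀, ?_, fun a => ?_⟩
  · rw [← et] at htr
    exact (transcendental_algebraMap_iff (algebraMap M L).injective).1 htr
  · obtain ⟨G, hG, eG⟩ := exists_eval₂_eq_zero (mem_algebraicClosure_iff.1 a.2)
    refine ⟨G, hG, (algebraMap M L).injective ?_⟩
    rw [Polynomial.hom_eval₂, map_zero, ← eG]
    congr 1
    refine Polynomial.ringHom_ext (fun c => ?_) ?_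
    · simp [← IsScalarTower.algebraMap_apply]
    · simpa using et

/-- The group of points over an algebraically closed field of characteristic zero is divisible. -/
theorem Pt.exists_nsmul_eq {k : Type*} [Field k] [IsAlgClosed k] [CharZero k]
    (hΔ : (W.Δ : k) ≠ 0) {n : ℕ} (hn : n ≠ 0) (P : Pt W k) : ∃ Q, n • Q = P := by
  rcases P.eq_zero_or_some with rfl | ⟨x₀, y₀, hP, rfl⟩
  · exact ⟨0, smul_zero n⟩
  obtain ⟨F, _, _, x, y, f, g, h, h', e, htr, halg⟩ := exists_generic hΔ hn x₀
  -- At a zero of `f - x₀` the generic point reduces to some `Q`, and `n • Q` is the reduction of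
  -- the point `(f, g)`. Its `x`-coordinate is `x₀`, so `n • Q` is the given point or its negative.
  obtain ⟨V, φ, ι, t, hφ, et, ht, hι, hιF⟩ := exists_valuationSubring htr halg
  have hΔF : (W.Δ : F) ≠ 0 := Δ_ne_zero_of_red (φ := φ) hΔ
  obtain ⟨Q, hQ⟩ := exists_isRed φ hΔ (Pt.some h)
  have hnQ := hQ.nsmul hΔ n
  rw [e] at hnQ
  let r : V := t + ι x₀
  have hr : algebraMap V F r = f := by
    change ((t + ι x₀ : V) : F) = f
    push_cast
    rw [et, hιF, sub_add_cancel]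
  rcases hnQ with ⟨⟨z, hz, w, hw, hzw, e1⟩, -⟩ | ⟨x', y', h1, h2, e1, e2⟩
  -- Here `f = r` is integral, so `z = r * w`, and the equation becomes `w * (1 - s) = 0` with `s`
  -- in the maximal ideal. This forces `w = 0`, which is false for an affine point.
  · exfalso
    have hzw' := hzw.map (algebraMap V F)
    have hw0 : algebraMap V F w ≠ 0 := fun h0 => by
      rw [h0, Pt.ofZW_zero] at e1
      exact Pt.some_ne_zero h' e1
    rw [Pt.ofZW_eq_some hΔF hzw' hw0] at e1
    have e2 := (WeierstrassCurve.Affine.Point.some.inj e1).1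
    rw [eq_div_iff hw0, ← hr, ← map_mul] at e2
    have hzr : r * w = z := IsFractionRing.injective V F e2
    let s := r * z ^ 2 + W.a₁ * z + W.a₂ * z ^ 2 + W.a₃ * w + W.a₄ * z * w + W.a₆ * w ^ 2
    have hs : s ∈ IsLocalRing.maximalIdeal V := by
      rw [← map_eq_zero_iff_mem (φ := φ)] at hz hw ⊢
      simp [s, hz, hw]
    have h1 : w * (1 - s) = 0 := by
      rw [OnZW] at hzw
      simp only [s]
      linear_combination hzw - z ^ 2 * hzr
    rcases mul_eq_zero.1 h1 with h0 | h0
    · exact hw0 (by rw [h0, map_zero])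
    · rw [← sub_eq_zero.1 h0] at hs
      exact (Ideal.ne_top_iff_one _).1 (IsLocalRing.maximalIdeal.isMaximal V).ne_top hs
  · have e3 := (WeierstrassCurve.Affine.Point.some.inj e1).1
    rw [← hr] at e3
    obtain rfl := IsFractionRing.injective V F e3
    have e4 : φ r = x₀ := by simp [r, ht, hι]
    rcases WeierstrassCurve.Affine.Y_eq_of_X_eq hP.1 h2.1 e4.symm with h0 | h0
    · exact ⟨Q, e2.trans (Pt.some_congr _ _ e4 h0.symm)⟩
    · refine ⟨-Q, ?_⟩
      rw [smul_neg, e2]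
      exact (WeierstrassCurve.Affine.Point.neg_some h2).trans (Pt.some_congr _ _ e4 h0.symm)

end Divisible

/-! ### Completions at primes of degree one -/

section PadicEquiv

/-- Both fields are completions of `ℚ` for the same absolute value. The isometric extension of `ℚ →
F` has closed range containing a dense subset. -/
theorem exists_padic_ringEquiv {p : ℕ} [Fact p.Prime] {F : Type*} [NormedField F]
    [CompleteSpace F] [CharZero F] (hnorm : ∀ q : ℚ, ‖(q : F)‖ = ‖(q : ℚ_[p])‖)
    (hF : DenseRange ((↑) : ℚ → F)) : ∃ e : ℚ_[p] ≃+* F, ∀ x, ‖e x‖ = ‖x‖ := by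
  let c := Rat.castHom ℚ_[p]
  let s : ℚ ≃+* c.range := RingEquiv.ofBijective c.rangeRestrict
    ⟨fun a b h => c.injective (congrArg Subtype.val h), c.rangeRestrict_surjective⟩
  let i : c.range →+* ℚ_[p] := c.range.subtype
  let f : c.range →+* F := (Rat.castHom F).comp s.symm.toRingHom
  have hi : IsUniformInducing i := isometry_subtype_coe.isUniformInducing
  have hd : DenseRange i := by
    have := Padic.denseRange_ratCast p
    intro x
    refine closure_mono ?_ (this x)
    rintro _ ⟨q, rfl⟩
    exact ⟨s q, rfl⟩
  have hfn : ∀ a, ‖f a‖ = ‖i a‖ := fun a => by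
    obtain ⟨q, rfl⟩ := s.surjective a
    change ‖(Rat.castHom F) (s.symm (s q))‖ = ‖(q : ℚ_[p])‖
    rw [s.symm_apply_apply]
    exact hnorm q
  have hf : Isometry f := AddMonoidHomClass.isometry_of_norm f hfn
  let φ := IsDenseInducing.extendRingHom hi hd hf.uniformContinuous
  have hφf : ∀ a, φ (i a) = f a := fun a =>
    (hi.isDenseInducing hd).extend_eq hf.continuous a
  have hφc : Continuous φ :=
    (uniformContinuous_uniformly_extend hi hd hf.uniformContinuous).continuous
  have hφn : ∀ x, ‖φ x‖ = ‖x‖ := fun x => by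
    refine hd.induction_on (p := fun x => ‖φ x‖ = ‖x‖) x
      (isClosed_eq hφc.norm continuous_norm) fun a => ?_
    rw [hφf, hfn]
  have hφi : Isometry φ := AddMonoidHomClass.isometry_of_norm φ hφn
  have hφs : Function.Surjective φ := fun y => by
    have hcl := hφi.isClosedEmbedding.isClosed_range
    have := hF y
    refine closure_minimal ?_ hcl this
    rintro _ ⟨q, rfl⟩
    exact ⟨(q : ℚ_[p]), map_ratCast φ q⟩
  exact ⟨RingEquiv.ofBijective φ ⟨φ.injective, hφs⟩, hφn⟩

variable {p : ℕ} [Fact p.Prime] {K : Type*} [Field K] [NumberField K]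
  {v v' : HeightOneSpectrum (𝓞 K)}

theorem absNorm_eq_of_split (hK : Module.finrank ℚ K = 2)
    (hsplit : Ideal.span {(p : 𝓞 K)} = v.asIdeal * v'.asIdeal) : Ideal.absNorm v.asIdeal = p := by
  have h : Ideal.absNorm v.asIdeal * Ideal.absNorm v'.asIdeal = p ^ 2 := by
    rw [← map_mul, ← hsplit, Ideal.absNorm_span_singleton, ← map_natCast (algebraMap ℤ (𝓞 K)),
      Algebra.norm_algebraMap, RingOfIntegers.rank, hK, Int.natAbs_pow, Int.natAbs_natCast]
  have h1 := NumberField.HeightOneSpectrum.one_lt_absNorm v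
  have h2 := NumberField.HeightOneSpectrum.one_lt_absNorm v'
  exact ((Nat.Prime.mul_eq_prime_sq_iff Fact.out h1.ne' h2.ne').1 h).1

theorem exists_int_sub_mem (hv : Ideal.absNorm v.asIdeal = p) (r : 𝓞 K) :
    ∃ n : ℤ, r - n ∈ v.asIdeal := by
  have hcard : Nat.card (𝓞 K ⧸ v.asIdeal) = p := hv
  have : Finite (𝓞 K ⧸ v.asIdeal) :=
    Nat.finite_of_card_ne_zero (by rw [hcard]; exact (Fact.out : p.Prime).ne_zero)
  let _ := Fintype.ofFinite (𝓞 K ⧸ v.asIdeal)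
  let e := ZMod.ringEquivOfPrime (𝓞 K ⧸ v.asIdeal) (Fact.out : p.Prime)
    (by rw [← Nat.card_eq_fintype_card, hcard])
  obtain ⟨n, hn⟩ := ZMod.intCast_surjective (e.symm (Ideal.Quotient.mk _ r))
  refine ⟨n, Ideal.Quotient.eq.1 ?_⟩
  rw [map_intCast, ← e.apply_symm_apply (Ideal.Quotient.mk _ r), ← hn, map_intCast]

theorem intValuation_prime (hvv' : v ≠ v')
    (hsplit : Ideal.span {(p : 𝓞 K)} = v.asIdeal * v'.asIdeal) :
    v.intValuation (p : 𝓞 K) = WithZero.exp (-1) := by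
  have hp0 : (p : 𝓞 K) ≠ 0 := Nat.cast_ne_zero.2 (Fact.out : p.Prime).ne_zero
  rw [v.intValuation_eq_exp_neg_multiplicity hp0, hsplit,
    multiplicity_eq_of_dvd_of_not_dvd (k := 1) (by rw [pow_one]; exact Dvd.intro _ rfl) fun h => ?_]
  · rfl
  · rw [pow_succ, pow_one] at h
    have h1 := (mul_dvd_mul_iff_left v.ne_bot).1 h
    have h2 := v'.isMaximal.eq_of_le v.isPrime.ne_top (Ideal.dvd_iff_le.1 h1)
    exact hvv' (HeightOneSpectrum.ext h2.symm)

/-- Successive approximation: the residue field is `𝔽_p` and `p` is a uniformizer, so each digit can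
be taken in `ℤ`. -/
theorem exists_int_intValuation_le (hv : Ideal.absNorm v.asIdeal = p)
    (hp : v.intValuation (p : 𝓞 K) = WithZero.exp (-1)) (N : ℕ) :
    ∀ r : 𝓞 K, ∃ n : ℤ, v.intValuation (r - n) ≤ WithZero.exp (-(N : ℤ)) := by
  induction N with
  | zero => exact fun r => ⟨0, by simpa using v.intValuation_le_one _⟩
  | succ N ih =>
    intro r
    obtain ⟨n₀, h₀⟩ := exists_int_sub_mem hv r
    have h₀' : v.intValuation (r - n₀) ≤ v.intValuation (p : 𝓞 K) := by
      rw [hp]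
      exact (v.intValuation_le_pow_iff_mem _ 1).2 (by rwa [pow_one])
    obtain ⟨y, hy⟩ := v.exists_intValuation_mul_sub_lt h₀' (Multiplicative.ofAdd (-(N + 1 : ℕ)))
    obtain ⟨n₁, h₁⟩ := ih y
    refine ⟨n₀ + n₁ * p, ?_⟩
    have e : r - ((n₀ + n₁ * p : ℤ) : 𝓞 K) = (r - n₀ - y * p) + (y - n₁) * p := by
      push_cast
      ring
    rw [e]
    refine (Valuation.map_add _ _ _).trans (max_le hy.le ?_)
    rw [map_mul, hp]
    refine (mul_le_mul_left h₁ _).trans (le_of_eq ?_)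
    rw [← WithZero.exp_add]
    congr 1
    push_cast
    ring

theorem toNNReal_exp {a : NNReal} (ha : a ≠ 0) (k : ℤ) :
    WithZeroMulInt.toNNReal ha (WithZero.exp k) = a ^ k := by
  rw [WithZeroMulInt.toNNReal_neg_apply ha WithZero.exp_ne_zero]
  rfl

omit [Fact p.Prime] in
theorem norm_algebraMap_le_pow (hv : Ideal.absNorm v.asIdeal = p) {r : 𝓞 K} {N : ℕ}
    (h : v.intValuation r ≤ WithZero.exp (-(N : ℤ))) :
    ‖algebraMap K (v.adicCompletion K) (algebraMap (𝓞 K) K r)‖ ≤ (p : ℝ)⁻¹ ^ N := by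
  have h1 := FinitePlace.norm_embedding_int K v r
  refine h1.le.trans ?_
  have h2 := (WithZeroMulInt.toNNReal_strictMono
    (NumberField.HeightOneSpectrum.one_lt_absNorm_nnreal v)).monotone h
  refine (NNReal.coe_le_coe.2 h2).trans (le_of_eq ?_)
  rw [toNNReal_exp]
  simp [hv]

omit [Fact p.Prime] in
theorem norm_natCast_prime (hv : Ideal.absNorm v.asIdeal = p)
    (hp : v.intValuation (p : 𝓞 K) = WithZero.exp (-1)) :
    ‖(p : v.adicCompletion K)‖ = (p : ℝ)⁻¹ := by
  have h1 := FinitePlace.norm_embedding_int K v (p : 𝓞 K)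
  rw [map_natCast, map_natCast] at h1
  rw [h1, hp, toNNReal_exp]
  simp [hv]

theorem norm_natCast_eq_norm_padic (hv : Ideal.absNorm v.asIdeal = p)
    (hp : v.intValuation (p : 𝓞 K) = WithZero.exp (-1)) (n : ℕ) :
    ‖(n : v.adicCompletion K)‖ = ‖(n : ℚ_[p])‖ := by
  rcases eq_or_ne n 0 with rfl | hn
  · simp
  obtain ⟨k, m, hm, rfl⟩ := Nat.exists_eq_pow_mul_and_not_dvd hn p (Fact.out : p.Prime).ne_one
  push_cast
  rw [norm_mul, norm_mul, norm_pow, norm_pow, norm_natCast_prime hv hp, Padic.norm_p]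
  congr 1
  rw [Padic.norm_natCast_eq_one_iff.2 ((Fact.out : p.Prime).coprime_iff_not_dvd.2 hm)]
  have h1 := (FinitePlace.norm_eq_one_iff_notMem K v (m : 𝓞 K)).2 fun hmem => by
    have hpv : (p : 𝓞 K) ∈ v.asIdeal := by
      rw [← pow_one v.asIdeal, ← v.intValuation_le_pow_iff_mem, hp]
      rfl
    obtain ⟨a, b, hab⟩ := Nat.isCoprime_iff_coprime.2
      ((Fact.out : p.Prime).coprime_iff_not_dvd.2 hm : Nat.Coprime p m)
    refine v.isPrime.ne_top ((Ideal.eq_top_iff_one _).2 ?_)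
    have : (a : 𝓞 K) * p + b * m = 1 := by exact_mod_cast congrArg (Int.cast : ℤ → 𝓞 K) hab
    rw [← this]
    exact add_mem (Ideal.mul_mem_left _ _ hpv) (Ideal.mul_mem_left _ _ hmem)
  rwa [map_natCast, map_natCast] at h1

theorem norm_ratCast_eq_norm_padic (hv : Ideal.absNorm v.asIdeal = p)
    (hp : v.intValuation (p : 𝓞 K) = WithZero.exp (-1)) (q : ℚ) :
    ‖(q : v.adicCompletion K)‖ = ‖(q : ℚ_[p])‖ := by
  have : CharZero (v.adicCompletion K) :=
    charZero_of_injective_algebraMap (algebraMap K (v.adicCompletion K)).injective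
  have hint : ∀ n : ℤ, ‖(n : v.adicCompletion K)‖ = ‖(n : ℚ_[p])‖ := fun n => by
    obtain ⟨n, rfl | rfl⟩ := n.eq_nat_or_neg <;>
      simp [norm_natCast_eq_norm_padic hv hp]
  rw [Rat.cast_def, Rat.cast_def, norm_div, norm_div, hint, norm_natCast_eq_norm_padic hv hp]

theorem denseRange_ratCast (hv : Ideal.absNorm v.asIdeal = p)
    (hp : v.intValuation (p : 𝓞 K) = WithZero.exp (-1)) :
    DenseRange ((↑) : ℚ → v.adicCompletion K) := by
  have : CharZero (v.adicCompletion K) :=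
    charZero_of_injective_algebraMap (algebraMap K (v.adicCompletion K)).injective
  let S := (Rat.castHom (v.adicCompletion K)).fieldRange.topologicalClosure
  have hS : (S : Set (v.adicCompletion K)) = closure (Set.range ((↑) : ℚ → _)) := rfl
  have hr : ∀ r : 𝓞 K, algebraMap K (v.adicCompletion K) (algebraMap (𝓞 K) K r) ∈ S := fun r => by
    rw [← SetLike.mem_coe, hS, Metric.mem_closure_iff]
    intro ε hε
    obtain ⟨N, hN⟩ := exists_pow_lt_of_lt_one hε (inv_prime_lt_one p)
    obtain ⟨n, hn⟩ := exists_int_intValuation_le hv hp N r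
    refine ⟨((n : ℚ) : v.adicCompletion K), ⟨n, rfl⟩, ?_⟩
    have h := norm_algebraMap_le_pow hv hn
    rw [map_sub, map_sub, map_intCast, map_intCast] at h
    rw [dist_eq_norm, Rat.cast_intCast]
    exact h.trans_lt hN
  have hK : ∀ a : K, algebraMap K (v.adicCompletion K) a ∈ S := fun a => by
    obtain ⟨x, y, -, rfl⟩ := IsFractionRing.div_surjective (A := 𝓞 K) a
    rw [map_div₀]
    exact S.div_mem (hr x) (hr y)
  intro x
  have := HeightOneSpectrum.denseRange_algebraMap K v x
  rw [← hS]
  refine closure_minimal ?_ (Subfield.isClosed_topologicalClosure _) this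
  rintro _ ⟨a, rfl⟩
  exact hK a

/-- The completion at a prime of degree one over `p` is `ℚ_p`. -/
theorem exists_adicCompletion_equiv (hK : Module.finrank ℚ K = 2) (hvv' : v ≠ v')
    (hsplit : Ideal.span {(p : 𝓞 K)} = v.asIdeal * v'.asIdeal) :
    ∃ e : v.adicCompletion K ≃+* ℚ_[p], Continuous e ∧ Continuous e.symm ∧
      ∀ x, x ∈ v.adicCompletionIntegers K ↔ ‖e x‖ ≤ 1 := by
  have hv := absNorm_eq_of_split hK hsplit
  have hp := intValuation_prime hvv' hsplit
  have : CharZero (v.adicCompletion K) :=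
    charZero_of_injective_algebraMap (algebraMap K (v.adicCompletion K)).injective
  obtain ⟨e, he⟩ := exists_padic_ringEquiv (norm_ratCast_eq_norm_padic hv hp)
    (denseRange_ratCast hv hp)
  have he' : ∀ x, ‖e.symm x‖ = ‖x‖ := fun x => by rw [← he, e.apply_symm_apply]
  refine ⟨e.symm, (AddMonoidHomClass.isometry_of_norm e.symm he').continuous,
    (AddMonoidHomClass.isometry_of_norm e he).continuous, fun x => ?_⟩
  rw [he', FinitePlace.norm_def, HeightOneSpectrum.mem_adicCompletionIntegers,
    ← WithZeroMulInt.toNNReal_le_one_iff (NumberField.HeightOneSpectrum.one_lt_absNorm_nnreal v),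
    ← NNReal.coe_le_coe, NNReal.coe_one]

end PadicEquiv

/-! ### Transport of the logarithm -/

section Transport

variable {W : WeierstrassCurve ℤ} {p : ℕ} [Fact p.Prime] {F L : Type*} [Field F] [Field L]
  [TopologicalSpace F] [TopologicalSpace L] [T2Space L] (e : F ≃+* L)

theorem formalLog_map (he : Continuous e) (he' : Continuous e.symm) (t : F) :
    e (formalLog W t) = formalLog W (e t) := by
  have : T2Space F := T2Space.of_injective_continuous e.injective he
  have h := Function.LeftInverse.map_tsum (L := .unconditional ℕ) (g := e)
    (fun n : ℕ => ((PowerSeries.coeff n (omegaSeries W) : ℤ) : F) / ((n : F) + 1) * t ^ (n + 1))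
    he he' e.left_inv
  rw [formalLog, formalLog, h]
  simp

omit [TopologicalSpace F] [TopologicalSpace L] [T2Space L] in
theorem Pt.z_map (P : Pt W F) : Pt.z W (Pt.map W (e : F →+* L) P) = e (Pt.z W P) := by
  rcases P.eq_zero_or_some with rfl | ⟨x, y, h, rfl⟩
  · exact (map_zero e).symm
  · exact ((map_div₀ e _ _).trans (by rw [map_neg]; rfl)).symm

theorem ptLog_map (he : Continuous e) (he' : Continuous e.symm) (u : ℚ) (P : Pt W F) :
    e (ptLog W p u P) = ptLog W p u (Pt.map W (e : F →+* L) P) := by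
  rw [ptLog, ptLog, map_mul, map_mul, map_inv₀, map_ratCast, map_natCast, formalLog_map e he he',
    ← Pt.z_map, map_nsmul]

theorem exists_ptLog_hom_of_equiv (hp : 2 < p) (e : F ≃+* ℚ_[p]) (he : Continuous e)
    (he' : Continuous e.symm) (hgood : ¬ (p : ℤ) ∣ W.Δ) (hap : ¬ ap W p ≡ 1 [ZMOD p])
    {u : ℚ} (hu : u ≠ 0) (hu' : padicValRat p u = 0) :
    ∃ L : Pt W F →+ ℤ_[p], (∀ P, (L P : ℚ_[p]) = e (ptLog W p u P)) ∧
      (∀ c, (∃ P, L P = c) ↔ (p : ℤ_[p]) ∣ c) ∧ ∀ P, L P = 0 → numPts W p • P = 0 := by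
  obtain ⟨L, hL, hL', hL''⟩ := exists_ptLog_hom hp hgood hap hu hu'
  refine ⟨L.comp (Pt.map W (e : F →+* ℚ_[p])), fun P => ?_, fun c => ?_, fun P hP => ?_⟩
  · exact (hL _).trans (ptLog_map e he he' u P).symm
  · rw [← hL']
    refine ⟨fun ⟨P, hP⟩ => ⟨_, hP⟩, fun ⟨P, hP⟩ => ⟨Pt.map W (e.symm : ℚ_[p] →+* F) P, ?_⟩⟩
    rw [AddMonoidHom.comp_apply, Pt.map_map, RingEquiv.comp_symm, Pt.map_id, hP]
  · refine Pt.map_injective W (e : F →+* ℚ_[p]) ?_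
    rw [map_zero, map_nsmul]
    exact hL'' _ hP

end Transport

/-! ### The Kummer map -/

section Kummer

variable {W : WeierstrassCurve ℤ}

theorem GPt.emb_toGPt {K F : Type*} [Field K] [Field F] [Algebra K F] (P : Pt W K) :
    GPt.emb W K F (Pt.toGPt W K P) = Pt.toGPt W F (Pt.map W (algebraMap K F) P) := by
  refine (Pt.map_map W _ _ P).trans (Eq.trans ?_ (Pt.map_map W _ _ P).symm)
  congr 1
  congr 1
  refine RingHom.ext fun x => ?_
  refine ((closureEmb K F).commutes x).trans ?_
  exact IsScalarTower.algebraMap_apply K F (AlgebraicClosure F) x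

theorem GPt.smul_toGPt {K : Type*} [Field K] (σ : Gal K) (P : Pt W K) :
    σ • Pt.toGPt W K P = Pt.toGPt W K P := by
  refine (Pt.map_map W _ _ P).trans ?_
  have h : (σ : AlgebraicClosure K →+* AlgebraicClosure K).comp
      (algebraMap K (AlgebraicClosure K)) = algebraMap K (AlgebraicClosure K) :=
    RingHom.ext fun x => σ.commutes x
  rw [h]
  rfl

theorem GPt.smul_nsmul {K : Type*} [Field K] (σ : Gal K) (n : ℕ) (Q : GPt W K) :
    σ • (n • Q) = n • (σ • Q) :=
  (DistribSMul.toAddMonoidHom (GPt W K) σ).map_nsmul _ _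

theorem exists_pow_nsmul_eq_zero {A : Type*} [AddCommGroup A] (p : ℕ) [Fact p.Prime]
    [Finite (AddCommGroup.primaryComponent A p)] :
    ∃ N : ℕ, ∀ (n : ℕ) (a : A), p ^ n • a = 0 → p ^ N • a = 0 := by
  let M := AddCommGroup.primaryComponent A p
  -- A crude exponent: an element of order `p ^ k` has `k < p ^ k ≤ Nat.card M`.
  refine ⟨Nat.card M, fun n a ha => ?_⟩
  obtain ⟨k, -, hk⟩ := (Nat.dvd_prime_pow Fact.out).1 (addOrderOf_dvd_of_nsmul_eq_zero ha)
  have hdvd := addOrderOf_dvd_natCard (⟨a, n, ha⟩ : M)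
  rw [← AddSubgroup.addOrderOf_coe, hk] at hdvd
  have hlt : k ≤ Nat.card M :=
    ((Nat.lt_pow_self (Fact.out : p.Prime).one_lt).trans_le
      (Nat.le_of_dvd Nat.card_pos hdvd)).le
  rw [← addOrderOf_dvd_iff_nsmul_eq_zero, hk]
  exact pow_dvd_pow p hlt

/-- The Tate module of a group with finite `p`-primary part vanishes: if `p ^ N` kills that part,
then `a n = p ^ N • a (n + N) = 0`. -/
theorem eq_zero_of_compatible {A : Type*} [AddCommGroup A] (p : ℕ) [Fact p.Prime]
    [Finite (AddCommGroup.primaryComponent A p)] {a : ℕ → A} (h : ∀ n, p ^ n • a n = 0)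
    (h' : ∀ n, p • a (n + 1) = a n) (n : ℕ) : a n = 0 := by
  obtain ⟨N, hN⟩ := exists_pow_nsmul_eq_zero (A := A) p
  have key : ∀ k, p ^ k • a (n + k) = a n := fun k => by
    induction k with
    | zero => simp
    | succ k ih => rw [pow_succ, mul_smul, ← add_assoc, h', ih]
  rw [← key N]
  exact hN _ _ (h _)

/-! ### Selmer classes and global points -/

section Global

variable {K : Type*} [Field K] [NumberField K] {p : ℕ} [Fact p.Prime]

omit [NumberField K] in
theorem H1.proj_mk (p n : ℕ) (ξ : Z1 (Gal K) (Tate W K p)) :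
    H1.proj W K p n (QuotientAddGroup.mk ξ) = QuotientAddGroup.mk (Z1.map (MonoidHom.id _)
      continuous_id (Tate.proj W K p n) (Tate.continuous_proj W K p n) (fun _ _ => rfl) ξ) := rfl

theorem Z1.ext' {G A : Type*} [Group G] [TopologicalSpace G] [AddCommGroup A]
    [DistribMulAction G A] [TopologicalSpace A] [IsTopologicalAddGroup A] {f g : Z1 G A}
    (h : ∀ σ, f.1 σ = g.1 σ) : f = g := Subtype.ext (funext h)

omit [NumberField K] [Fact p.Prime] in
theorem H1.nsmul_proj_succ (n : ℕ) (c : H1 (Gal K) (Tate W K p)) :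
    p • H1.proj W K p (n + 1) c = H1.proj W K p n c := by
  obtain ⟨ξ, rfl⟩ := QuotientAddGroup.mk_surjective c
  rw [H1.proj_mk, H1.proj_mk, ← QuotientAddGroup.mk_nsmul]
  exact congrArg _ (Z1.ext' fun σ => (ξ.1 σ).2.2 n)

omit [NumberField K] [Fact p.Prime] in
theorem H1.pow_nsmul_proj (n : ℕ) (c : H1 (Gal K) (Tate W K p)) :
    p ^ n • H1.proj W K p n c = 0 := by
  obtain ⟨ξ, rfl⟩ := QuotientAddGroup.mk_surjective c
  rw [H1.proj_mk, ← QuotientAddGroup.mk_nsmul]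
  refine (QuotientAddGroup.eq_zero_iff _).2 ?_
  convert zero_mem (B1 (Gal K) (GPt W K))
  exact Z1.ext' fun σ => Tate.pow_nsmul_proj W K p n (ξ.1 σ)

/-- If the `p`-primary part of the Tate--Shafarevich group is finite, then the Selmer group is the
completed Mordell--Weil group. -/
theorem proj_eq_zero_of_mem_sel (hSha : Finite (AddCommGroup.primaryComponent (Sha W K) p))
    (c : Sel W K p) (n : ℕ) : H1.proj W K p n c.1 = 0 := by
  have hmem : ∀ n, H1.proj W K p n c.1 ∈ Sha W K := fun n => (AddSubgroup.mem_iInf.1 c.2 n :)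
  exact congrArg Subtype.val (eq_zero_of_compatible (A := Sha W K) p
    (a := fun n => ⟨H1.proj W K p n c.1, hmem n⟩)
    (fun n => Subtype.ext (H1.pow_nsmul_proj n c.1))
    (fun n => Subtype.ext (H1.nsmul_proj_succ n c.1)) n)

variable {F : Type*} [Field F] [Algebra K F]

/-- At level `n` the class is the coboundary of a point `Q n` of `E(K̄)`, and `p ^ n • Q n` is
rational over `K`. Localizing these points gives a Kummer description of the restriction, which
agrees with `x` by uniqueness. -/
theorem exists_represents_of_proj_eq_zero {c : H1 (Gal K) (Tate W K p)} {x : PtHat W p F}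
    (hc : ∀ n, H1.proj W K p n c = 0) (hx : IsLoc W p K F c x) :
    ∃ P : ℕ → Pt W K, Represents x fun n => Pt.map W (algebraMap K F) (P n) := by
  obtain ⟨ξ, rfl⟩ := QuotientAddGroup.mk_surjective c
  have hQ : ∀ n, ∃ Q : GPt W K, ∀ σ : Gal K, Tate.proj W K p n (ξ.1 σ) = σ • Q - Q := fun n => by
    obtain ⟨Q, hQ⟩ := (QuotientAddGroup.eq_zero_iff _).1 (hc n)
    exact ⟨Q, hQ⟩
  choose Q hQ using hQ
  have hP : ∀ n, ∃ P : Pt W K, Pt.toGPt W K P = p ^ n • Q n := fun n => by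
    refine GPt.exists_of_fixed W K _ fun σ => ?_
    have h1 : p ^ n • (σ • Q n - Q n) = 0 := by rw [← hQ, Tate.pow_nsmul_proj]
    rw [smul_sub, sub_eq_zero] at h1
    rw [GPt.smul_nsmul, h1]
  choose P hP using hP
  have hR : ∀ n, ∃ R : Pt W K, P n - P (n + 1) = p ^ n • R := fun n => by
    obtain ⟨R, hR⟩ := GPt.exists_of_fixed W K (Q n - p • Q (n + 1)) fun σ => by
      have h1 : p • (σ • Q (n + 1) - Q (n + 1)) = σ • Q n - Q n := by
        rw [← hQ, ← hQ]
        exact (ξ.1 σ).2.2 n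
      rw [smul_sub] at h1
      have h3 : σ • Q n = Q n + (p • σ • Q (n + 1) - p • Q (n + 1)) := by rw [h1]; abel
      rw [smul_sub, GPt.smul_nsmul, h3]
      abel
    refine ⟨R, Pt.toGPt_injective W K ?_⟩
    rw [map_sub, map_nsmul, hR, hP, hP, smul_sub, pow_succ, mul_smul]
  obtain ⟨x', hx'⟩ := exists_represents_of_cauchy (p := p)
    (P := fun n => Pt.map W (algebraMap K F) (P n)) fun n => by
      obtain ⟨R, hR⟩ := hR n
      exact ⟨Pt.map W (algebraMap K F) R, by rw [← map_sub, hR, map_nsmul]⟩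
  have hloc : IsLoc W p K F (QuotientAddGroup.mk ξ) x' :=
    ⟨ξ, _, fun n => GPt.emb W K F (Q n), rfl, hx', fun n => by
      rw [← GPt.emb_toGPt, hP, map_nsmul], fun n σ => by
      rw [hQ, map_sub, GPt.emb_smul]⟩
  rw [hx.unique hloc]
  exact ⟨P, hx'⟩

omit [NumberField K] in
-- The coordinates of a point generate a finite extension, so its stabilizer is open.
theorem GPt.continuous_smul (Q : GPt W K) : Continuous fun σ : Gal K => σ • Q := by
  have hstab : ∀ᶠ σ in 𝓝 (1 : Gal K), σ • Q = Q := by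
    rcases Pt.eq_zero_or_some (W := W) Q with h | ⟨x, y, h, hQ⟩
    · exact Filter.Eventually.of_forall fun σ => by
        have h' : Q = (0 : GPt W K) := h
        rw [h']
        exact smul_zero σ
    · refine (krullTopology_mem_nhds_one_iff _ _ _).2 ⟨IntermediateField.adjoin K {x, y},
        IntermediateField.finiteDimensional_adjoin fun x _ => Algebra.IsIntegral.isIntegral x,
        fun σ hσ => ?_⟩
      have hσ' := (IntermediateField.mem_fixingSubgroup_iff _ _).1 hσ
      have hx : σ x = x := hσ' x (IntermediateField.subset_adjoin K _ (by simp))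
      have hy : σ y = y := hσ' y (IntermediateField.subset_adjoin K _ (by simp))
      change σ • Q = Q
      rw [hQ]
      exact Pt.some_congr _ _ hx hy
  rw [continuous_iff_continuousAt]
  intro σ₀
  rw [ContinuousAt, nhds_discrete (GPt W K), Filter.tendsto_pure]
  have h1 : Filter.Tendsto (fun σ : Gal K => σ₀⁻¹ * σ) (𝓝 σ₀) (𝓝 1) := by
    have := (continuous_const_mul σ₀⁻¹).tendsto σ₀
    rwa [inv_mul_cancel] at this
  filter_upwards [h1.eventually hstab] with σ hσ
  rw [mul_smul] at hσ
  rw [← hσ, smul_inv_smul]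
  exact congrArg _ hσ

theorem exists_isLoc_locPt_tmul (hΔ : W.Δ ≠ 0) (a : ℤ_[p]) (X : Pt W K) :
    ∃ c ∈ Sel W K p, IsLoc W p K F c (locPt W p K F (a ⊗ₜ X)) := by
  have hΔ' : (W.Δ : AlgebraicClosure K) ≠ 0 := Int.cast_ne_zero.2 hΔ
  have hdiv : ∀ Q : GPt W K, ∃ Q' : GPt W K, p • Q' = Q :=
    Pt.exists_nsmul_eq hΔ' (Fact.out : p.Prime).ne_zero
  choose D hD using hdiv
  let Y : ℕ → GPt W K := fun n => D^[n] (Pt.toGPt W K X)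
  have hY : ∀ n, p • Y (n + 1) = Y n := fun n => by
    simp only [Y, Function.iterate_succ_apply']
    exact hD _
  have hYX : ∀ n, p ^ n • Y n = Pt.toGPt W K X := fun n => by
    induction n with
    | zero => simp [Y]
    | succ n ih => rw [pow_succ, mul_smul, hY, ih]
  -- With `Y n` a compatible system of `p ^ n`-division points of `X`, the point `Q n` divides
  -- `a.appr n • X`. Since `p • Q (n + 1)` and `Q n` differ by a multiple of the rational point `X`,
  -- the elements `σ • Q n - Q n` form a point of the Tate module; the entry at level `0` vanishes
  -- as `a.appr 0 = 0`.
  let Q : ℕ → GPt W K := fun n => a.appr n • Y n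
  have hQ : ∀ n, ∃ k : ℕ, p • Q (n + 1) = Q n + k • Pt.toGPt W K X := fun n => by
    obtain ⟨k, hk⟩ := PadicInt.dvd_appr_sub_appr a n (n + 1) n.le_succ
    refine ⟨k, ?_⟩
    have hk' : a.appr (n + 1) = a.appr n + p ^ n * k := by
      have := PadicInt.appr_mono a n.le_succ
      lia
    simp only [Q]
    rw [smul_comm, hY, hk', add_smul, mul_comm, mul_smul, hYX]
  let ξ : Z1 (Gal K) (Tate W K p) := ⟨fun σ => ⟨fun n => σ • Q n - Q n, by
      simp [Q, PadicInt.appr], fun n => by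
      obtain ⟨k, hk⟩ := hQ n
      change p • (σ • Q (n + 1) - Q (n + 1)) = σ • Q n - Q n
      rw [smul_sub, ← GPt.smul_nsmul, hk, smul_add, GPt.smul_nsmul σ k, GPt.smul_toGPt]
      abel⟩, by
      refine Continuous.subtype_mk (continuous_pi fun n => ?_) _
      exact (GPt.continuous_smul (Q n)).sub continuous_const, fun σ τ => by
      refine Subtype.ext (funext fun n => ?_)
      change (σ * τ) • Q n - Q n = σ • Q n - Q n + σ • (τ • Q n - Q n)
      rw [mul_smul, smul_sub]
      abel⟩
  refine ⟨QuotientAddGroup.mk ξ, ?_, ξ, fun n => a.appr n • Pt.map W (algebraMap K F) X,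
    fun n => GPt.emb W K F (Q n), rfl, fun n => ?_, fun n => ?_, fun n σ => ?_⟩
  · refine AddSubgroup.mem_iInf.2 fun n => ?_
    have : H1.proj W K p n (QuotientAddGroup.mk ξ) = 0 :=
      (QuotientAddGroup.eq_zero_iff _).2 ⟨Q n, fun σ => rfl⟩
    rw [AddSubgroup.mem_comap, this]
    exact zero_mem _
  · change Submodule.Quotient.mk (a ⊗ₜ Pt.map W (algebraMap K F) X) = _
    rw [Submodule.Quotient.eq]
    have h : (1 : ℤ_[p]) ⊗ₜ[ℤ] (a.appr n • Pt.map W (algebraMap K F) X) =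
        (a.appr n : ℤ_[p]) • ((1 : ℤ_[p]) ⊗ₜ[ℤ] Pt.map W (algebraMap K F) X) := by
      rw [TensorProduct.tmul_smul, Nat.cast_smul_eq_nsmul]
    have h' : a ⊗ₜ[ℤ] Pt.map W (algebraMap K F) X =
        a • ((1 : ℤ_[p]) ⊗ₜ[ℤ] Pt.map W (algebraMap K F) X) := by
      rw [TensorProduct.smul_tmul', smul_eq_mul, mul_one]
    rw [h, h', ← sub_smul]
    refine Submodule.smul_mem_smul ?_ Submodule.mem_top
    rw [Ideal.span_singleton_pow]
    exact PadicInt.appr_spec n a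
  · rw [map_nsmul, ← GPt.emb_toGPt, ← hYX n, map_nsmul, smul_comm]
    simp only [Q, map_nsmul]
  · rw [← GPt.emb_smul, ← map_sub]
    rfl

theorem exists_isLoc_locPt (hΔ : W.Δ ≠ 0) (x : PtZp W p K) :
    ∃ c ∈ Sel W K p, IsLoc W p K F c (locPt W p K F x) := by
  induction x using TensorProduct.induction_on with
  | zero =>
    obtain ⟨c, hc, h⟩ := exists_isLoc_locPt_tmul (F := F) hΔ (0 : ℤ_[p]) (0 : Pt W K)
    exact ⟨c, hc, by rwa [TensorProduct.tmul_zero] at h⟩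
  | tmul a X => exact exists_isLoc_locPt_tmul hΔ a X
  | add x y hx hy =>
    obtain ⟨c, hc, h⟩ := hx
    obtain ⟨c', hc', h'⟩ := hy
    exact ⟨c + c', add_mem hc hc', by rw [map_add]; exact h.add h'⟩

variable (v : HeightOneSpectrum (𝓞 K))

theorem exists_represents_loc (hSha : Finite (AddCommGroup.primaryComponent (Sha W K) p))
    (c : Sel W K p) : ∃ P : ℕ → Pt W K,
      Represents (loc W p v c) fun n => Pt.map W (algebraMap K (v.adicCompletion K)) (P n) :=
  exists_represents_of_proj_eq_zero (proj_eq_zero_of_mem_sel hSha c) (loc_spec W p v c)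

theorem exists_loc_eq_locPt (hΔ : W.Δ ≠ 0) (x : PtZp W p K) :
    ∃ c : Sel W K p, loc W p v c = locPt W p K (v.adicCompletion K) x := by
  obtain ⟨c, hc, h⟩ := exists_isLoc_locPt (F := v.adicCompletion K) hΔ x
  exact ⟨⟨c, hc⟩, (loc_spec W p v ⟨c, hc⟩).unique h⟩

end Global

end Kummer

/-! ### Extension of an additive map to the completion -/

section Extension

variable {W : WeierstrassCurve ℤ} {p : ℕ} [Fact p.Prime] {F : Type*} [Field F]
  (L : Pt W F →+ ℤ_[p])

instance : IsAdicComplete (Ideal.span {(p : ℤ_[p])}) ℤ_[p] := by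
  rw [← PadicInt.maximalIdeal_eq_span_p]
  infer_instance

/-- The `ℤ_p`-linear extension of `L` to `E(F) ⊗ ℤ_p`. -/
def zpExt : PtZp W p F →ₗ[ℤ_[p]] ℤ_[p] :=
  LinearMap.liftBaseChange ℤ_[p] L.toIntLinearMap

@[simp]
theorem zpExt_tmul (a : ℤ_[p]) (P : Pt W F) : zpExt L (a ⊗ₜ[ℤ] P) = a * L P := by
  simp [zpExt]

/-- The extension of `L` to the completion. -/
def hatExt : PtHat W p F →ₗ[ℤ_[p]] ℤ_[p] :=
  (AdicCompletion.ofLinearEquiv (Ideal.span {(p : ℤ_[p])}) ℤ_[p]).symm.toLinearMap ∘ₗ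
    (AdicCompletion.map (Ideal.span {(p : ℤ_[p])}) (zpExt L)).restrictScalars ℤ_[p]

theorem of_hatExt (x : PtHat W p F) :
    AdicCompletion.of (Ideal.span {(p : ℤ_[p])}) ℤ_[p] (hatExt L x) =
      AdicCompletion.map (Ideal.span {(p : ℤ_[p])}) (zpExt L) x :=
  AdicCompletion.of_ofLinearEquiv_symm _ _

theorem hatExt_of (x : PtZp W p F) :
    hatExt L (AdicCompletion.of (Ideal.span {(p : ℤ_[p])}) _ x) = zpExt L x := by
  refine (AdicCompletion.ofLinearEquiv (Ideal.span {(p : ℤ_[p])}) ℤ_[p]).injective ?_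
  refine (of_hatExt L _).trans (AdicCompletion.map_of _ _ _)

theorem pow_dvd_hatExt_sub {x : PtHat W p F} {P : ℕ → Pt W F} (hx : Represents x P) (n : ℕ) :
    (p : ℤ_[p]) ^ n ∣ hatExt L x - L (P n) := by
  have h := congrArg (AdicCompletion.eval (Ideal.span {(p : ℤ_[p])}) ℤ_[p] n) (of_hatExt L x)
  have h' : AdicCompletion.eval (Ideal.span {(p : ℤ_[p])}) ℤ_[p] n
      (AdicCompletion.map (Ideal.span {(p : ℤ_[p])}) (zpExt L) x) =
        Submodule.Quotient.mk (L (P n)) := by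
    refine (AdicCompletion.map_val_apply _ _ _).trans ?_
    refine (congrArg _ (hx n)).trans ?_
    refine congrArg Submodule.Quotient.mk (?_ : zpExt L _ = _)
    simp
  have h2 := (Submodule.Quotient.eq _).1 (h.trans h')
  rwa [smul_eq_mul, Ideal.mul_top, Ideal.span_singleton_pow, Ideal.mem_span_singleton] at h2

/-- A kernel element is represented by points `P n` with `L (P n)` divisible by `p ^ n`. Up to an
element killed by `m`, hence divisible by every power of `p`, such points are themselves divisible
by high powers of `p`. -/
theorem hatExt_injective (hL : ∀ c, (p : ℤ_[p]) ∣ c → ∃ P, L P = c) {m : ℕ} (hm : m.Coprime p)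
    (hker : ∀ P, L P = 0 → m • P = 0) : Function.Injective (hatExt L) := by
  refine (injective_iff_map_eq_zero _).2 fun x hx => ?_
  obtain ⟨P, hP⟩ := exists_represents x
  have key : ∀ n, ∃ R : Pt W F, P (n + 1) = p ^ n • R := fun n => by
    obtain ⟨c, hc⟩ := pow_dvd_hatExt_sub L hP (n + 1)
    -- Only multiples of `p` are known to be values of `L`, so one power of `p` is lost; hence level
    -- `n + 1` is used for divisibility by `p ^ n`.
    obtain ⟨R, hR⟩ := hL (-(p * c)) ((dvd_mul_right _ _).neg_right)
    have h0 : L (P (n + 1) - p ^ n • R) = 0 := by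
      rw [map_sub, map_nsmul, hR, nsmul_eq_mul]
      rw [hx] at hc
      push_cast
      linear_combination -hc
    have h1 := hker _ h0
    have hcop : IsCoprime (m : ℤ) ((p ^ n : ℕ) : ℤ) :=
      Nat.isCoprime_iff_coprime.2 (hm.pow_right n)
    obtain ⟨a, b, hab⟩ := hcop
    refine ⟨R + b • (P (n + 1) - p ^ n • R), ?_⟩
    have h2 : P (n + 1) - p ^ n • R = p ^ n • b • (P (n + 1) - p ^ n • R) := by
      conv_lhs => rw [← one_zsmul (P (n + 1) - p ^ n • R), ← hab, add_smul, mul_smul, mul_smul,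
        natCast_zsmul, h1, smul_zero, zero_add, natCast_zsmul, smul_comm]
    rw [smul_add, ← h2]
    abel
  refine AdicCompletion.ext fun n => ?_
  obtain ⟨R, hR⟩ := key n
  refine (AdicCompletion.transitionMap_comp_eval_apply _ _ (Nat.le_succ n) x).symm.trans ?_
  refine (congrArg _ (hP (n + 1))).trans ?_
  refine (Submodule.Quotient.mk_eq_zero _).2 ?_
  rw [hR]
  exact tmul_pow_nsmul_mem W p n R

theorem range_hatExt (hL : ∀ c, (∃ P, L P = c) ↔ (p : ℤ_[p]) ∣ c) :
    LinearMap.range (hatExt L) = Ideal.span {(p : ℤ_[p])} := by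
  refine Submodule.ext fun c => ?_
  rw [Ideal.mem_span_singleton, LinearMap.mem_range]
  constructor
  · rintro ⟨x, rfl⟩
    obtain ⟨P, hP⟩ := exists_represents x
    have h := pow_dvd_hatExt_sub L hP 1
    rw [pow_one] at h
    exact (dvd_sub_left ((hL _).1 ⟨P 1, rfl⟩)).1 h
  · intro h
    obtain ⟨P, hP⟩ := (hL c).2 h
    exact ⟨_, (hatExt_of L (1 ⊗ₜ P)).trans (by simpa using hP)⟩

theorem tendsto_of_represents [TopologicalSpace F] {x : PtHat W p F} {P : ℕ → Pt W F}
    (hx : Represents x P) :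
    Filter.Tendsto (fun n => ((L (P n) : ℤ_[p]) : ℚ_[p])) Filter.atTop (𝓝 (hatExt L x)) := by
  rw [tendsto_iff_norm_sub_tendsto_zero]
  refine squeeze_zero (fun _ => norm_nonneg _) (fun n => ?_)
    (tendsto_pow_atTop_nhds_zero_of_lt_one (inv_prime_pos p).le (inv_prime_lt_one p))
  obtain ⟨c, hc⟩ := pow_dvd_hatExt_sub L hx n
  rw [norm_sub_rev, ← PadicInt.coe_sub, PadicInt.padic_norm_e_of_padicInt, hc, norm_mul, norm_pow,
    PadicInt.norm_p]
  exact mul_le_of_le_one_right (by positivity) (PadicInt.norm_le_one c)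

end Extension

/-! ### Ideals of `ℤ_p` -/

section Ideals

variable {p : ℕ} [Fact p.Prime]

theorem natCard_quotient_span_p : Nat.card (ℤ_[p] ⧸ Ideal.span {(p : ℤ_[p])}) = p := by
  rw [← PadicInt.maximalIdeal_eq_span_p]
  exact (Nat.card_congr (PadicInt.residueField (p := p)).toEquiv).trans (Nat.card_zmod p)

theorem finite_quotient_span {a : ℤ_[p]} (ha : a ≠ 0) :
    Finite (ℤ_[p] ⧸ Ideal.span {a}) := by
  have h : Ideal.span {a} = Ideal.span {(p : ℤ_[p]) ^ a.valuation} := by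
    conv_lhs => rw [PadicInt.unitCoeff_spec ha]
    exact Ideal.span_singleton_mul_left_unit (Units.isUnit _) _
  rw [h, ← PadicInt.ker_toZModPow]
  exact Finite.of_injective _ (RingHom.kerLift_injective (PadicInt.toZModPow (p := p) a.valuation))

/-- A nonzero ideal of `ℤ_p` contains a power of `p`, so it is closed. -/
theorem mem_span_of_forall_pow {a b : ℤ_[p]} (ha : a ≠ 0)
    (h : ∀ n : ℕ, ∃ c ∈ Ideal.span {a}, (p : ℤ_[p]) ^ n ∣ b - c) : b ∈ Ideal.span {a} := by
  obtain ⟨c, hc, hbc⟩ := h a.valuation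
  have h' : a ∣ p ^ a.valuation := by
    refine ⟨((PadicInt.unitCoeff ha)⁻¹ : ℤ_[p]ˣ), ?_⟩
    have h := congrArg (· * (((PadicInt.unitCoeff ha)⁻¹ : ℤ_[p]ˣ) : ℤ_[p]))
      (PadicInt.unitCoeff_spec ha)
    refine Eq.trans ?_ h.symm
    rw [mul_right_comm, Units.mul_inv, one_mul]
  rw [← sub_add_cancel b c]
  exact add_mem (Ideal.mem_span_singleton.2 (h'.trans hbc)) hc

end Ideals

/-! ### The cokernel of the localization map -/

section Cokernel

variable {W : WeierstrassCurve ℤ} {p : ℕ} [Fact p.Prime]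

theorem hatExt_locPt_tmul {K F : Type*} [Field K] [Field F] [Algebra K F] (L : Pt W F →+ ℤ_[p])
    (P : Pt W K) : hatExt L (locPt W p K F (1 ⊗ₜ P)) = L (Pt.map W (algebraMap K F) P) := by
  refine (hatExt_of L _).trans ?_
  simp

/-- If `y₁, …, y_r, y` is a basis of `M` whose first `r` members are a basis of the kernel of `f`,
then `f y ≠ 0` and `f y` spans the image of `f`. -/
theorem basis_last_spec {R M N : Type*} [CommRing R] [Nontrivial R] [AddCommGroup M] [Module R M]
    [AddCommGroup N] [Module R N] (f : M →ₗ[R] N) {r : ℕ} (y : Module.Basis (Fin (r + 1)) R M)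
    (hy : Submodule.span R (Set.range fun i : Fin r => y i.castSucc) = LinearMap.ker f) :
    f (y (Fin.last r)) ≠ 0 ∧ ∀ m, ∃ a : R, f m = a • f (y (Fin.last r)) := by
  refine ⟨fun h => ?_, fun m => ⟨y.repr m (Fin.last r), ?_⟩⟩
  · have h1 : y (Fin.last r) ∈ Submodule.span R (y '' Set.range Fin.castSucc) := by
      rw [← Set.range_comp]
      exact hy ▸ (LinearMap.mem_ker.2 h)
    refine y.linearIndependent.notMem_span_image ?_ h1
    rintro ⟨i, hi⟩
    exact (Fin.castSucc_lt_last i).ne hi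
  · have h0 : ∀ i : Fin r, f (y i.castSucc) = 0 := fun i =>
      LinearMap.mem_ker.1 (hy ▸ Submodule.subset_span ⟨i, rfl⟩)
    conv_lhs => rw [← y.sum_repr m]
    rw [map_sum, Fin.sum_univ_castSucc]
    simp only [map_smul, h0, smul_zero, Finset.sum_const_zero, zero_add]

variable {K : Type*} [Field K] [NumberField K] (v : HeightOneSpectrum (𝓞 K))

/-- The image of the Selmer group under the extended logarithm is generated by the logarithm of the
last member of an adapted basis. -/
theorem map_hatExt_range_loc (hΔ : W.Δ ≠ 0)
    (hSha : Finite (AddCommGroup.primaryComponent (Sha W K) p))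
    (L : Pt W (v.adicCompletion K) →+ ℤ_[p]) (hL : Function.Injective (hatExt L)) {r : ℕ}
    (y : Module.Basis (Fin (r + 1)) ℤ_[p] (PtZp W p K))
    (hy : Submodule.span ℤ_[p] (Set.range fun i : Fin r => y i.castSucc) =
      LinearMap.ker (locPt W p K (v.adicCompletion K))) :
    hatExt L (locPt W p K (v.adicCompletion K) (y (Fin.last r))) ≠ 0 ∧
    (loc W p v).range.map (hatExt L).toAddMonoidHom = (Ideal.span
      {hatExt L (locPt W p K (v.adicCompletion K) (y (Fin.last r)))}).toAddSubgroup := by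
  obtain ⟨h0, hs⟩ := basis_last_spec _ y hy
  have hl := (map_ne_zero_iff _ hL).2 h0
  refine ⟨hl, le_antisymm ?_ ?_⟩
  · rintro _ ⟨_, ⟨c, rfl⟩, rfl⟩
    -- The localization of a Selmer class is only a limit of global points, whose logarithms lie in
    -- the ideal; closedness of the ideal finishes the argument.
    refine mem_span_of_forall_pow hl fun n => ?_
    obtain ⟨P, hP⟩ := exists_represents_loc v hSha c
    refine ⟨_, ?_, pow_dvd_hatExt_sub L hP n⟩
    obtain ⟨a, ha⟩ := hs (1 ⊗ₜ P n)
    rw [← hatExt_locPt_tmul, ha, map_smul]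
    exact Ideal.mul_mem_left _ _ (Ideal.mem_span_singleton_self _)
  · intro b hb
    obtain ⟨a, rfl⟩ := Ideal.mem_span_singleton'.1 hb
    obtain ⟨c, hc⟩ := exists_loc_eq_locPt v hΔ (a • y (Fin.last r))
    refine ⟨_, ⟨c, rfl⟩, ?_⟩
    rw [hc, map_smul]
    exact map_smul (hatExt L) _ _

/-- `[f(M) : f(H)] = [M : H]` for an injective `f` with image of index `p`. -/
theorem natCard_quotient_range_loc (L : Pt W (v.adicCompletion K) →+ ℤ_[p])
    (hL : Function.Injective (hatExt L))
    (hL' : LinearMap.range (hatExt L) = Ideal.span {(p : ℤ_[p])}) {l : ℤ_[p]}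
    (hl : (loc W p v).range.map (hatExt L).toAddMonoidHom = (Ideal.span {l}).toAddSubgroup) :
    Nat.card (ℤ_[p] ⧸ Ideal.span {l}) =
      Nat.card (PtHat W p (v.adicCompletion K) ⧸ (loc W p v).range) * p := by
  have h := AddSubgroup.index_map_of_injective (loc W p v).range
    (f := (hatExt L).toAddMonoidHom) hL
  have h' : (hatExt L).toAddMonoidHom.range = (Ideal.span {(p : ℤ_[p])}).toAddSubgroup :=
    congrArg Submodule.toAddSubgroup hL'
  rw [hl, h'] at h
  refine h.trans (congrArg _ natCard_quotient_span_p)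

theorem quotient_span_equiv {R S : Type*} [CommRing R] [CommRing S] (e : R ≃+* S) (a : R) :
    Nonempty (R ⧸ Ideal.span {a} ≃+* S ⧸ Ideal.span {e a}) :=
  ⟨Ideal.quotientEquiv _ _ e (by rw [Ideal.map_span, Set.image_singleton]; rfl)⟩

end Cokernel

end EllSelmer
end

/-! ### The index formula -/

theorem mainTheorem7 (p : ℕ) [Fact p.Prime] (hp : 2 < p)
    (W : WeierstrassCurve ℤ) (hgood : ¬ (p : ℤ) ∣ W.Δ) (hap : ¬ EllSelmer.ap W p ≡ 1 [ZMOD p])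
    (K : Type*) [Field K] [NumberField K] (hK : Module.finrank ℚ K = 2) (hK' : IsTotallyComplex K)
    (v v' : HeightOneSpectrum (𝓞 K)) (hvv' : v ≠ v')
    (hsplit : Ideal.span {(p : 𝓞 K)} = v.asIdeal * v'.asIdeal)
    (hSha : Finite (AddCommGroup.primaryComponent (EllSelmer.Sha W K) p))
    (u : ℚ) (hu : u ≠ 0) (hu' : padicValRat p u = 0)
    (r : ℕ) (y : Module.Basis (Fin (r + 1)) ℤ_[p] (EllSelmer.PtZp W p K))
    (hy : Submodule.span ℤ_[p] (Set.range fun i : Fin r => y i.castSucc) =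
      LinearMap.ker (EllSelmer.locPt W p K (v.adicCompletion K))) :
    ∃ l : v.adicCompletionIntegers K,
      EllSelmer.HasLog u (EllSelmer.locPt W p K (v.adicCompletion K) (y (Fin.last r)))
        (l : v.adicCompletion K) ∧
      Finite (EllSelmer.PtHat W p (v.adicCompletion K) ⧸ (EllSelmer.loc W p v).range) ∧
      Finite (v.adicCompletionIntegers K ⧸ Ideal.span {l}) ∧
      (Nat.card (EllSelmer.PtHat W p (v.adicCompletion K) ⧸ (EllSelmer.loc W p v).range) : ℚ) =
        (p : ℚ)⁻¹ * Nat.card (v.adicCompletionIntegers K ⧸ Ideal.span {l}) := by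
  obtain ⟨e, he, he', hv⟩ := EllSelmer.exists_adicCompletion_equiv (p := p) hK hvv' hsplit
  obtain ⟨L, hL, hLr, hLk⟩ :=
    EllSelmer.exists_ptLog_hom_of_equiv hp e he he' hgood hap hu hu'
  have hΔ : W.Δ ≠ 0 := fun h => hgood (h ▸ dvd_zero _)
  have hm : (EllSelmer.numPts W p).Coprime p :=
    (Padic.norm_natCast_eq_one_iff.1 (EllSelmer.norm_numPts hap)).symm
  have hinj := EllSelmer.hatExt_injective L (fun c => (hLr c).2) hm hLk
  obtain ⟨hl0, hlr⟩ := EllSelmer.map_hatExt_range_loc v hΔ hSha L hinj y hy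
  set x := EllSelmer.locPt W p K (v.adicCompletion K) (y (Fin.last r))
  have hcard := EllSelmer.natCard_quotient_range_loc v L hinj (EllSelmer.range_hatExt L hLr) hlr
  -- The identification of the local ring of integers with `ℤ_p` carries the value of `hatExt L`
  -- back to the required `l`.
  let eO : v.adicCompletionIntegers K ≃+* ℤ_[p] :=
    { toFun a := ⟨e a, (hv _).1 a.2⟩
      invFun b := ⟨e.symm b, (hv _).2 (by rw [e.apply_symm_apply]; exact b.2)⟩
      left_inv a := Subtype.ext (e.symm_apply_apply _)
      right_inv b := Subtype.ext (e.apply_symm_apply _)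
      map_mul' a b := Subtype.ext (map_mul e _ _)
      map_add' a b := Subtype.ext (map_add e _ _) }
  have hfin := EllSelmer.finite_quotient_span hl0
  obtain ⟨q⟩ := EllSelmer.quotient_span_equiv eO (eO.symm (EllSelmer.hatExt L x))
  rw [eO.apply_symm_apply] at q
  refine ⟨eO.symm (EllSelmer.hatExt L x), fun P hP => ?_, ?_, Finite.of_equiv _ q.symm.toEquiv, ?_⟩
  · refine ((he'.tendsto _).comp (EllSelmer.tendsto_of_represents L hP)).congr fun n => ?_
    exact (congrArg e.symm (hL (P n))).trans (e.symm_apply_apply _)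
  -- An infinite cokernel would have `Nat.card` zero, whereas by `hcard` its product with `p` is the
  -- cardinality of a finite nonempty quotient.
  · refine Nat.finite_of_card_ne_zero fun h => ?_
    rw [h, zero_mul] at hcard
    exact Nat.card_pos.ne' hcard
  · have hp0 : (p : ℚ) ≠ 0 := Nat.cast_ne_zero.2 (Fact.out : p.Prime).ne_zero
    rw [Nat.card_congr q.toEquiv, hcard, Nat.cast_mul, mul_comm (Nat.cast _), inv_mul_cancel_left₀ hp0]
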